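/- Let $X$ be a compact Hausdorff space. A $C(X)$-algebra is a C*-algebra $A$ together with a unital $*$-homomorphism from $C(X)$ into the centre of the multiplier algebra $M(A)$. Its fibre at $x\in X$ is $A_x=A/C_x(X)A$, where $C_x(X)A$ is the closed ideal generated by $C_x(X)=\{f\in C(X): f(x)=0\}$, and $a_x$ is the image of $a$ in $A_x$; $A$ is a continuous field if $x\mapsto\|a_x\|$ is continuous for every $a\in A$. For $C(X)$-algebras $A$ and $B$, let $A\otimes^m_{C(X)}B$ be the Hausdorff completion of the algebraic tensor product $A\otimes_{alg}B$ for the C*-seminorm $\|\alpha\|_m=\sup_{x\in X}\|\alpha_x\|_{A_x\otimes_{\min}B_x}$, where $\alpha_x$ is the image of $\alpha$ in $A_x\otimes_{alg}B_x$ and $\|\cdot\|_{A_x\otimes_{\min}B_x}$ is the spatial (minimal) C*-norm; it is a $C(X)$-algebra with $f\cdot(a\otimes b)=fa\otimes b=a\otimes fb$. For a Hilbert $C(X)$-module $\mathcal E$, let $\mathcal L(\mathcal E)$ be the algebra of adjointable operators on it, and let $\mathcal E_x$ be the Hilbert space obtained from $\mathcal E$ by separation and completion for $\langle\xi,\eta\rangle(x)$.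 A field of faithful representations of $A$ in $\mathcal E$ is a $C(X)$-linear $*$-homomorphism $\pi:A\to\mathcal L(\mathcal E)$ such that for every $x\in X$ the induced representation $\pi_x$ of $A$ on $\mathcal E_x$ factors through a faithful representation of $A_x$. The Hilbert $B$-module $\mathcal E\otimes_{C(X)}B$ is the Hausdorff completion of $\mathcal E\otimes_{alg}B$ for the $B$-valued inner product $\langle\xi\otimes b,\eta\otimes c\rangle=b^*(\langle\xi,\eta\rangle c)$; a function $f\in C(X)$ acts on it by $\xi\otimes b\mapsto\xi\otimes fb$. (1) Let $A$ and $B$ be $C(X)$-algebras and let $\pi$ be a field of faithful representations of $A$ in a Hilbert $C(X)$-module $\mathcal E$. Then $a\otimes b\mapsto\pi(a)\otimes b$ induces a faithful $C(X)$-linear representation of $A\otimes^m_{C(X)}B$ in the Hilbert $B$-module $\mathcal E\otimes_{C(X)}B$: there is an injective $*$-homomorphism $\Psi:A\otimes^m_{C(X)}B\to\mathcal L(\mathcal E\otimes_{C(X)}B)$ with $\Psi(a\otimes b)(\xi\otimes c)=\pi(a)\xi\otimes bc$ for all $a\in A$, $b,c\in B$, $\xi\in\mathcal E$, and $\Psi(fd)=f\,\Psi(d)$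 for all $f\in C(X)$, $d\in A\otimes^m_{C(X)}B$. (2) The minimal tensor product over $C(X)$ is associative for separable continuous fields: if $A_1,A_2,A_3$ are separable $C(X)$-algebras which are continuous fields, there is a $C(X)$-linear $*$-isomorphism $$(A_1\otimes^m_{C(X)}A_2)\otimes^m_{C(X)}A_3\;\cong\;A_1\otimes^m_{C(X)}(A_2\otimes^m_{C(X)}A_3),\qquad (a_1\otimes a_2)\otimes a_3\mapsto a_1\otimes(a_2\otimes a_3).$$ -/

import Mathlib

open scoped TensorProduct ComplexOrder MultiplierAlgebra
open UniformSpace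

noncomputable section

namespace CX

section Basic

/-- A `C(X)`-algebra: a C⋆-algebra `A` with a unital ⋆-homomorphism from `C(X)` to the centre of
the multiplier algebra of `A`. -/
class CXAlgebra (X : Type*) [TopologicalSpace X] [CompactSpace X] (A : Type*)
    [NonUnitalCStarAlgebra A] where
  toMultiplier : C(X, ℂ) →⋆ₐ[ℂ] 𝓜(ℂ, A)
  central : ∀ (f : C(X, ℂ)) (m : 𝓜(ℂ, A)), Commute (toMultiplier f) m

variable {X : Type*} [TopologicalSpace X] [CompactSpace X]
variable {A : Type*} [NonUnitalCStarAlgebra A]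

lemma eq_of_mul_left {a b : A} (h : ∀ c, c * a = c * b) : a = b := by
  have h1 : star (a - b) * (a - b) = 0 := by rw [mul_sub, h, sub_self]
  exact sub_eq_zero.1 (CStarRing.star_mul_self_eq_zero_iff _ |>.1 h1)

lemma eq_of_mul_right {a b : A} (h : ∀ c, a * c = b * c) : a = b := by
  have h1 : (a - b) * star (a - b) = 0 := by rw [sub_mul, h, sub_self]
  exact sub_eq_zero.1 (CStarRing.mul_star_self_eq_zero_iff _ |>.1 h1)

/-- The action `a ↦ f a` of a function `f ∈ C(X)` on a `C(X)`-algebra. -/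
def act [CXAlgebra X A] (f : C(X, ℂ)) : A →L[ℂ] A := (CXAlgebra.toMultiplier (A := A) f).fst

variable [CXAlgebra X A]

lemma act_mul (f : C(X, ℂ)) (a b : A) : act f (a * b) = act f a * b := by
  refine eq_of_mul_left fun c => ?_
  simp only [act]
  rw [← DoubleCentralizer.central, ← mul_assoc, DoubleCentralizer.central, mul_assoc]

lemma mul_act (f : C(X, ℂ)) (a b : A) : a * act f b = act f (a * b) := by
  have h := congr(($(CXAlgebra.central (A := A) f (a : 𝓜(ℂ, A)))).fst b)
  simpa [act] using h.symm

lemma snd_eq_act (f : C(X, ℂ)) (a : A) :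
    (CXAlgebra.toMultiplier (A := A) f).snd a = act f a := by
  refine eq_of_mul_right fun c => ?_
  rw [DoubleCentralizer.central, ← act_mul, ← mul_act]; rfl

lemma star_act (f : C(X, ℂ)) (a : A) : star (act f a) = act (star f) (star a) := by
  rw [← snd_eq_act]
  simp only [act, map_star, DoubleCentralizer.star_fst, star_star]

lemma norm_act_le (f : C(X, ℂ)) (a : A) : ‖act f a‖ ≤ ‖f‖ * ‖a‖ := by
  refine (ContinuousLinearMap.le_opNorm _ _).trans ?_
  gcongr
  rw [act, DoubleCentralizer.norm_fst]
  exact NonUnitalStarAlgHom.norm_apply_le _ _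

@[simp] lemma act_one (a : A) : act (1 : C(X, ℂ)) a = a := by simp [act]
lemma act_act (f g : C(X, ℂ)) (a : A) : act f (act g a) = act (f * g) a := by simp [act]
lemma act_add (f g : C(X, ℂ)) (a : A) : act (f + g) a = act f a + act g a := by simp [act]
lemma act_sub (f g : C(X, ℂ)) (a : A) : act (f - g) a = act f a - act g a := by simp [act]
@[simp] lemma act_zero (a : A) : act (0 : C(X, ℂ)) a = 0 := by simp [act]
lemma act_smul (z : ℂ) (f : C(X, ℂ)) (a : A) : act (z • f) a = z • act f a := by simp [act]

/-- Construction of a `C(X)`-algebra from an action by bounded operators. -/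
@[reducible] def CXAlgebra.ofAct {D : Type*} [NonUnitalCStarAlgebra D] (L : C(X, ℂ) → D →L[ℂ] D)
    (h_one : ∀ d, L 1 d = d) (h_mul : ∀ f g d, L (f * g) d = L f (L g d))
    (h_add : ∀ f g d, L (f + g) d = L f d + L g d)
    (h_smul : ∀ (z : ℂ) f d, L (z • f) d = z • L f d)
    (h_star : ∀ f d, L (star f) (star d) = star (L f d))
    (h_left : ∀ f d e, L f (d * e) = L f d * e) (h_right : ∀ f d e, L f (d * e) = d * L f e) :
    CXAlgebra X D where
  toMultiplier :=
    { toFun := fun f => ⟨(L f, L f), fun d e => by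
        show L f d * e = d * L f e
        rw [← h_left, h_right]⟩
      map_one' := by
        ext d
        · exact h_one d
        · exact h_one d
      map_mul' := fun f g => by
        ext d
        · exact h_mul f g d
        · show L (f * g) d = L g (L f d)
          rw [mul_comm, h_mul]
      map_zero' := by
        ext d
        · have := h_smul 0 0 d
          simpa using this
        · have := h_smul 0 0 d
          simpa using this
      map_add' := fun f g => by
        ext d
        · exact h_add f g d
        · exact h_add f g d
      commutes' := fun z => by
        ext d
        · have := h_smul z 1 d
          rw [h_one] at this
          simpa [Algebra.algebraMap_eq_smul_one] using this
        · have := h_smul z 1 d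
          rw [h_one] at this
          simpa [Algebra.algebraMap_eq_smul_one] using this
      map_star' := fun f => by
        ext d
        · show L (star f) d = star (L f (star d))
          rw [← h_star, star_star]
        · show L (star f) d = star (L f (star d))
          rw [← h_star, star_star] }
  central := fun f m => by
    have key : ∀ d, L f (m.fst d) = m.fst (L f d) := fun d => by
      refine eq_of_mul_left fun c => ?_
      rw [← h_right, ← m.central, h_right, m.central]
    have key' : ∀ d, L f (m.snd d) = m.snd (L f d) := fun d => by
      refine eq_of_mul_right fun c => ?_
      rw [← h_left, m.central, m.central, ← h_left]
    ext d
    · exact key d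
    · exact (key' d).symm

end Basic

section Fibre

variable {X : Type*} [TopologicalSpace X] [CompactSpace X]
variable (A : Type*) [NonUnitalCStarAlgebra A] [CXAlgebra X A]

/-- The closed ideal `C_x(X) A`, where `C_x(X)` is the ideal of functions vanishing at `x`. -/
def fibreIdeal (x : X) : Submodule ℂ A :=
  (Submodule.span ℂ {b | ∃ (f : C(X, ℂ)) (a : A), f x = 0 ∧ b = act f a}).topologicalClosure

instance isClosed_fibreIdeal (x : X) : IsClosed (fibreIdeal A x : Set A) :=
  Submodule.isClosed_topologicalClosure _

/-- The fibre `A_x = A / C_x(X) A`, with the quotient norm. -/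
def Fibre (x : X) : Type _ := A ⧸ fibreIdeal A x

instance (x : X) : NormedAddCommGroup (Fibre A x) :=
  inferInstanceAs (NormedAddCommGroup (A ⧸ fibreIdeal A x))
instance (x : X) : NormedSpace ℂ (Fibre A x) :=
  inferInstanceAs (NormedSpace ℂ (A ⧸ fibreIdeal A x))
instance (x : X) : CompleteSpace (Fibre A x) :=
  inferInstanceAs (CompleteSpace (A ⧸ fibreIdeal A x))

variable {A}

lemma act_mem_fibreIdeal (x : X) (f : C(X, ℂ)) {a : A} (ha : a ∈ fibreIdeal A x) :
    act f a ∈ fibreIdeal A x := by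
  refine SetLike.le_def.1 (Submodule.topologicalClosure_minimal (t := (fibreIdeal A x).comap (act f).toLinearMap)
    _ ?_ ?_) ha
  · rw [Submodule.span_le]
    rintro _ ⟨g, a, hg, rfl⟩
    refine Submodule.le_topologicalClosure _ (Submodule.subset_span ⟨f * g, a, by simp [hg], ?_⟩)
    exact act_act f g a
  · exact (isClosed_fibreIdeal A x).preimage (act f).continuous

lemma mul_mem_fibreIdeal (x : X) (b : A) {a : A} (ha : a ∈ fibreIdeal A x) :
    b * a ∈ fibreIdeal A x := by
  refine SetLike.le_def.1 (Submodule.topologicalClosure_minimal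
    (t := (fibreIdeal A x).comap (ContinuousLinearMap.mul ℂ A b).toLinearMap)
    _ ?_ ?_) ha
  · rw [Submodule.span_le]
    rintro _ ⟨g, a, hg, rfl⟩
    exact Submodule.le_topologicalClosure _ (Submodule.subset_span ⟨g, b * a, hg, mul_act g b a⟩)
  · exact (isClosed_fibreIdeal A x).preimage
      (ContinuousLinearMap.mul ℂ A b).continuous

lemma star_mem_fibreIdeal (x : X) {a : A} (ha : a ∈ fibreIdeal A x) :
    star a ∈ fibreIdeal A x := by
  refine SetLike.le_def.1 (Submodule.topologicalClosure_minimal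
    (t := (fibreIdeal A x).comap (starₗᵢ ℂ (E := A)).toLinearEquiv.toLinearMap)
    _ ?_ ?_) ha
  · rw [Submodule.span_le]
    rintro _ ⟨g, a, hg, rfl⟩
    refine Submodule.le_topologicalClosure _ (Submodule.subset_span ⟨star g, star a, ?_, ?_⟩)
    · simp [hg]
    · exact star_act g a
  · exact (isClosed_fibreIdeal A x).preimage continuous_star

lemma mul_mem_fibreIdeal' (x : X) (b : A) {a : A} (ha : a ∈ fibreIdeal A x) :
    a * b ∈ fibreIdeal A x := by
  have := star_mem_fibreIdeal x (mul_mem_fibreIdeal x (star b) (star_mem_fibreIdeal x ha))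
  simpa using this

/-- The quotient map `a ↦ a_x`, as a linear map. -/
def toFibreₗ (x : X) : A →ₗ[ℂ] Fibre A x := (fibreIdeal A x).mkQ

lemma toFibreₗ_surjective (x : X) : Function.Surjective (toFibreₗ (A := A) x) :=
  Submodule.mkQ_surjective _

lemma toFibreₗ_eq_iff (x : X) {a b : A} : toFibreₗ x a = toFibreₗ x b ↔ a - b ∈ fibreIdeal A x :=
  Submodule.Quotient.eq _

instance (x : X) : Mul (Fibre A x) where
  mul := Quotient.map₂ (· * ·) fun a a' ha b b' hb => by
    replace ha := (Submodule.quotientRel_def _).1 ha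
    replace hb := (Submodule.quotientRel_def _).1 hb
    refine (Submodule.quotientRel_def _).2 ?_
    have : a * b - a' * b' = (a - a') * b + a' * (b - b') := by noncomm_ring
    rw [this]
    exact add_mem (mul_mem_fibreIdeal' x b ha) (mul_mem_fibreIdeal x a' hb)

instance (x : X) : Star (Fibre A x) where
  star := Quotient.map star fun a a' ha => by
    replace ha := (Submodule.quotientRel_def _).1 ha
    refine (Submodule.quotientRel_def _).2 ?_
    rw [← star_sub]
    exact star_mem_fibreIdeal x ha

lemma toFibreₗ_mul (x : X) (a b : A) : toFibreₗ x (a * b) = toFibreₗ x a * toFibreₗ x b := rfl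
lemma toFibreₗ_star (x : X) (a : A) : toFibreₗ x (star a) = star (toFibreₗ x a) := rfl

instance (x : X) : NonUnitalRing (Fibre A x) where
  __ : AddCommGroup (Fibre A x) := inferInstance
  left_distrib a b c := by
    obtain ⟨a, rfl⟩ := toFibreₗ_surjective x a
    obtain ⟨b, rfl⟩ := toFibreₗ_surjective x b
    obtain ⟨c, rfl⟩ := toFibreₗ_surjective x c
    change toFibreₗ x a * (toFibreₗ x b + toFibreₗ x c) = _
    simp only [← toFibreₗ_mul, ← map_add, mul_add]
  right_distrib a b c := by
    obtain ⟨a, rfl⟩ := toFibreₗ_surjective x a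
    obtain ⟨b, rfl⟩ := toFibreₗ_surjective x b
    obtain ⟨c, rfl⟩ := toFibreₗ_surjective x c
    change (toFibreₗ x a + toFibreₗ x b) * toFibreₗ x c = _
    simp only [← toFibreₗ_mul, ← map_add, add_mul]
  zero_mul a := by
    obtain ⟨a, rfl⟩ := toFibreₗ_surjective x a
    change (0 : Fibre A x) * _ = 0
    rw [← map_zero (toFibreₗ (A := A) x), ← toFibreₗ_mul, zero_mul]
  mul_zero a := by
    obtain ⟨a, rfl⟩ := toFibreₗ_surjective x a
    change _ * (0 : Fibre A x) = 0
    rw [← map_zero (toFibreₗ (A := A) x), ← toFibreₗ_mul, mul_zero]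
  mul_assoc a b c := by
    obtain ⟨a, rfl⟩ := toFibreₗ_surjective x a
    obtain ⟨b, rfl⟩ := toFibreₗ_surjective x b
    obtain ⟨c, rfl⟩ := toFibreₗ_surjective x c
    simp only [← toFibreₗ_mul, mul_assoc]

instance (x : X) : StarRing (Fibre A x) where
  star_involutive a := by
    obtain ⟨a, rfl⟩ := toFibreₗ_surjective x a
    simp only [← toFibreₗ_star, star_star]
  star_mul a b := by
    obtain ⟨a, rfl⟩ := toFibreₗ_surjective x a
    obtain ⟨b, rfl⟩ := toFibreₗ_surjective x b
    simp only [← toFibreₗ_star, ← toFibreₗ_mul, star_mul]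
  star_add a b := by
    obtain ⟨a, rfl⟩ := toFibreₗ_surjective x a
    obtain ⟨b, rfl⟩ := toFibreₗ_surjective x b
    simp only [← toFibreₗ_star, ← map_add, star_add]

lemma norm_toFibreₗ_le (x : X) (a : A) : ‖toFibreₗ x a‖ ≤ ‖a‖ :=
  Submodule.Quotient.norm_mk_le _ _

lemma exists_norm_lt_of_toFibreₗ (x : X) (a : A) {ε : ℝ} (hε : 0 < ε) :
    ∃ b, toFibreₗ x b = toFibreₗ x a ∧ ‖b‖ < ‖toFibreₗ x a‖ + ε := by
  obtain ⟨b, hb, hb'⟩ := Submodule.Quotient.norm_mk_lt (S := fibreIdeal A x)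
    ((fibreIdeal A x).mkQ a) hε
  exact ⟨b, hb, hb'⟩

lemma toFibreₗ_act (x : X) (f : C(X, ℂ)) (a : A) : toFibreₗ x (act f a) = f x • toFibreₗ x a := by
  rw [← map_smul, toFibreₗ_eq_iff]
  refine Submodule.le_topologicalClosure _ (Submodule.subset_span
    ⟨f - (f x) • 1, a, by simp, ?_⟩)
  rw [act_sub, act_smul, act_one]

lemma exists_act_small (x : X) {j : A}
    (hj : j ∈ Submodule.span ℂ {b | ∃ (f : C(X, ℂ)) (a : A), f x = 0 ∧ b = act f a})
    {δ : ℝ} (hδ : 0 < δ) :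
    ∃ h : C(X, ℂ), h x = 1 ∧ ‖h‖ ≤ 1 ∧ ‖act h j‖ < δ := by
  induction hj using Submodule.span_induction generalizing δ with
  | mem j hj =>
    obtain ⟨f, a, hf, rfl⟩ := hj
    set η : ℝ := δ / (‖a‖ + 1) with hη_def
    have hη : 0 < η := by positivity
    have hpos : ∀ y, 0 < η + ‖f y‖ := fun y => by positivity
    refine ⟨⟨fun y => ((η / (η + ‖f y‖) : ℝ) : ℂ), ?_⟩, ?_, ?_, ?_⟩
    · refine Complex.continuous_ofReal.comp (continuous_const.div (by fun_prop) fun y => ?_)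
      exact (hpos y).ne'
    · simp [hf, hη.ne']
    · refine (ContinuousMap.norm_le _ zero_le_one).2 fun y => ?_
      simp only [ContinuousMap.coe_mk, Complex.norm_real, Real.norm_eq_abs]
      rw [abs_of_pos (div_pos hη (hpos y)), div_le_one (hpos y)]
      linarith [norm_nonneg (f y)]
    · rw [act_act]
      refine (norm_act_le _ _).trans_lt ?_
      have : ‖(⟨fun y => ((η / (η + ‖f y‖) : ℝ) : ℂ),
          Complex.continuous_ofReal.comp (continuous_const.div (by fun_prop) fun y =>
            (hpos y).ne')⟩ : C(X, ℂ)) * f‖ ≤ η := by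
        refine (ContinuousMap.norm_le _ hη.le).2 fun y => ?_
        simp only [ContinuousMap.mul_apply, ContinuousMap.coe_mk, norm_mul, Complex.norm_real,
          Real.norm_eq_abs]
        rw [abs_of_pos (div_pos hη (hpos y)), div_mul_eq_mul_div, div_le_iff₀ (hpos y)]
        nlinarith [norm_nonneg (f y)]
      calc _ ≤ η * ‖a‖ := by gcongr
        _ < δ := by
          rw [hη_def, div_mul_eq_mul_div, div_lt_iff₀ (by positivity)]
          nlinarith
  | zero => exact ⟨1, by simp, by
      refine (ContinuousMap.norm_le _ zero_le_one).2 fun y => by simp, by simpa using hδ⟩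
  | add j₁ j₂ _ _ ih₁ ih₂ =>
    obtain ⟨h₁, hx₁, hn₁, hs₁⟩ := ih₁ (half_pos hδ)
    obtain ⟨h₂, hx₂, hn₂, hs₂⟩ := ih₂ (half_pos hδ)
    refine ⟨h₁ * h₂, by simp [hx₁, hx₂], ?_, ?_⟩
    · exact (norm_mul_le _ _).trans (mul_le_one₀ hn₁ (norm_nonneg _) hn₂)
    · rw [map_add]
      have e₁ : ‖act (h₁ * h₂) j₁‖ < δ / 2 := by
        rw [mul_comm, ← act_act]
        refine (norm_act_le _ _).trans_lt ?_
        nlinarith [norm_nonneg (act h₁ j₁), norm_nonneg h₂]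
      have e₂ : ‖act (h₁ * h₂) j₂‖ < δ / 2 := by
        rw [← act_act]
        refine (norm_act_le _ _).trans_lt ?_
        nlinarith [norm_nonneg (act h₂ j₂), norm_nonneg h₁]
      exact (norm_add_le _ _).trans_lt (by linarith)
  | smul z j _ ih =>
    obtain ⟨h, hx, hn, hs⟩ := ih (δ := δ / (‖z‖ + 1)) (by positivity)
    refine ⟨h, hx, hn, ?_⟩
    rw [map_smul, norm_smul]
    rw [lt_div_iff₀ (by positivity)] at hs
    nlinarith [norm_nonneg (act h j), norm_nonneg z]

lemma exists_norm_act_lt (x : X) (a : A) {ε : ℝ} (hε : 0 < ε) :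
    ∃ h : C(X, ℂ), h x = 1 ∧ ‖h‖ ≤ 1 ∧ ‖act h a‖ < ‖toFibreₗ x a‖ + ε := by
  obtain ⟨b, hb, hb'⟩ := exists_norm_lt_of_toFibreₗ x a (half_pos hε)
  rw [eq_comm, toFibreₗ_eq_iff] at hb
  obtain ⟨j, hj, hj'⟩ := Metric.mem_closure_iff.1 hb (ε / 4) (by positivity)
  obtain ⟨h, hx, hn, hs⟩ := exists_act_small x hj (δ := ε / 4) (by positivity)
  refine ⟨h, hx, hn, ?_⟩
  have e : a = b + (a - b - j) + j := by abel
  have e₁ : ‖act h b‖ ≤ ‖b‖ := (norm_act_le _ _).trans (mul_le_of_le_one_left (norm_nonneg _) hn)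
  have e₂ : ‖act h (a - b - j)‖ ≤ ‖a - b - j‖ :=
    (norm_act_le _ _).trans (mul_le_of_le_one_left (norm_nonneg _) hn)
  rw [dist_eq_norm] at hj'
  rw [e, map_add, map_add, ← e]
  refine (norm_add₃_le).trans_lt ?_
  linarith

instance (x : X) : NonUnitalNormedRing (Fibre A x) where
  __ : NormedAddCommGroup (Fibre A x) := inferInstance
  __ : NonUnitalRing (Fibre A x) := inferInstance
  norm_mul_le a b := by
    obtain ⟨a, rfl⟩ := toFibreₗ_surjective x a
    obtain ⟨b, rfl⟩ := toFibreₗ_surjective x b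
    refine le_of_forall_pos_le_add fun ε hε => ?_
    have hcont : Filter.Tendsto (fun t : ℝ => (‖toFibreₗ x a‖ + t) * (‖toFibreₗ x b‖ + t))
        (nhdsWithin 0 (Set.Ioi 0)) (nhds ((‖toFibreₗ x a‖ + 0) * (‖toFibreₗ x b‖ + 0))) :=
      (Continuous.tendsto (by fun_prop) 0).mono_left nhdsWithin_le_nhds
    simp only [add_zero] at hcont
    obtain ⟨t, ht, ht0⟩ := ((hcont.eventually_lt_const
      (lt_add_of_pos_right _ hε)).and self_mem_nhdsWithin).exists
    obtain ⟨a', ha, ha'⟩ := exists_norm_lt_of_toFibreₗ x a ht0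
    obtain ⟨b', hb, hb'⟩ := exists_norm_lt_of_toFibreₗ x b ht0
    rw [← ha, ← hb, ← toFibreₗ_mul]
    rw [← ha, ← hb] at ht
    refine (norm_toFibreₗ_le x _).trans ((norm_mul_le _ _).trans (le_trans ?_ ht.le))
    rw [ha, hb]
    gcongr

instance (x : X) : CStarRing (Fibre A x) where
  norm_mul_self_le a := by
    obtain ⟨a, rfl⟩ := toFibreₗ_surjective x a
    rw [← toFibreₗ_star, ← toFibreₗ_mul]
    refine le_of_forall_pos_le_add fun ε hε => ?_
    obtain ⟨h, hx, hn, hh⟩ := exists_norm_act_lt x (star a * a) hε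
    have e₁ : toFibreₗ x a = toFibreₗ x (act h a) := by rw [toFibreₗ_act, hx, one_smul]
    have e₂ : ‖toFibreₗ x a‖ ≤ ‖act h a‖ := e₁ ▸ norm_toFibreₗ_le x _
    have e₃ : star (act h a) * act h a = act (star h) (act h (star a * a)) := by
      rw [star_act, mul_act, ← act_mul, act_act, act_act, mul_comm]
    calc _ ≤ ‖act h a‖ * ‖act h a‖ := by gcongr
      _ = ‖star (act h a) * act h a‖ := CStarRing.norm_star_mul_self.symm
      _ ≤ ‖star h‖ * ‖act h (star a * a)‖ := e₃ ▸ norm_act_le _ _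
      _ ≤ 1 * ‖act h (star a * a)‖ := by
        gcongr
        rwa [norm_star]
      _ ≤ _ := by rw [one_mul]; exact hh.le

instance (x : X) : NonUnitalCStarAlgebra (Fibre A x) where
  smul_assoc z a b := by
    obtain ⟨a, rfl⟩ := toFibreₗ_surjective x a
    obtain ⟨b, rfl⟩ := toFibreₗ_surjective x b
    change (z • toFibreₗ x a) * toFibreₗ x b = z • (toFibreₗ x a * toFibreₗ x b)
    rw [← map_smul, ← toFibreₗ_mul, ← toFibreₗ_mul, ← map_smul, smul_mul_assoc]
  smul_comm z a b := by
    obtain ⟨a, rfl⟩ := toFibreₗ_surjective x a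
    obtain ⟨b, rfl⟩ := toFibreₗ_surjective x b
    change z • (toFibreₗ x a * toFibreₗ x b) = toFibreₗ x a * (z • toFibreₗ x b)
    rw [← map_smul, ← toFibreₗ_mul, ← toFibreₗ_mul, ← map_smul, mul_smul_comm]
  star_smul z a := by
    obtain ⟨a, rfl⟩ := toFibreₗ_surjective x a
    rw [← map_smul, ← toFibreₗ_star, ← toFibreₗ_star, star_smul, map_smul]

/-- The quotient ⋆-homomorphism `A → A_x`, `a ↦ a_x`. -/
def toFibre (x : X) : A →⋆ₙₐ[ℂ] Fibre A x where
  __ := toFibreₗ x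
  map_zero' := map_zero (toFibreₗ x)
  map_mul' := toFibreₗ_mul x
  map_star' := toFibreₗ_star x

variable (X A) in
/-- `A` is a continuous field of C⋆-algebras over `X`: all functions `x ↦ ‖a_x‖` are
continuous. -/
def IsContinuousField : Prop := ∀ a : A, Continuous fun x : X => ‖toFibre x a‖

end Fibre

section Completion

variable (R : Type*) [NonUnitalSeminormedRing R]

/-- The multiplication of the completion of a seminormed ring, the continuous extension of the
multiplication of the ring. -/
@[reducible] def completionMul : Mul (Completion R) where
  mul := Function.curry
    ((Completion.isDenseInducing_coe.prodMap Completion.isDenseInducing_coe).extend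
      (fun p : R × R => ((p.1 * p.2 : R) : Completion R)))

lemma completionMul_coe (a b : R) :
    letI := completionMul R
    ((a * b : R) : Completion R) = (a : Completion R) * (b : Completion R) :=
  ((Completion.isDenseInducing_coe.prodMap Completion.isDenseInducing_coe).extend_eq
      ((Completion.continuous_coe R).comp (continuous_mul (M := R))) (a, b)).symm

lemma completionMul_continuous :
    letI := completionMul R
    Continuous fun p : Completion R × Completion R => p.1 * p.2 := by
  let m := (AddMonoidHom.mul : R →+ R →+ R).compr₂ Completion.toCompl
  have : Continuous fun p : R × R => m p.1 p.2 :=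
    (Completion.continuous_coe R).comp (continuous_mul (M := R))
  have di : IsDenseInducing (Completion.toCompl : R → Completion R) :=
    Completion.isDenseInducing_coe
  exact di.extend_Z_bilin di this

/-- The completion of a seminormed ring, as a normed ring. -/
@[reducible] def completionRing : NonUnitalNormedRing (Completion R) :=
  letI := completionMul R
  haveI : ContinuousMul (Completion R) := ⟨completionMul_continuous R⟩
  { __ : NormedAddCommGroup (Completion R) := inferInstance
    __ := completionMul R
    zero_mul a := by
      refine Completion.induction_on a (isClosed_eq (by fun_prop) continuous_const) fun a => ?_
      rw [← Completion.coe_zero, ← completionMul_coe, zero_mul]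
    mul_zero a := by
      refine Completion.induction_on a (isClosed_eq (by fun_prop) continuous_const) fun a => ?_
      rw [← Completion.coe_zero, ← completionMul_coe, mul_zero]
    mul_assoc a b c := by
      refine Completion.induction_on₃ a b c (isClosed_eq (by fun_prop) (by fun_prop))
        fun a b c => ?_
      simp only [← completionMul_coe, mul_assoc]
    left_distrib a b c := by
      refine Completion.induction_on₃ a b c (isClosed_eq (by fun_prop) (by fun_prop))
        fun a b c => ?_
      simp only [← completionMul_coe, ← Completion.coe_add, mul_add]
    right_distrib a b c := by
      refine Completion.induction_on₃ a b c (isClosed_eq (by fun_prop) (by fun_prop))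
        fun a b c => ?_
      simp only [← completionMul_coe, ← Completion.coe_add, add_mul]
    norm_mul_le a b := by
      refine Completion.induction_on₂ a b (isClosed_le (by fun_prop) (by fun_prop)) fun a b => ?_
      simpa only [← completionMul_coe, Completion.norm_coe] using norm_mul_le a b }

attribute [local instance] completionMul completionRing

lemma completion_continuousMul : ContinuousMul (Completion R) := ⟨completionMul_continuous R⟩

attribute [local instance] completion_continuousMul

variable [StarRing R]

lemma norm_star_of_cstar (h : ∀ a : R, ‖a‖ * ‖a‖ ≤ ‖star a * a‖) (a : R) : ‖star a‖ = ‖a‖ := by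
  have key : ∀ a : R, ‖a‖ ≤ ‖star a‖ := fun a => by
    by_contra! hlt
    have h0 : 0 < ‖a‖ := (norm_nonneg _).trans_lt hlt
    have := (h a).trans (norm_mul_le _ _)
    nlinarith
  exact le_antisymm (by simpa using key (star a)) (key a)

/-- The involution of the completion, the continuous extension of the involution of the ring. -/
@[reducible] def completionStar : Star (Completion R) := ⟨Completion.map star⟩

attribute [local instance] completionStar

lemma completionStar_coe (h : ∀ a : R, ‖a‖ * ‖a‖ ≤ ‖star a * a‖) (a : R) :
    ((star a : R) : Completion R) = star (a : Completion R) := by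
  refine (Completion.map_coe ?_ a).symm
  exact (AddMonoidHomClass.isometry_of_norm ((starAddEquiv : R ≃+ R) : R →+ R)
    (norm_star_of_cstar R h)).uniformContinuous

lemma completionStar_continuous : Continuous (star : Completion R → Completion R) :=
  Completion.continuous_map

/-- The completion of a ⋆-ring with respect to a C⋆-seminorm, as a ⋆-ring. -/
@[reducible] def completionStarRing (h : ∀ a : R, ‖a‖ * ‖a‖ ≤ ‖star a * a‖) :
    StarRing (Completion R) where
  star_involutive a := by
    have hs := completionStar_continuous R
    refine Completion.induction_on a (isClosed_eq (hs.comp hs) continuous_id) fun a => ?_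
    rw [← completionStar_coe R h, ← completionStar_coe R h, star_star]
  star_mul a b := by
    have hs := completionStar_continuous R
    refine Completion.induction_on₂ a b (isClosed_eq (hs.comp continuous_mul)
      ((hs.comp continuous_snd).mul (hs.comp continuous_fst))) fun a b => ?_
    rw [← completionMul_coe, ← completionStar_coe R h, ← completionStar_coe R h,
      ← completionStar_coe R h, ← completionMul_coe, star_mul]
  star_add a b := by
    have hs := completionStar_continuous R
    refine Completion.induction_on₂ a b (isClosed_eq (hs.comp continuous_add)
      ((hs.comp continuous_fst).add (hs.comp continuous_snd))) fun a b => ?_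
    rw [← Completion.coe_add, ← completionStar_coe R h, ← completionStar_coe R h,
      ← completionStar_coe R h, ← Completion.coe_add, star_add]

/-- The Hausdorff completion of a ⋆-algebra with respect to a C⋆-seminorm, as a C⋆-algebra. -/
@[reducible] def completionCStar [NormedSpace ℂ R] [IsScalarTower ℂ R R] [SMulCommClass ℂ R R]
    [StarModule ℂ R] (h : ∀ a : R, ‖a‖ * ‖a‖ ≤ ‖star a * a‖) :
    NonUnitalCStarAlgebra (Completion R) where
  __ := completionRing R
  __ := completionStarRing R h
  __ : NormedSpace ℂ (Completion R) := inferInstance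
  complete := CompleteSpace.complete
  norm_mul_self_le a := by
    have hs := completionStar_continuous R
    refine Completion.induction_on a (isClosed_le (continuous_norm.mul continuous_norm)
      (continuous_norm.comp (hs.mul continuous_id))) fun a => ?_
    have := h a
    rw [← Completion.norm_coe, ← Completion.norm_coe (star a * a), completionMul_coe,
      completionStar_coe R h] at this
    exact this
  smul_assoc z a b := by
    refine Completion.induction_on₂ a b (isClosed_eq
      ((continuous_fst.const_smul z).mul continuous_snd) (continuous_mul.const_smul z))
      fun a b => ?_
    have := completionMul_coe R (z • a) b
    rw [smul_mul_assoc, Completion.coe_smul, Completion.coe_smul, completionMul_coe] at this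
    exact this.symm
  smul_comm z a b := by
    refine Completion.induction_on₂ a b (isClosed_eq
      (continuous_mul.const_smul z) (continuous_fst.mul (continuous_snd.const_smul z)))
      fun a b => ?_
    have := completionMul_coe R a (z • b)
    rw [mul_smul_comm, Completion.coe_smul, Completion.coe_smul, completionMul_coe] at this
    exact this
  star_smul z a := by
    have hs := completionStar_continuous R
    refine Completion.induction_on a (isClosed_eq (hs.comp (continuous_const_smul z))
      ((continuous_const_smul _).comp hs)) fun a => ?_
    have := completionStar_coe R h (z • a)
    rw [star_smul, Completion.coe_smul, Completion.coe_smul, completionStar_coe R h] at this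
    exact this.symm

end Completion

universe u v w

section Spatial

/-- A representation of a C⋆-algebra on a Hilbert space. -/
structure HilbertRep (A : Type u) [NonUnitalCStarAlgebra A] where
  H : Type u
  [normed : NormedAddCommGroup H]
  [inner : InnerProductSpace ℂ H]
  [complete : CompleteSpace H]
  π : A →⋆ₙₐ[ℂ] (H →L[ℂ] H)

attribute [instance] HilbertRep.normed HilbertRep.inner HilbertRep.complete

variable {A : Type u} [NonUnitalCStarAlgebra A] {B : Type v} [NonUnitalCStarAlgebra B]

/-- The representation `π₁ ⊗ π₂` of the algebraic tensor product `A ⊗ B` by bounded operators on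
the algebraic (pre-Hilbert) tensor product of the two Hilbert spaces; the norm of an operator
there agrees with that of its extension to the Hilbert space tensor product. -/
def tensorRep (ρ : HilbertRep A) (σ : HilbertRep B) :
    A ⊗[ℂ] B →ₗ[ℂ] (ρ.H ⊗[ℂ] σ.H →L[ℂ] ρ.H ⊗[ℂ] σ.H) :=
  TensorProduct.lift (LinearMap.mk₂ ℂ (fun a b => TensorProduct.mapL (ρ.π a) (σ.π b))
    (fun a a' b => by rw [map_add, TensorProduct.mapL_add_left])
    (fun z a b => by rw [map_smul, TensorProduct.mapL_smul_left])
    (fun a b b' => by rw [map_add, TensorProduct.mapL_add_right])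
    (fun z a b => by rw [map_smul, TensorProduct.mapL_smul_right]))

/-- The spatial (minimal) C⋆-norm `‖α‖_min` on the algebraic tensor product of two
C⋆-algebras: the supremum of `‖(π₁ ⊗ π₂)(α)‖` over all Hilbert space representations. -/
def spatialNorm (α : A ⊗[ℂ] B) : ℝ :=
  ⨆ p : HilbertRep A × HilbertRep B, ‖tensorRep p.1 p.2 α‖

lemma tensorRep_tmul (ρ : HilbertRep A) (σ : HilbertRep B) (a : A) (b : B) :
    tensorRep ρ σ (a ⊗ₜ b) = TensorProduct.mapL (ρ.π a) (σ.π b) := by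
  simp [tensorRep]

lemma norm_tensorRep_tmul_le (ρ : HilbertRep A) (σ : HilbertRep B) (a : A) (b : B) :
    ‖tensorRep ρ σ (a ⊗ₜ b)‖ ≤ ‖a‖ * ‖b‖ := by
  rw [tensorRep_tmul]
  refine (TensorProduct.norm_mapL_le _ _).trans ?_
  gcongr
  · exact NonUnitalStarAlgHom.norm_apply_le ρ.π a
  · exact NonUnitalStarAlgHom.norm_apply_le σ.π b

lemma tensorRep_mul (ρ : HilbertRep A) (σ : HilbertRep B) (α β : A ⊗[ℂ] B) :
    tensorRep ρ σ (α * β) = tensorRep ρ σ α * tensorRep ρ σ β := by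
  induction α with
  | zero => simp
  | add α α' h h' => rw [add_mul, map_add, h, h', map_add, add_mul]
  | tmul a b =>
    induction β with
    | zero => simp
    | add β β' h h' => rw [mul_add, map_add, h, h', map_add, mul_add]
    | tmul c d =>
      rw [Algebra.TensorProduct.tmul_mul_tmul, tensorRep_tmul, tensorRep_tmul, tensorRep_tmul,
        map_mul, map_mul, TensorProduct.mapL_mul]

lemma tensorRep_star (ρ : HilbertRep A) (σ : HilbertRep B) (α : A ⊗[ℂ] B)
    (s t : ρ.H ⊗[ℂ] σ.H) :
    inner ℂ (tensorRep ρ σ α s) t = inner ℂ s (tensorRep ρ σ (star α) t) := by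
  induction α with
  | zero => simp
  | add α α' h h' => simp only [map_add, star_add, add_apply, inner_add_left,
      inner_add_right, h, h']
  | tmul a b =>
    rw [TensorProduct.star_tmul, tensorRep_tmul, tensorRep_tmul]
    induction s with
    | zero => simp
    | add s s' h h' => simp only [map_add, inner_add_left, h, h']
    | tmul ξ η =>
      induction t with
      | zero => simp
      | add s s' h h' => simp only [map_add, inner_add_right, h, h']
      | tmul ξ' η' =>
        simp only [TensorProduct.mapL_tmul, TensorProduct.inner_tmul, map_star,
          ContinuousLinearMap.star_eq_adjoint, ContinuousLinearMap.adjoint_inner_right]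

lemma norm_smul_clm {G : Type*} [NormedAddCommGroup G] [InnerProductSpace ℂ G] (z : ℂ)
    (T : G →L[ℂ] G) : ‖z • T‖ = ‖z‖ * ‖T‖ := norm_smul z T

lemma cstar_clm {G : Type*} [NormedAddCommGroup G] [InnerProductSpace ℂ G]
    (T S R : G →L[ℂ] G) (h : ∀ s t, inner ℂ (T s) t = inner ℂ s (S t)) (hR : R = S * T) :
    ‖T‖ * ‖T‖ ≤ ‖R‖ := by
  have : ‖T‖ ≤ √‖R‖ := by
    refine ContinuousLinearMap.opNorm_le_bound _ (Real.sqrt_nonneg _) fun s => ?_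
    refine le_of_sq_le_sq ?_ (by positivity)
    rw [mul_pow, Real.sq_sqrt (norm_nonneg _), ← inner_self_eq_norm_sq (𝕜 := ℂ), h]
    have e : S (T s) = R s := by rw [hR]; rfl
    rw [e]
    refine (RCLike.re_le_norm _).trans ((norm_inner_le_norm _ _).trans ?_)
    have := R.le_opNorm s
    nlinarith [norm_nonneg s]
  calc _ ≤ √‖R‖ * √‖R‖ := by gcongr
    _ = _ := Real.mul_self_sqrt (norm_nonneg _)

/-- A C⋆-seminorm on a ⋆-algebra. -/
structure IsCStarSeminorm {R : Type*} [NonUnitalRing R] [Star R] [Module ℂ R] (p : R → ℝ) :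
    Prop where
  nonneg : ∀ a, 0 ≤ p a
  add_le : ∀ a b, p (a + b) ≤ p a + p b
  smul : ∀ (z : ℂ) a, p (z • a) = ‖z‖ * p a
  mul_le : ∀ a b, p (a * b) ≤ p a * p b
  star_mul_self : ∀ a, p a * p a ≤ p (star a * a)

lemma IsCStarSeminorm.iSup {R : Type*} [NonUnitalRing R] [Star R] [Module ℂ R] {ι : Type*}
    {p : ι → R → ℝ} (hp : ∀ i, IsCStarSeminorm (p i))
    (hb : ∀ a, BddAbove (Set.range fun i => p i a)) :
    IsCStarSeminorm fun a => ⨆ i, p i a where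
  nonneg a := Real.iSup_nonneg fun i => (hp i).nonneg a
  add_le a b := Real.iSup_le (fun i => ((hp i).add_le a b).trans
      (add_le_add (le_ciSup (hb a) i) (le_ciSup (hb b) i)))
    (add_nonneg (Real.iSup_nonneg fun i => (hp i).nonneg a)
      (Real.iSup_nonneg fun i => (hp i).nonneg b))
  smul z a := by
    simp only [(hp _).smul]
    exact (Real.mul_iSup_of_nonneg (norm_nonneg z) _).symm
  mul_le a b := Real.iSup_le (fun i => ((hp i).mul_le a b).trans
      (mul_le_mul (le_ciSup (hb a) i) (le_ciSup (hb b) i) ((hp i).nonneg b)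
        (Real.iSup_nonneg fun i => (hp i).nonneg a)))
    (mul_nonneg (Real.iSup_nonneg fun i => (hp i).nonneg a)
      (Real.iSup_nonneg fun i => (hp i).nonneg b))
  star_mul_self a := by
    have h0 : 0 ≤ ⨆ i, p i (star a * a) := Real.iSup_nonneg fun i => (hp i).nonneg _
    have : ⨆ i, p i a ≤ √(⨆ i, p i (star a * a)) := by
      refine Real.iSup_le (fun i => Real.le_sqrt_of_sq_le ?_) (Real.sqrt_nonneg _)
      rw [sq]
      exact ((hp i).star_mul_self a).trans (le_ciSup (hb _) i)
    have h1 : 0 ≤ ⨆ i, p i a := Real.iSup_nonneg fun i => (hp i).nonneg a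
    calc _ ≤ √(⨆ i, p i (star a * a)) * √(⨆ i, p i (star a * a)) := by gcongr
      _ = _ := Real.mul_self_sqrt h0

lemma isCStarSeminorm_tensorRep (ρ : HilbertRep A) (σ : HilbertRep B) :
    IsCStarSeminorm fun α => ‖tensorRep ρ σ α‖ where
  nonneg _ := ContinuousLinearMap.opNorm_nonneg _
  add_le a b := by rw [map_add]; exact ContinuousLinearMap.opNorm_add_le _ _
  smul z a := by rw [map_smul]; exact norm_smul_clm _ _
  mul_le a b := by rw [tensorRep_mul]; exact ContinuousLinearMap.opNorm_comp_le _ _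
  star_mul_self a := cstar_clm _ _ _ (tensorRep_star ρ σ a) (tensorRep_mul ρ σ _ _)

lemma exists_tensorRep_bound (α : A ⊗[ℂ] B) :
    ∃ C, ∀ (ρ : HilbertRep A) (σ : HilbertRep B), ‖tensorRep ρ σ α‖ ≤ C := by
  induction α with
  | zero =>
    refine ⟨0, fun ρ σ => ?_⟩
    rw [map_zero]
    exact ContinuousLinearMap.opNorm_zero.le
  | tmul a b => exact ⟨_, fun ρ σ => norm_tensorRep_tmul_le ρ σ a b⟩
  | add α β h h' =>
    obtain ⟨C, hC⟩ := h
    obtain ⟨D, hD⟩ := h'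
    exact ⟨C + D, fun ρ σ => ((isCStarSeminorm_tensorRep ρ σ).add_le α β).trans
      (add_le_add (hC ρ σ) (hD ρ σ))⟩

lemma isCStarSeminorm_spatialNorm : IsCStarSeminorm (spatialNorm : A ⊗[ℂ] B → ℝ) := by
  refine IsCStarSeminorm.iSup (fun p => isCStarSeminorm_tensorRep p.1 p.2) fun α => ?_
  obtain ⟨C, hC⟩ := exists_tensorRep_bound α
  exact ⟨C, by rintro _ ⟨p, rfl⟩; exact hC p.1 p.2⟩

lemma spatialNorm_tmul_le (a : A) (b : B) : spatialNorm (a ⊗ₜ[ℂ] b) ≤ ‖a‖ * ‖b‖ :=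
  Real.iSup_le (fun p => norm_tensorRep_tmul_le p.1 p.2 a b) (by positivity)

end Spatial

section MinTensor

variable (X : Type w) [TopologicalSpace X] [CompactSpace X]
variable (A : Type u) [NonUnitalCStarAlgebra A] [CXAlgebra X A]
variable (B : Type v) [NonUnitalCStarAlgebra B] [CXAlgebra X B]

variable {A B} in
/-- The image `α_x` of `α ∈ A ⊗ B` in the algebraic tensor product `A_x ⊗ B_x`. -/
def tensorFibre (x : X) : A ⊗[ℂ] B →ₗ[ℂ] Fibre A x ⊗[ℂ] Fibre B x :=
  TensorProduct.map (toFibreₗ x) (toFibreₗ x)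

variable {A B} in
/-- The seminorm `‖α‖_m = sup_x ‖α_x‖`, with the norm of `A_x ⊗_min B_x` on the right. -/
def mNorm (α : A ⊗[ℂ] B) : ℝ := ⨆ x : X, spatialNorm (tensorFibre X x α)

/-- The algebraic tensor product `A ⊗ B`, to be equipped with the seminorm `‖·‖_m`. -/
def PreMinTensor (X : Type w) [TopologicalSpace X] [CompactSpace X]
    (A : Type u) [NonUnitalCStarAlgebra A] [CXAlgebra X A]
    (B : Type v) [NonUnitalCStarAlgebra B] [CXAlgebra X B] : Type (max u v) := A ⊗[ℂ] B

variable {A B}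

lemma tensorFibre_mul (x : X) (α β : A ⊗[ℂ] B) :
    tensorFibre X x (α * β) = tensorFibre X x α * tensorFibre X x β := by
  induction α with
  | zero => simp
  | add α α' h h' => rw [add_mul, map_add, h, h', map_add, add_mul]
  | tmul a b =>
    induction β with
    | zero => simp
    | add β β' h h' => rw [mul_add, map_add, h, h', map_add, mul_add]
    | tmul c d =>
      rw [Algebra.TensorProduct.tmul_mul_tmul]
      simp only [tensorFibre, TensorProduct.map_tmul, toFibreₗ_mul,
        Algebra.TensorProduct.tmul_mul_tmul]

lemma tensorFibre_star (x : X) (α : A ⊗[ℂ] B) :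
    tensorFibre X x (star α) = star (tensorFibre X x α) := by
  induction α with
  | zero => simp
  | add α α' h h' => rw [star_add, map_add, h, h', map_add, star_add]
  | tmul a b => rfl

lemma spatialNorm_tensorFibre_bound (α : A ⊗[ℂ] B) :
    ∃ C, ∀ x, spatialNorm (tensorFibre X x α) ≤ C := by
  induction α with
  | zero =>
    refine ⟨0, fun x => ?_⟩
    have := isCStarSeminorm_spatialNorm.smul 0 (tensorFibre X x (0 : A ⊗[ℂ] B))
    rw [zero_smul, norm_zero, zero_mul] at this
    rw [map_zero, this]
  | tmul a b =>
    refine ⟨‖a‖ * ‖b‖, fun x => (spatialNorm_tmul_le _ _).trans ?_⟩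
    gcongr
    · exact norm_toFibreₗ_le x a
    · exact norm_toFibreₗ_le x b
  | add α β h h' =>
    obtain ⟨C, hC⟩ := h
    obtain ⟨D, hD⟩ := h'
    exact ⟨C + D, fun x => by
      rw [map_add]
      exact (isCStarSeminorm_spatialNorm.add_le _ _).trans (add_le_add (hC x) (hD x))⟩

lemma bddAbove_spatialNorm_tensorFibre (α : A ⊗[ℂ] B) :
    BddAbove (Set.range fun x : X => spatialNorm (tensorFibre X x α)) := by
  obtain ⟨C, hC⟩ := spatialNorm_tensorFibre_bound X α
  exact ⟨C, by rintro _ ⟨x, rfl⟩; exact hC x⟩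

lemma isCStarSeminorm_mNorm : IsCStarSeminorm (mNorm X : A ⊗[ℂ] B → ℝ) :=
  IsCStarSeminorm.iSup (fun x =>
    have h := isCStarSeminorm_spatialNorm (A := Fibre A x) (B := Fibre B x)
    { nonneg := fun a => h.nonneg _
      add_le := fun a b => by rw [map_add]; exact h.add_le _ _
      smul := fun z a => by rw [map_smul]; exact h.smul _ _
      mul_le := fun a b => by rw [tensorFibre_mul]; exact h.mul_le _ _
      star_mul_self := fun a => by
        rw [tensorFibre_mul, tensorFibre_star]; exact h.star_mul_self _ })
    (bddAbove_spatialNorm_tensorFibre X)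

variable (A B)

instance : NonUnitalRing (PreMinTensor X A B) := inferInstanceAs (NonUnitalRing (A ⊗[ℂ] B))
instance : Module ℂ (PreMinTensor X A B) := inferInstanceAs (Module ℂ (A ⊗[ℂ] B))
instance : StarAddMonoid (PreMinTensor X A B) := inferInstanceAs (StarAddMonoid (A ⊗[ℂ] B))
instance : StarModule ℂ (PreMinTensor X A B) := inferInstanceAs (StarModule ℂ (A ⊗[ℂ] B))
instance : IsScalarTower ℂ (PreMinTensor X A B) (PreMinTensor X A B) :=
  inferInstanceAs (IsScalarTower ℂ (A ⊗[ℂ] B) (A ⊗[ℂ] B))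
instance : SMulCommClass ℂ (PreMinTensor X A B) (PreMinTensor X A B) :=
  inferInstanceAs (SMulCommClass ℂ (A ⊗[ℂ] B) (A ⊗[ℂ] B))

lemma star_mul_tensor (α β : A ⊗[ℂ] B) : star (α * β) = star β * star α := by
  induction α with
  | zero => simp
  | add α α' h h' => rw [add_mul, star_add, h, h', star_add, mul_add]
  | tmul a b =>
    induction β with
    | zero => simp
    | add β β' h h' => rw [mul_add, star_add, h, h', star_add, add_mul]
    | tmul c d =>
      simp only [Algebra.TensorProduct.tmul_mul_tmul, TensorProduct.star_tmul, star_mul]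

instance : StarRing (PreMinTensor X A B) where
  star_add := star_add
  star_mul := star_mul_tensor A B

/-- `‖·‖_m` as a bundled seminorm. -/
def mSeminorm : AddGroupSeminorm (A ⊗[ℂ] B) where
  toFun := mNorm X
  map_zero' := by
    have := (isCStarSeminorm_mNorm X (A := A) (B := B)).smul 0 0
    rwa [zero_smul, norm_zero, zero_mul] at this
  add_le' := (isCStarSeminorm_mNorm X (A := A) (B := B)).add_le
  neg' a := by
    have := (isCStarSeminorm_mNorm X (A := A) (B := B)).smul (-1) a
    rwa [neg_one_smul, norm_neg, norm_one, one_mul] at this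

instance : SeminormedAddCommGroup (PreMinTensor X A B) :=
  AddGroupSeminorm.toSeminormedAddCommGroup
    (show AddGroupSeminorm (PreMinTensor X A B) from mSeminorm X A B)

lemma norm_preMinTensor (α : PreMinTensor X A B) : ‖α‖ = mNorm X (A := A) (B := B) α := rfl

instance : NonUnitalSeminormedRing (PreMinTensor X A B) where
  __ : SeminormedAddCommGroup (PreMinTensor X A B) := inferInstance
  __ : NonUnitalRing (PreMinTensor X A B) := inferInstance
  norm_mul_le := (isCStarSeminorm_mNorm X (A := A) (B := B)).mul_le

instance : NormedSpace ℂ (PreMinTensor X A B) where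
  norm_smul_le z a := ((isCStarSeminorm_mNorm X (A := A) (B := B)).smul z a).le

/-- The minimal tensor product `A ⊗^m_{C(X)} B`: the Hausdorff completion of the algebraic tensor
product `A ⊗ B` for the seminorm `‖·‖_m`. -/
abbrev MinTensor : Type (max u v) := Completion (PreMinTensor X A B)

instance : NonUnitalCStarAlgebra (MinTensor X A B) :=
  completionCStar (PreMinTensor X A B) (isCStarSeminorm_mNorm X (A := A) (B := B)).star_mul_self

lemma MinTensor.coe_mul (α β : PreMinTensor X A B) :
    ((α * β : PreMinTensor X A B) : MinTensor X A B) = (α : MinTensor X A B) * (β : MinTensor X A B) :=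
  completionMul_coe _ α β

lemma MinTensor.coe_star (α : PreMinTensor X A B) :
    ((star α : PreMinTensor X A B) : MinTensor X A B) = star (α : MinTensor X A B) :=
  completionStar_coe _ (isCStarSeminorm_mNorm X (A := A) (B := B)).star_mul_self α

variable {A B}

/-- The identity map from `A ⊗ B` to `PreMinTensor X A B`. -/
def preOf (α : A ⊗[ℂ] B) : PreMinTensor X A B := α

/-- The elementary tensor `a ⊗ b` in `PreMinTensor X A B`. -/
def preTmul (a : A) (b : B) : PreMinTensor X A B := preOf X (a ⊗ₜ[ℂ] b)

/-- The image of the elementary tensor `a ⊗ b` in `A ⊗^m_{C(X)} B`. -/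
def MinTensor.tmul (a : A) (b : B) : MinTensor X A B := (preTmul X a b : PreMinTensor X A B)

variable {X}

/-- The operator `f ⊗ 1` on `A ⊗ B` for `f ∈ C(X)`. -/
def algAct (f : C(X, ℂ)) : A ⊗[ℂ] B →ₗ[ℂ] A ⊗[ℂ] B :=
  TensorProduct.map (act f).toLinearMap LinearMap.id

lemma tensorFibre_algAct (x : X) (f : C(X, ℂ)) (α : A ⊗[ℂ] B) :
    tensorFibre X x (algAct f α) = f x • tensorFibre X x α := by
  induction α with
  | zero => simp
  | add α α' h h' => rw [map_add, map_add, h, h', map_add, smul_add]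
  | tmul a b =>
    change (toFibreₗ x (act f a)) ⊗ₜ (toFibreₗ x b) = f x • (toFibreₗ x a ⊗ₜ toFibreₗ x b)
    rw [toFibreₗ_act, TensorProduct.smul_tmul']

lemma mNorm_algAct_le (f : C(X, ℂ)) (α : A ⊗[ℂ] B) :
    mNorm X (algAct f α) ≤ ‖f‖ * mNorm X α := by
  refine Real.iSup_le (fun x => ?_)
    (mul_nonneg (norm_nonneg _) ((isCStarSeminorm_mNorm X).nonneg α))
  rw [tensorFibre_algAct, isCStarSeminorm_spatialNorm.smul]
  exact mul_le_mul (f.norm_coe_le_norm x) (le_ciSup (bddAbove_spatialNorm_tensorFibre X α) x)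
    (isCStarSeminorm_spatialNorm.nonneg _) (norm_nonneg _)

/-- The operator `f ⊗ 1` on `A ⊗ B`, as a bounded operator for `‖·‖_m`. -/
def preAct (f : C(X, ℂ)) : PreMinTensor X A B →L[ℂ] PreMinTensor X A B :=
  LinearMap.mkContinuous (algAct f : A ⊗[ℂ] B →ₗ[ℂ] A ⊗[ℂ] B) ‖f‖ (mNorm_algAct_le f)

lemma preAct_tmul (f : C(X, ℂ)) (a : A) (b : B) :
    preAct f (preTmul X a b) = preTmul X (act f a) b := rfl

/-- The operator `f ⊗ 1` on `A ⊗^m_{C(X)} B`. -/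
def MinTensor.actL (f : C(X, ℂ)) : MinTensor X A B →L[ℂ] MinTensor X A B :=
  (preAct (A := A) (B := B) f).completion

lemma MinTensor.actL_tmul (f : C(X, ℂ)) (a : A) (b : B) :
    MinTensor.actL f (MinTensor.tmul X a b) = MinTensor.tmul X (act f a) b :=
  ContinuousLinearMap.completion_apply_coe _ _

lemma MinTensor.tmul_mul_tmul (a a' : A) (b b' : B) :
    MinTensor.tmul X a b * MinTensor.tmul X a' b' = MinTensor.tmul X (a * a') (b * b') := by
  rw [MinTensor.tmul, MinTensor.tmul, ← MinTensor.coe_mul]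
  congr 1
  exact Algebra.TensorProduct.tmul_mul_tmul a a' b b'

lemma MinTensor.star_tmul (a : A) (b : B) :
    star (MinTensor.tmul X a b) = MinTensor.tmul X (star a) (star b) := by
  rw [MinTensor.tmul, ← MinTensor.coe_star]
  congr 1

/-- Additive continuous maps which agree on elementary tensors are equal. -/
lemma MinTensor.ext_of_tmul {D : Type*} [NormedAddCommGroup D] {P Q : MinTensor X A B → D}
    (hP : Continuous P) (hQ : Continuous Q) (hPadd : ∀ s t, P (s + t) = P s + P t)
    (hQadd : ∀ s t, Q (s + t) = Q s + Q t)
    (h : ∀ (a : A) (b : B), P (MinTensor.tmul X a b) = Q (MinTensor.tmul X a b)) (d) :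
    P d = Q d := by
  refine Completion.induction_on d (isClosed_eq hP hQ) fun α => ?_
  change P ((preOf X α : PreMinTensor X A B) : MinTensor X A B) =
    Q ((preOf X α : PreMinTensor X A B) : MinTensor X A B)
  refine TensorProduct.induction_on (motive := fun α : A ⊗[ℂ] B =>
    P ((preOf X α : PreMinTensor X A B) : MinTensor X A B) =
      Q ((preOf X α : PreMinTensor X A B) : MinTensor X A B))
    α ?_ h fun α β hα hβ => ?_
  · have h1 := h 0 0
    rwa [MinTensor.tmul, preTmul, TensorProduct.zero_tmul] at h1
  · have e : ((preOf X (α + β) : PreMinTensor X A B) : MinTensor X A B) =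
      ((preOf X α : PreMinTensor X A B) : MinTensor X A B) +
        ((preOf X β : PreMinTensor X A B) : MinTensor X A B) :=
      Completion.coe_add (preOf X α) (preOf X β)
    rw [e, hPadd, hQadd, hα, hβ]

lemma MinTensor.tmul_smul (z : ℂ) (a : A) (b : B) :
    MinTensor.tmul X (z • a) b = z • MinTensor.tmul X a b := by
  rw [MinTensor.tmul, MinTensor.tmul, ← Completion.coe_smul]
  rfl

lemma MinTensor.tmul_add (a a' : A) (b : B) :
    MinTensor.tmul X (a + a') b = MinTensor.tmul X a b + MinTensor.tmul X a' b := by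
  rw [MinTensor.tmul, MinTensor.tmul, MinTensor.tmul, ← Completion.coe_add]
  congr 1
  exact TensorProduct.add_tmul a a' b

/-- `A ⊗^m_{C(X)} B` is a `C(X)`-algebra, with `f (a ⊗ b) = (f a) ⊗ b`. -/
instance : CXAlgebra X (MinTensor X A B) :=
  CXAlgebra.ofAct (D := MinTensor X A B) (MinTensor.actL (X := X) (A := A) (B := B))
    (MinTensor.ext_of_tmul (by fun_prop) continuous_id (fun s t => map_add _ s t)
      (fun s t => rfl) fun a b => by rw [MinTensor.actL_tmul, act_one])
    (fun f g => MinTensor.ext_of_tmul (by fun_prop) (by fun_prop) (fun s t => map_add _ s t)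
      (fun s t => by rw [map_add, map_add]) fun a b => by
        rw [MinTensor.actL_tmul, MinTensor.actL_tmul, MinTensor.actL_tmul, act_act])
    (fun f g => MinTensor.ext_of_tmul (by fun_prop) (by fun_prop) (fun s t => map_add _ s t)
      (fun s t => by rw [map_add, map_add]; abel) fun a b => by
        rw [MinTensor.actL_tmul, MinTensor.actL_tmul, MinTensor.actL_tmul, act_add,
          MinTensor.tmul_add])
    (fun z f => MinTensor.ext_of_tmul (by fun_prop)
      ((MinTensor.actL (X := X) (A := A) (B := B) f).continuous.const_smul z)
      (fun s t => map_add _ s t) (fun s t => by rw [map_add, smul_add]) fun a b => by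
        rw [MinTensor.actL_tmul, MinTensor.actL_tmul, act_smul, MinTensor.tmul_smul])
    (fun f => MinTensor.ext_of_tmul (by fun_prop) (by fun_prop)
      (fun s t => by rw [star_add, map_add]) (fun s t => by rw [map_add, star_add]) fun a b => by
        rw [MinTensor.star_tmul, MinTensor.actL_tmul, MinTensor.actL_tmul, MinTensor.star_tmul,
          star_act])
    (fun f d e => MinTensor.ext_of_tmul (P := fun d => MinTensor.actL f (d * e))
      (Q := fun d => MinTensor.actL f d * e) (by fun_prop) (by fun_prop)
      (fun s t => by rw [add_mul, map_add]) (fun s t => by rw [map_add, add_mul])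
      (fun a b => MinTensor.ext_of_tmul
        (P := fun e => MinTensor.actL f (MinTensor.tmul X a b * e))
        (Q := fun e => MinTensor.actL f (MinTensor.tmul X a b) * e) (by fun_prop) (by fun_prop)
        (fun s t => by rw [mul_add, map_add]) (fun s t => by rw [mul_add])
        (fun a' b' => by
          rw [MinTensor.tmul_mul_tmul, MinTensor.actL_tmul, MinTensor.actL_tmul,
            MinTensor.tmul_mul_tmul, act_mul]) e) d)
    (fun f d e => MinTensor.ext_of_tmul (P := fun d => MinTensor.actL f (d * e))
      (Q := fun d => d * MinTensor.actL f e) (by fun_prop) (by fun_prop)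
      (fun s t => by rw [add_mul, map_add]) (fun s t => by rw [add_mul])
      (fun a b => MinTensor.ext_of_tmul
        (P := fun e => MinTensor.actL f (MinTensor.tmul X a b * e))
        (Q := fun e => MinTensor.tmul X a b * MinTensor.actL f e) (by fun_prop) (by fun_prop)
        (fun s t => by rw [mul_add, map_add]) (fun s t => by rw [map_add, mul_add])
        (fun a' b' => by
          rw [MinTensor.tmul_mul_tmul, MinTensor.actL_tmul, MinTensor.actL_tmul,
            MinTensor.tmul_mul_tmul, mul_act]) e) d)

lemma MinTensor.act_tmul (f : C(X, ℂ)) (a : A) (b : B) :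
    act f (MinTensor.tmul X a b) = MinTensor.tmul X (act f a) b :=
  MinTensor.actL_tmul f a b

end MinTensor

section Adjointable

variable (R E : Type*) [NonUnitalCStarAlgebra R] [PartialOrder R] [NormedAddCommGroup E]
  [NormedSpace ℂ E] [SMul R E] [CStarModule R E]

variable {E} in
lemma ext_inner {ξ η : E} (h : ∀ ζ, inner R ζ ξ = inner R ζ η) : ξ = η := by
  rw [← sub_eq_zero, ← CStarModule.inner_self (A := R), CStarModule.inner_sub_right, h, sub_self]

/-- The bounded operators on a Hilbert C⋆-module which admit an adjoint. -/
def adjSubalgebra : Subalgebra ℂ (E →L[ℂ] E) where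
  carrier := {T | ∃ S : E →L[ℂ] E, ∀ ξ η, inner R (T ξ) η = inner R ξ (S η)}
  mul_mem' := by
    rintro T T' ⟨S, hS⟩ ⟨S', hS'⟩
    exact ⟨S' * S, fun ξ η => (hS _ _).trans (hS' _ _)⟩
  add_mem' := by
    rintro T T' ⟨S, hS⟩ ⟨S', hS'⟩
    refine ⟨S + S', fun ξ η => ?_⟩
    rw [add_apply, add_apply, CStarModule.inner_add_left, CStarModule.inner_add_right, hS, hS']
  algebraMap_mem' z := by
    refine ⟨algebraMap ℂ _ (star z), fun ξ η => ?_⟩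
    rw [Algebra.algebraMap_eq_smul_one, Algebra.algebraMap_eq_smul_one]
    change inner R (z • ξ) η = inner R ξ (star z • η)
    rw [CStarModule.inner_smul_left_complex, CStarModule.inner_smul_right_complex]

/-- The ⋆-algebra `ℒ_R(E)` of bounded operators on the Hilbert `R`-module `E` which admit an
adjoint (such operators are automatically `R`-linear). -/
abbrev Adj : Type _ := adjSubalgebra R E

variable {R E}

instance : Star (Adj R E) where
  star T := ⟨T.2.choose, (T : E →L[ℂ] E), fun ξ η => by
    rw [← CStarModule.star_inner, ← T.2.choose_spec, CStarModule.star_inner]⟩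

lemma Adj.inner_left (T : Adj R E) (ξ η : E) :
    inner R ((T : E →L[ℂ] E) ξ) η = inner R ξ ((star T : Adj R E).1 η) :=
  T.2.choose_spec ξ η

lemma Adj.inner_right (T : Adj R E) (ξ η : E) :
    inner R ξ ((T : E →L[ℂ] E) η) = inner R ((star T : Adj R E).1 ξ) η := by
  rw [← CStarModule.star_inner, T.inner_left, CStarModule.star_inner]

lemma Adj.eq_star {T S : Adj R E} (h : ∀ ξ η, inner R (T.1 ξ) η = inner R ξ (S.1 η)) :
    star T = S := by
  ext η
  refine ext_inner R fun ξ => ?_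
  rw [← h, T.inner_left]

lemma Adj.map_smul (T : Adj R E) (r : R) (ξ : E) : T.1 (r • ξ) = r • T.1 ξ := by
  refine ext_inner R fun ζ => ?_
  rw [T.inner_right, CStarModule.inner_op_smul_right, CStarModule.inner_op_smul_right,
    T.inner_right]

instance : StarRing (Adj R E) where
  star_involutive T := Adj.eq_star fun ξ η => (T.inner_right ξ η).symm
  star_mul T S := Adj.eq_star fun ξ η =>
    (T.inner_left (S.1 ξ) η).trans (S.inner_left ξ ((star T : Adj R E).1 η))
  star_add T S := Adj.eq_star fun ξ η => by
    change inner R (T.1 ξ + S.1 ξ) η = inner R ξ ((star T : Adj R E).1 η + (star S : Adj R E).1 η)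
    rw [CStarModule.inner_add_left, CStarModule.inner_add_right, T.inner_left, S.inner_left]

instance : StarModule ℂ (Adj R E) where
  star_smul z T := Adj.eq_star fun ξ η => by
    change inner R (z • T.1 ξ) η = inner R ξ (star z • (star T : Adj R E).1 η)
    rw [CStarModule.inner_smul_left_complex, CStarModule.inner_smul_right_complex, T.inner_left]

end Adjointable

section Localization

variable {X : Type*} [TopologicalSpace X] [CompactSpace X]
variable (E : Type*) [NormedAddCommGroup E] [NormedSpace ℂ E] [SMul C(X, ℂ) E]
  [CStarModule C(X, ℂ) E]

/-- The space `E`, to be equipped with the inner product `⟨ξ, η⟩(x)`. -/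
def PreLoc (_x : X) : Type _ := E

instance (x : X) : AddCommGroup (PreLoc E x) := inferInstanceAs (AddCommGroup E)
instance (x : X) : Module ℂ (PreLoc E x) := inferInstanceAs (Module ℂ E)

variable {E} in
/-- The identity map from `E` to `PreLoc E x`. -/
def toPreLoc (x : X) : E ≃ₗ[ℂ] PreLoc E x := LinearEquiv.refl ℂ E

/-- The semi-inner product `⟨ξ, η⟩(x)` on a Hilbert `C(X)`-module. -/
abbrev preLocCore (x : X) : PreInnerProductSpace.Core ℂ (PreLoc E x) where
  inner ξ η := (inner C(X, ℂ) ((toPreLoc x).symm ξ) ((toPreLoc x).symm η)) x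
  conj_inner_symm ξ η := by
    change star ((inner C(X, ℂ) ((toPreLoc x).symm η) ((toPreLoc x).symm ξ)) x) = _
    rw [← ContinuousMap.star_apply, CStarModule.star_inner]
  re_inner_nonneg ξ := by
    have h : 0 ≤ inner C(X, ℂ) ((toPreLoc x).symm ξ) ((toPreLoc x).symm ξ) :=
      CStarModule.inner_self_nonneg
    exact (RCLike.nonneg_iff.1 (h x)).1
  add_left ξ η ζ := by rw [map_add, CStarModule.inner_add_left]; rfl
  smul_left ξ η z := by rw [_root_.map_smul, CStarModule.inner_smul_left_complex]; rfl

instance (x : X) : SeminormedAddCommGroup (PreLoc E x) :=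
  InnerProductSpace.Core.toSeminormedAddCommGroup (c := preLocCore E x)
instance (x : X) : InnerProductSpace ℂ (PreLoc E x) :=
  InnerProductSpace.ofCore (preLocCore E x)

/-- The Hilbert space `E_x = E ⊗_{e_x} ℂ`: the Hausdorff completion of `E` for the inner product
`⟨ξ, η⟩(x)`. -/
abbrev Loc (x : X) : Type _ := Completion (PreLoc E x)

variable {E}

lemma preLoc_inner (x : X) (ξ η : E) :
    inner ℂ (toPreLoc x ξ) (toPreLoc x η) = (inner C(X, ℂ) ξ η) x := rfl

lemma norm_toPreLoc_sq (x : X) (ξ : E) :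
    ‖toPreLoc x ξ‖ ^ 2 = ((inner C(X, ℂ) ξ ξ) x).re :=
  norm_sq_eq_re_inner (𝕜 := ℂ) (toPreLoc x ξ)

lemma norm_toPreLoc_le (x : X) (ξ : E) : ‖toPreLoc x ξ‖ ≤ ‖ξ‖ := by
  refine le_of_sq_le_sq ?_ (norm_nonneg _)
  rw [norm_toPreLoc_sq, CStarModule.norm_sq_eq C(X, ℂ)]
  exact (Complex.re_le_norm _).trans (ContinuousMap.norm_coe_le_norm _ x)

lemma inner_self_apply (ξ : E) (x : X) :
    (inner C(X, ℂ) ξ ξ) x = (((inner C(X, ℂ) ξ ξ) x).re : ℂ) := by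
  have h : 0 ≤ inner C(X, ℂ) ξ ξ := CStarModule.inner_self_nonneg
  exact Complex.eq_re_of_ofReal_le (h x)

lemma toPreLoc_smul (x : X) (f : C(X, ℂ)) (ξ : E) :
    ‖toPreLoc x (f • ξ)‖ = ‖f x‖ * ‖toPreLoc x ξ‖ := by
  refine (sq_eq_sq₀ (norm_nonneg _) (by positivity)).1 ?_
  rw [mul_pow, norm_toPreLoc_sq, norm_toPreLoc_sq, CStarModule.inner_op_smul_right,
    CStarModule.inner_op_smul_left, ContinuousMap.mul_apply, ContinuousMap.mul_apply,
    inner_self_apply, ContinuousMap.star_apply, mul_left_comm, RCLike.star_def, Complex.mul_conj,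
    Complex.normSq_eq_norm_sq, ← Complex.ofReal_mul, Complex.ofReal_re, Complex.ofReal_re,
    mul_comm]

lemma norm_toPreLoc_adj_le (T : Adj C(X, ℂ) E) (x : X) (ξ : E) :
    ‖toPreLoc x (T.1 ξ)‖ ≤ ‖T.1‖ * ‖toPreLoc x ξ‖ := by
  have key : ∀ ε : ℝ, 0 < ε →
      ‖toPreLoc x (T.1 ξ)‖ ≤ ‖T.1‖ * √(‖toPreLoc x ξ‖ ^ 2 + ε) := fun ε hε => by
    have hpos : ∀ y : X, 0 < √(‖toPreLoc y ξ‖ ^ 2 + ε) := fun y => Real.sqrt_pos.2 (by positivity)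
    have hcont : Continuous fun y : X => √(‖toPreLoc y ξ‖ ^ 2 + ε) := by
      simp only [norm_toPreLoc_sq]
      fun_prop
    let f : C(X, ℂ) := ⟨fun y => (((√(‖toPreLoc y ξ‖ ^ 2 + ε))⁻¹ : ℝ) : ℂ),
      Complex.continuous_ofReal.comp (hcont.inv₀ fun y => (hpos y).ne')⟩
    have hf : ∀ y, ‖f y‖ = (√(‖toPreLoc y ξ‖ ^ 2 + ε))⁻¹ := fun y => by
      change ‖(((√(‖toPreLoc y ξ‖ ^ 2 + ε))⁻¹ : ℝ) : ℂ)‖ = _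
      rw [Complex.norm_real, Real.norm_eq_abs, abs_of_pos (inv_pos.2 (hpos y))]
    have h1 : ‖f • ξ‖ ≤ 1 := by
      refine le_of_sq_le_sq ?_ zero_le_one
      rw [CStarModule.norm_sq_eq C(X, ℂ), one_pow]
      refine (ContinuousMap.norm_le _ zero_le_one).2 fun y => ?_
      rw [inner_self_apply, Complex.norm_real, ← norm_toPreLoc_sq, toPreLoc_smul, hf,
        Real.norm_eq_abs, abs_of_nonneg (by positivity)]
      refine pow_le_one₀ (by positivity) ?_
      rw [inv_mul_le_one₀ (hpos y)]
      exact Real.le_sqrt_of_sq_le (by linarith)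
    have h2 : ‖toPreLoc x (T.1 (f • ξ))‖ ≤ ‖T.1‖ :=
      (norm_toPreLoc_le x _).trans ((T.1.le_opNorm _).trans
        (mul_le_of_le_one_right (norm_nonneg _) h1))
    rw [Adj.map_smul, toPreLoc_smul, hf, inv_mul_le_iff₀ (hpos x), mul_comm] at h2
    exact h2
  have hlim : Filter.Tendsto (fun ε : ℝ => ‖T.1‖ * √(‖toPreLoc x ξ‖ ^ 2 + ε))
      (nhdsWithin 0 (Set.Ioi 0)) (nhds (‖T.1‖ * √(‖toPreLoc x ξ‖ ^ 2 + 0))) :=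
    (Continuous.tendsto (by fun_prop) 0).mono_left nhdsWithin_le_nhds
  rw [add_zero, Real.sqrt_sq (norm_nonneg _)] at hlim
  exact ge_of_tendsto hlim (Filter.eventually_of_mem self_mem_nhdsWithin fun ε hε => key ε hε)

/-- The operator `T_x = T ⊗ 1` on `E_x` induced by an adjointable operator `T` on `E`. -/
def loc (x : X) (T : Adj C(X, ℂ) E) : Loc E x →L[ℂ] Loc E x :=
  (LinearMap.mkContinuous
    ((toPreLoc x).toLinearMap ∘ₗ T.1.toLinearMap ∘ₗ (toPreLoc x).symm.toLinearMap) ‖T.1‖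
    (fun ξ => norm_toPreLoc_adj_le T x ((toPreLoc x).symm ξ))).completion

lemma loc_coe (x : X) (T : Adj C(X, ℂ) E) (ξ : E) :
    loc x T ((toPreLoc x ξ : PreLoc E x) : Loc E x) =
      ((toPreLoc x (T.1 ξ) : PreLoc E x) : Loc E x) :=
  ContinuousLinearMap.completion_apply_coe _ _

/-- A field of faithful representations of the `C(X)`-algebra `A` in the Hilbert `C(X)`-module
`E`: a `C(X)`-linear ⋆-homomorphism `π : A → ℒ(E)` such that for all `x` the representation
`π_x` of `A` in `E_x` factors through a faithful representation of the fibre `A_x`. -/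
structure IsFieldOfFaithfulReps {A : Type*} [NonUnitalCStarAlgebra A] [CXAlgebra X A]
    (π : A →⋆ₙₐ[ℂ] Adj C(X, ℂ) E) : Prop where
  map_act : ∀ (f : C(X, ℂ)) (a : A) (ξ : E), (π (act f a)).1 ξ = f • (π a).1 ξ
  faithful : ∀ x : X, ∃ ρ : Fibre A x →⋆ₙₐ[ℂ] (Loc E x →L[ℂ] Loc E x),
    (∀ a, ρ (toFibre x a) = loc x (π a)) ∧ Function.Injective ρ

end Localization

section Gram

lemma isUnit_of_posDef {X : Type*} [TopologicalSpace X] {n : ℕ}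
    (N : Matrix (Fin n) (Fin n) C(X, ℂ)) (h : ∀ x, (N.map fun f => f x).PosDef) : IsUnit N := by
  rw [Matrix.isUnit_iff_isUnit_det, ContinuousMap.isUnit_iff_forall_ne_zero]
  intro x
  have e : (N.det) x = (N.map fun f => f x).det :=
    (ContinuousMap.evalAlgHom ℂ ℂ x).toRingHom.map_det N
  rw [e]
  exact (h x).det_pos.ne'

lemma exists_star_mul_self {D : Type*} [CStarAlgebra D] {a : D} (hsa : IsSelfAdjoint a)
    (h : ∀ t : ℝ, 0 < t → IsUnit ((t : ℂ) • 1 + a)) : ∃ s, a = star s * s := by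
  let _ := CStarAlgebra.spectralOrder D
  have := CStarAlgebra.spectralOrderedRing D
  rw [← CStarAlgebra.nonneg_iff_eq_star_mul_self,
    StarOrderedRing.nonneg_iff_spectrum_nonneg (R := ℝ) a hsa]
  intro t ht
  by_contra! hlt
  refine ht (spectrum.mem_resolventSet_iff.2 ?_)
  convert (h (-t) (neg_pos.2 hlt)).neg using 1
  rw [Algebra.algebraMap_eq_smul_one, neg_add, Complex.ofReal_neg, neg_smul, neg_neg,
    sub_eq_add_neg, Complex.coe_smul]

/-- A Gram matrix over `C(X)` is of the form `S⋆ S`. -/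
lemma exists_gram {X : Type*} [TopologicalSpace X] [CompactSpace X] {E : Type*}
    [NormedAddCommGroup E] [NormedSpace ℂ E] [SMul C(X, ℂ) E] [CStarModule C(X, ℂ) E] {n : ℕ}
    (ξ : Fin n → E) : ∃ S : Fin n → Fin n → C(X, ℂ),
      ∀ i j, inner C(X, ℂ) (ξ i) (ξ j) = ∑ k, star (S k i) * S k j := by
  let G : Matrix (Fin n) (Fin n) C(X, ℂ) := Matrix.of fun i j => inner C(X, ℂ) (ξ i) (ξ j)
  let G' : CStarMatrix (Fin n) (Fin n) C(X, ℂ) := CStarMatrix.ofMatrix G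
  have hG : ∀ x, (G.map fun f => f x).PosSemidef := fun x => by
    refine Matrix.PosSemidef.of_dotProduct_mulVec_nonneg ?_ fun v => ?_
    · ext i j
      change star ((inner C(X, ℂ) (ξ j) (ξ i)) x) = (inner C(X, ℂ) (ξ i) (ξ j)) x
      rw [← ContinuousMap.star_apply, CStarModule.star_inner]
    · have h : 0 ≤ inner C(X, ℂ) (∑ i, v i • ξ i) (∑ i, v i • ξ i) :=
        CStarModule.inner_self_nonneg
      have h' := h x
      rw [CStarModule.inner_sum_left] at h'
      simp only [CStarModule.inner_sum_right, CStarModule.inner_smul_left_complex,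
        CStarModule.inner_smul_right_complex] at h'
      change (0 : ℂ) ≤ (∑ i, ∑ j, v j • star (v i) • inner C(X, ℂ) (ξ i) (ξ j)) x at h'
      simp only [ContinuousMap.coe_sum, Finset.sum_apply, ContinuousMap.coe_smul, Pi.smul_apply,
        smul_eq_mul] at h'
      simp only [dotProduct, Matrix.mulVec, Finset.mul_sum]
      refine h'.trans_eq (Finset.sum_congr rfl fun i _ => Finset.sum_congr rfl fun j _ => ?_)
      change _ = star (v i) * ((inner C(X, ℂ) (ξ i) (ξ j)) x * v j)
      ring
  have hsa : IsSelfAdjoint G' := by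
    ext i j : 1
    change star (inner C(X, ℂ) (ξ j) (ξ i)) = inner C(X, ℂ) (ξ i) (ξ j)
    rw [CStarModule.star_inner]
  have hpos : ∀ t : ℝ, 0 < t → IsUnit ((t : ℂ) • 1 + G') := fun t ht => by
    have hu : IsUnit ((t : ℂ) • 1 + G) := by
      refine isUnit_of_posDef _ fun x => ?_
      have e : (((t : ℂ) • 1 + G).map fun f => f x) = (t : ℂ) • 1 + G.map fun f => f x := by
        ext i j
        by_cases hij : i = j
        · subst hij
          simp
        · simp [hij]
      rw [e]
      refine (Matrix.PosDef.smul Matrix.PosDef.one ?_).add_posSemidef (hG x)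
      exact_mod_cast ht
    exact hu.map (CStarMatrix.ofMatrixRingEquiv (n := Fin n) (A := C(X, ℂ)))
  obtain ⟨S, hS⟩ := exists_star_mul_self (D := CStarMatrix (Fin n) (Fin n) C(X, ℂ)) hsa hpos
  refine ⟨fun k i => S k i, fun i j => ?_⟩
  have := congr_fun (congr_fun hS i) j
  rw [CStarMatrix.mul_apply] at this
  exact this

end Gram

section Interior

variable {X : Type*} [TopologicalSpace X] [CompactSpace X]
variable {E : Type*} [NormedAddCommGroup E] [NormedSpace ℂ E] [SMul C(X, ℂ) E]
  [CStarModule C(X, ℂ) E]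
variable {B : Type*} [NonUnitalCStarAlgebra B] [CXAlgebra X B]

/-- The linear map `η ⊗ c ↦ b⋆ (⟨ξ, η⟩ c)`. -/
def intInnerRight (ξ : E) (b : B) : E ⊗[ℂ] B →ₗ[ℂ] B :=
  TensorProduct.lift (LinearMap.mk₂ ℂ (fun η c => star b * act (inner C(X, ℂ) ξ η) c)
    (fun η η' c => by rw [CStarModule.inner_add_right, act_add, mul_add])
    (fun z η c => by rw [CStarModule.inner_smul_right_complex, act_smul, mul_smul_comm])
    (fun η c c' => by rw [map_add, mul_add])
    (fun z η c => by rw [map_smul, mul_smul_comm]))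

variable (X) in
/-- The `B`-valued semi-inner product on the algebraic tensor product `E ⊗ B`, given by
`⟨ξ ⊗ b, η ⊗ c⟩ = b⋆ (⟨ξ, η⟩ c)`. -/
def intInner : E ⊗[ℂ] B →ₗ⋆[ℂ] E ⊗[ℂ] B →ₗ[ℂ] B :=
  TensorProduct.lift (LinearMap.mk₂'ₛₗ (starRingEnd ℂ) (starRingEnd ℂ)
    (fun (ξ : E) (b : B) => intInnerRight (X := X) ξ b)
    (fun ξ ξ' b => TensorProduct.ext' fun η c => by
      simp only [intInnerRight, TensorProduct.lift.tmul, LinearMap.mk₂_apply, LinearMap.add_apply]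
      rw [CStarModule.inner_add_left, act_add, mul_add])
    (fun z ξ b => TensorProduct.ext' fun η c => by
      simp only [intInnerRight, TensorProduct.lift.tmul, LinearMap.mk₂_apply, LinearMap.smul_apply]
      rw [CStarModule.inner_smul_left_complex, act_smul, mul_smul_comm]; rfl)
    (fun ξ b b' => TensorProduct.ext' fun η c => by
      simp only [intInnerRight, TensorProduct.lift.tmul, LinearMap.mk₂_apply, LinearMap.add_apply]
      rw [star_add, add_mul])
    (fun z ξ b => TensorProduct.ext' fun η c => by
      simp only [intInnerRight, TensorProduct.lift.tmul, LinearMap.mk₂_apply, LinearMap.smul_apply]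
      rw [star_smul, smul_mul_assoc]; rfl))

lemma intInner_tmul (ξ η : E) (b c : B) :
    intInner X (ξ ⊗ₜ[ℂ] b) (η ⊗ₜ[ℂ] c) = star b * act (inner C(X, ℂ) ξ η) c := by
  simp only [intInner, intInnerRight, TensorProduct.lift.tmul, LinearMap.mk₂'ₛₗ_apply,
    LinearMap.mk₂_apply]

/-- Induction on both arguments. -/
lemma tensor_induction₂ {P : E ⊗[ℂ] B → E ⊗[ℂ] B → Prop} (h0 : ∀ t, P 0 t) (h0' : ∀ s, P s 0)
    (ht : ∀ (ξ : E) (b : B) (η : E) (c : B), P (ξ ⊗ₜ b) (η ⊗ₜ c))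
    (ha : ∀ s s' t, P s t → P s' t → P (s + s') t)
    (ha' : ∀ s t t', P s t → P s t' → P s (t + t')) (s t : E ⊗[ℂ] B) : P s t := by
  induction s with
  | zero => exact h0 t
  | add s s' h h' => exact ha _ _ _ h h'
  | tmul ξ b =>
    induction t with
    | zero => exact h0' _
    | add t t' h h' => exact ha' _ _ _ h h'
    | tmul η c => exact ht _ _ _ _

lemma star_intInner (s t : E ⊗[ℂ] B) : star (intInner X s t) = intInner X t s := by
  refine tensor_induction₂ (P := fun s t => star (intInner X s t) = intInner X t s)
    (fun t => by simp) (fun s => by simp) (fun ξ b η c => ?_)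
    (fun s s' t h h' => ?_) (fun s t t' h h' => ?_) s t
  · rw [intInner_tmul, intInner_tmul, star_mul, star_star, star_act, CStarModule.star_inner,
      ← act_mul, mul_act]
  · rw [map_add, map_add, LinearMap.add_apply, star_add, h, h']
  · rw [map_add, map_add, LinearMap.add_apply, star_add, h, h']

/-- Right multiplication by `b` on `E ⊗ B`. -/
def tensorMulRight (b : B) : E ⊗[ℂ] B →ₗ[ℂ] E ⊗[ℂ] B :=
  TensorProduct.map LinearMap.id (LinearMap.mulRight ℂ b)

lemma intInner_mulRight (s t : E ⊗[ℂ] B) (b : B) :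
    intInner X s (tensorMulRight b t) = intInner X s t * b := by
  refine tensor_induction₂ (P := fun s t => intInner X s (tensorMulRight b t) = intInner X s t * b)
    (fun t => by simp) (fun s => by simp) (fun ξ b' η c => ?_)
    (fun s s' t h h' => ?_) (fun s t t' h h' => ?_) s t
  · change intInner X (ξ ⊗ₜ b') (η ⊗ₜ (c * b)) = _
    rw [intInner_tmul, intInner_tmul, act_mul, mul_assoc]
  · rw [map_add, LinearMap.add_apply, LinearMap.add_apply, add_mul, h, h']
  · rw [map_add, map_add, map_add, add_mul, h, h']

lemma intInner_mulRight_left (s t : E ⊗[ℂ] B) (b : B) :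
    intInner X (tensorMulRight b s) t = star b * intInner X s t := by
  rw [← star_intInner, intInner_mulRight, star_mul, star_intInner]

/-- The operator `1 ⊗ f` on `E ⊗ B`. -/
def tensorAct (f : C(X, ℂ)) : E ⊗[ℂ] B →ₗ[ℂ] E ⊗[ℂ] B :=
  TensorProduct.map LinearMap.id (act f).toLinearMap

lemma intInner_tensorAct (s t : E ⊗[ℂ] B) (f : C(X, ℂ)) :
    intInner X s (tensorAct f t) = act f (intInner X s t) := by
  refine tensor_induction₂ (P := fun s t => intInner X s (tensorAct f t) = act f (intInner X s t))
    (fun t => by simp) (fun s => by simp) (fun ξ b η c => ?_)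
    (fun s s' t h h' => ?_) (fun s t t' h h' => ?_) s t
  · change intInner X (ξ ⊗ₜ b) (η ⊗ₜ (act f c)) = _
    rw [intInner_tmul, intInner_tmul, act_act, ← mul_act, act_act, mul_comm]
  · rw [map_add, LinearMap.add_apply, LinearMap.add_apply, map_add, h, h']
  · rw [map_add, map_add, map_add, map_add, h, h']

lemma intInner_tensorAct_self (s : E ⊗[ℂ] B) (f : C(X, ℂ)) :
    intInner X (tensorAct f s) (tensorAct f s) = act (f * star f) (intInner X s s) := by
  rw [intInner_tensorAct, ← star_intInner, intInner_tensorAct, star_act, star_intInner, act_act]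

lemma exists_eq_sum_tmul (s : E ⊗[ℂ] B) :
    ∃ (n : ℕ) (ξ : Fin n → E) (b : Fin n → B), s = ∑ i, ξ i ⊗ₜ[ℂ] b i := by
  induction s with
  | zero => exact ⟨0, fun _ => 0, fun _ => 0, by simp⟩
  | tmul ξ b => exact ⟨1, fun _ => ξ, fun _ => b, by simp⟩
  | add s t h h' =>
    obtain ⟨n, ξ, b, rfl⟩ := h
    obtain ⟨m, η, c, rfl⟩ := h'
    exact ⟨n + m, Fin.append ξ η, Fin.append b c, by simp [Fin.sum_univ_add]⟩

variable (X) in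
/-- The seminorm `‖s‖ = ‖⟨s, s⟩‖ ^ (1/2)` on `E ⊗ B`. -/
def intNorm (s : E ⊗[ℂ] B) : ℝ := √‖intInner X s s‖

lemma intNorm_sq (s : E ⊗[ℂ] B) : intNorm X s ^ 2 = ‖intInner X s s‖ :=
  Real.sq_sqrt (norm_nonneg _)

variable [PartialOrder B] [StarOrderedRing B]

lemma intInner_self_nonneg (s : E ⊗[ℂ] B) : 0 ≤ intInner X s s := by
  obtain ⟨n, ξ, b, rfl⟩ := exists_eq_sum_tmul s
  obtain ⟨S, hS⟩ := exists_gram (X := X) ξ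
  have key : intInner X (∑ i, ξ i ⊗ₜ[ℂ] b i) (∑ i, ξ i ⊗ₜ[ℂ] b i) =
      ∑ k, star (∑ i, act (S k i) (b i)) * ∑ i, act (S k i) (b i) := by
    have hsum : ∀ (g : Fin n → C(X, ℂ)) (c : B), act (∑ k, g k) c = ∑ k, act (g k) c :=
      fun g c => map_sum (⟨⟨fun f => act f c, act_zero c⟩, fun f f' => act_add f f' c⟩ : C(X, ℂ) →+ B) g _
    simp only [map_sum, LinearMap.sum_apply, intInner_tmul, hS, star_sum, Finset.sum_mul,
      Finset.mul_sum, hsum]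
    rw [Finset.sum_congr rfl fun i _ => Finset.sum_comm, Finset.sum_comm]
    refine Finset.sum_congr rfl fun k _ => ?_
    refine Finset.sum_congr rfl fun i _ => Finset.sum_congr rfl fun j _ => ?_
    rw [star_act, ← act_mul, mul_act, mul_act, act_act]
  rw [key]
  exact Finset.sum_nonneg fun k _ => star_mul_self_nonneg _

lemma norm_sq_le_of_nonneg {a p q : B} {r : ℝ} (hp : IsSelfAdjoint p) (hr : ‖p‖ < r)
    (h : 0 ≤ star a * p * a - (2 * r) • (star a * a) + (r * r) • q) : ‖a‖ ^ 2 ≤ r * ‖q‖ := by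
  have hr0 : 0 < r := (norm_nonneg _).trans_lt hr
  have h2 : star a * p * a ≤ ‖p‖ • (star a * a) := CStarAlgebra.star_left_conjugate_le_norm_smul hp
  have h4 : star a * a ≤ r • q := by
    have h5 : 0 ≤ (r - ‖p‖) • (star a * a) :=
      smul_nonneg (sub_nonneg.2 hr.le) (star_mul_self_nonneg a)
    have h6 : 0 ≤ r • (r • q - star a * a) := by
      have e : r • (r • q - star a * a) =
        (star a * p * a - (2 * r) • (star a * a) + (r * r) • q) +
        (r - ‖p‖) • (star a * a) + (‖p‖ • (star a * a) - star a * p * a) := by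
        rw [smul_sub, smul_smul, sub_smul, mul_smul 2 r, two_smul]
        abel
      rw [e]
      exact add_nonneg (add_nonneg h h5) (sub_nonneg.2 h2)
    have h7 := smul_nonneg (inv_nonneg.2 hr0.le) h6
    rw [smul_smul, inv_mul_cancel₀ hr0.ne', one_smul] at h7
    exact sub_nonneg.1 h7
  have h8 := CStarAlgebra.norm_le_norm_of_nonneg_of_le (star_mul_self_nonneg a) h4
  rw [CStarRing.norm_star_mul_self, ← sq, norm_smul, Real.norm_eq_abs, abs_of_pos hr0] at h8
  exact h8

lemma norm_intInner_sq_le (s t : E ⊗[ℂ] B) :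
    ‖intInner X s t‖ ^ 2 ≤ ‖intInner X s s‖ * ‖intInner X t t‖ := by
  have key : ∀ r : ℝ, ‖intInner X s s‖ < r → ‖intInner X s t‖ ^ 2 ≤ r * ‖intInner X t t‖ := by
    intro r hr
    set a := intInner X s t with ha
    have h1 := intInner_self_nonneg (X := X) (tensorMulRight a s - (r : ℂ) • t)
    have h3 : intInner X (tensorMulRight a s - (r : ℂ) • t) (tensorMulRight a s - (r : ℂ) • t) =
        star a * intInner X s s * a - (2 * r) • (star a * a) + (r * r) • intInner X t t := by
      have e : intInner X t s = star a := by rw [ha, star_intInner]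
      rw [map_sub, map_sub, LinearMap.map_smulₛₗ, LinearMap.sub_apply, LinearMap.sub_apply,
        LinearMap.smul_apply, LinearMap.smul_apply, map_smul, map_smul, intInner_mulRight,
        intInner_mulRight, intInner_mulRight_left, intInner_mulRight_left, e, ← ha,
        Complex.conj_ofReal, Complex.coe_smul, Complex.coe_smul, Complex.coe_smul, two_mul,
        add_smul, mul_smul]
      abel
    rw [h3] at h1
    exact norm_sq_le_of_nonneg (star_intInner s s) hr h1
  have hlim : Filter.Tendsto (fun r : ℝ => r * ‖intInner X t t‖)
      (nhdsWithin ‖intInner X s s‖ (Set.Ioi ‖intInner X s s‖))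
      (nhds (‖intInner X s s‖ * ‖intInner X t t‖)) :=
    (Continuous.tendsto (by fun_prop) _).mono_left nhdsWithin_le_nhds
  exact ge_of_tendsto hlim (Filter.eventually_of_mem self_mem_nhdsWithin fun r hr => key r hr)

end Interior

section IntTensor

variable {X : Type*} [TopologicalSpace X] [CompactSpace X]
variable {E : Type*} [NormedAddCommGroup E] [NormedSpace ℂ E] [SMul C(X, ℂ) E]
  [CStarModule C(X, ℂ) E]
variable {B : Type*} [NonUnitalCStarAlgebra B] [CXAlgebra X B]

lemma intNorm_nonneg (s : E ⊗[ℂ] B) : 0 ≤ intNorm X s := Real.sqrt_nonneg _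

lemma intNorm_smul (z : ℂ) (s : E ⊗[ℂ] B) : intNorm X (z • s) = ‖z‖ * intNorm X s := by
  refine (sq_eq_sq₀ (intNorm_nonneg _) (mul_nonneg (norm_nonneg _) (intNorm_nonneg _))).1 ?_
  rw [mul_pow, intNorm_sq, intNorm_sq, map_smul, LinearMap.map_smulₛₗ, LinearMap.smul_apply,
    norm_smul, norm_smul, RCLike.norm_conj]
  ring

lemma intNorm_mulRight_le (b : B) (s : E ⊗[ℂ] B) :
    intNorm X (tensorMulRight b s) ≤ ‖b‖ * intNorm X s := by
  refine le_of_sq_le_sq ?_ (mul_nonneg (norm_nonneg _) (intNorm_nonneg _))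
  rw [mul_pow, intNorm_sq, intNorm_sq, intInner_mulRight, intInner_mulRight_left]
  refine (norm_mul_le _ _).trans ((mul_le_mul_of_nonneg_right (norm_mul_le _ _)
    (norm_nonneg _)).trans_eq ?_)
  rw [norm_star]
  ring

lemma intNorm_tensorAct_le (f : C(X, ℂ)) (s : E ⊗[ℂ] B) :
    intNorm X (tensorAct f s) ≤ ‖f‖ * intNorm X s := by
  refine le_of_sq_le_sq ?_ (mul_nonneg (norm_nonneg _) (intNorm_nonneg _))
  rw [mul_pow, intNorm_sq, intNorm_sq, intInner_tensorAct_self]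
  refine (norm_act_le _ _).trans (mul_le_mul_of_nonneg_right ?_ (norm_nonneg _))
  refine (norm_mul_le _ _).trans_eq ?_
  rw [norm_star, sq]

variable [PartialOrder B] [StarOrderedRing B]

lemma norm_intInner_le (s t : E ⊗[ℂ] B) : ‖intInner X s t‖ ≤ intNorm X s * intNorm X t := by
  refine le_of_sq_le_sq ?_ (mul_nonneg (intNorm_nonneg _) (intNorm_nonneg _))
  rw [mul_pow, intNorm_sq, intNorm_sq]
  exact norm_intInner_sq_le s t

lemma intNorm_add_le (s t : E ⊗[ℂ] B) : intNorm X (s + t) ≤ intNorm X s + intNorm X t := by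
  refine le_of_sq_le_sq ?_ (add_nonneg (intNorm_nonneg _) (intNorm_nonneg _))
  rw [intNorm_sq, map_add, map_add, LinearMap.add_apply, LinearMap.add_apply]
  have h1 := norm_intInner_le (X := X) s t
  have h2 := norm_intInner_le (X := X) t s
  have h3 := intNorm_sq (X := X) s
  have h4 := intNorm_sq (X := X) t
  have h5 := norm_add_le (intInner X s s + intInner X t s) (intInner X s t + intInner X t t)
  have h6 := norm_add_le (intInner X s s) (intInner X t s)
  have h7 := norm_add_le (intInner X s t) (intInner X t t)
  nlinarith

variable (X E B)

/-- The norm of the interior tensor product as a bundled seminorm. -/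
def intSeminorm : AddGroupSeminorm (E ⊗[ℂ] B) where
  toFun := intNorm X
  map_zero' := by
    have := intNorm_smul (X := X) 0 (0 : E ⊗[ℂ] B)
    rwa [zero_smul, norm_zero, zero_mul] at this
  add_le' := intNorm_add_le
  neg' a := by
    have := intNorm_smul (X := X) (-1) a
    rwa [neg_one_smul, norm_neg, norm_one, one_mul] at this

/-- The algebraic tensor product `E ⊗ B`, to be equipped with the semi-inner product. -/
def PreIntTensor (X : Type*) [TopologicalSpace X] [CompactSpace X]
    (E : Type*) [NormedAddCommGroup E] [NormedSpace ℂ E] [SMul C(X, ℂ) E]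
    [CStarModule C(X, ℂ) E]
    (B : Type*) [NonUnitalCStarAlgebra B] [CXAlgebra X B] [PartialOrder B] [StarOrderedRing B] :
    Type _ := E ⊗[ℂ] B

instance : AddCommGroup (PreIntTensor X E B) := inferInstanceAs (AddCommGroup (E ⊗[ℂ] B))
instance : Module ℂ (PreIntTensor X E B) := inferInstanceAs (Module ℂ (E ⊗[ℂ] B))

instance : SeminormedAddCommGroup (PreIntTensor X E B) :=
  AddGroupSeminorm.toSeminormedAddCommGroup
    (show AddGroupSeminorm (PreIntTensor X E B) from intSeminorm X E B)

instance : NormedSpace ℂ (PreIntTensor X E B) where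
  norm_smul_le z s := (intNorm_smul (X := X) (E := E) (B := B) z s).le

variable {E B} in
/-- The identity map from `E ⊗ B` to `PreIntTensor X E B`. -/
def toPreInt : E ⊗[ℂ] B ≃ₗ[ℂ] PreIntTensor X E B := LinearEquiv.refl ℂ (E ⊗[ℂ] B)

/-- The interior tensor product `E ⊗_{C(X)} B`: the Hausdorff completion of the algebraic tensor
product `E ⊗ B` for the `B`-valued inner product `⟨ξ ⊗ b, η ⊗ c⟩ = b⋆ (⟨ξ, η⟩ c)`. -/
abbrev IntTensor : Type _ := Completion (PreIntTensor X E B)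

variable {E B}

/-- The image of `ξ ⊗ b` in `E ⊗_{C(X)} B`. -/
def IntTensor.tmul (ξ : E) (b : B) : IntTensor X E B :=
  ((toPreInt X (ξ ⊗ₜ[ℂ] b) : PreIntTensor X E B) : IntTensor X E B)

variable {X}

/-- The semi-inner product on `PreIntTensor X E B`. -/
def preInner (s t : PreIntTensor X E B) : B :=
  intInner X ((toPreInt X).symm s) ((toPreInt X).symm t)

lemma norm_preInner_le (s t : PreIntTensor X E B) : ‖preInner s t‖ ≤ ‖s‖ * ‖t‖ :=
  norm_intInner_le (X := X) ((toPreInt X).symm s) ((toPreInt X).symm t)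

lemma norm_preInner_self (s : PreIntTensor X E B) : ‖preInner s s‖ = ‖s‖ ^ 2 :=
  (intNorm_sq (X := X) ((toPreInt X).symm s)).symm

/-- The semi-inner product as a biadditive map. -/
def preInnerHom : PreIntTensor X E B →+ PreIntTensor X E B →+ B :=
  AddMonoidHom.mk' (fun s => AddMonoidHom.mk' (fun t => preInner s t)
    (fun t t' => by rw [preInner, map_add, map_add]; rfl))
    (fun s s' => by
      ext t
      change preInner (s + s') t = preInner s t + preInner s' t
      rw [preInner, map_add, map_add, LinearMap.add_apply]; rfl)

lemma continuous_preInner :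
    Continuous fun p : PreIntTensor X E B × PreIntTensor X E B => preInner p.1 p.2 := by
  rw [continuous_iff_continuousAt]
  rintro ⟨s, t⟩
  rw [ContinuousAt, tendsto_iff_norm_sub_tendsto_zero]
  have h : Filter.Tendsto (fun p : PreIntTensor X E B × PreIntTensor X E B =>
      ‖p.1 - s‖ * ‖p.2‖ + ‖s‖ * ‖p.2 - t‖) (nhds (s, t))
      (nhds (‖s - s‖ * ‖t‖ + ‖s‖ * ‖t - t‖)) :=
    Continuous.tendsto (by fun_prop) (s, t)
  rw [sub_self, sub_self, norm_zero, zero_mul, mul_zero, add_zero] at h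
  refine squeeze_zero (fun _ => norm_nonneg _) (fun p => ?_) h
  have e : preInner p.1 p.2 - preInner s t = preInner (p.1 - s) p.2 + preInner s (p.2 - t) := by
    change preInnerHom p.1 p.2 - preInnerHom s t =
      preInnerHom (p.1 - s) p.2 + preInnerHom s (p.2 - t)
    rw [map_sub, map_sub, AddMonoidHom.sub_apply]
    abel
  rw [e]
  exact (norm_add_le _ _).trans (add_le_add (norm_preInner_le _ _) (norm_preInner_le _ _))

/-- The `B`-valued inner product of `E ⊗_{C(X)} B`, the continuous extension of `preInner`. -/
def IntTensor.innerB (s t : IntTensor X E B) : B :=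
  (Completion.isDenseInducing_coe.prodMap Completion.isDenseInducing_coe).extend
    (fun p : PreIntTensor X E B × PreIntTensor X E B => preInner p.1 p.2) (s, t)

lemma IntTensor.innerB_coe (s t : PreIntTensor X E B) :
    IntTensor.innerB (s : IntTensor X E B) (t : IntTensor X E B) = preInner s t :=
  (Completion.isDenseInducing_coe.prodMap Completion.isDenseInducing_coe).extend_eq
    continuous_preInner (s, t)

lemma IntTensor.continuous_innerB :
    Continuous fun p : IntTensor X E B × IntTensor X E B => IntTensor.innerB p.1 p.2 := by
  have di : IsDenseInducing (Completion.toCompl : PreIntTensor X E B → IntTensor X E B) :=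
    Completion.isDenseInducing_coe
  exact di.extend_Z_bilin di (φ := preInnerHom) continuous_preInner

/-- The right action of `b ∈ B` on `E ⊗_{C(X)} B`, `(ξ ⊗ c) b = ξ ⊗ c b`. -/
def IntTensor.mulRight (b : B) : IntTensor X E B →L[ℂ] IntTensor X E B :=
  (LinearMap.mkContinuous ((toPreInt X).toLinearMap ∘ₗ tensorMulRight b ∘ₗ
    (toPreInt X).symm.toLinearMap) ‖b‖
    (fun s => intNorm_mulRight_le (X := X) b ((toPreInt X).symm s))).completion

lemma IntTensor.mulRight_coe (b : B) (s : E ⊗[ℂ] B) :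
    IntTensor.mulRight b ((toPreInt X s : PreIntTensor X E B) : IntTensor X E B) =
      ((toPreInt X (tensorMulRight b s) : PreIntTensor X E B) : IntTensor X E B) :=
  ContinuousLinearMap.completion_apply_coe _ _

/-- The action of `f ∈ C(X)` on `E ⊗_{C(X)} B`, `ξ ⊗ b ↦ ξ ⊗ f b`. -/
def IntTensor.actL (f : C(X, ℂ)) : IntTensor X E B →L[ℂ] IntTensor X E B :=
  (LinearMap.mkContinuous ((toPreInt X).toLinearMap ∘ₗ tensorAct f ∘ₗ
    (toPreInt X).symm.toLinearMap) ‖f‖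
    (fun s => intNorm_tensorAct_le (X := X) f ((toPreInt X).symm s))).completion

lemma IntTensor.actL_tmul (f : C(X, ℂ)) (ξ : E) (b : B) :
    IntTensor.actL f (IntTensor.tmul X ξ b) = IntTensor.tmul X ξ (act f b) :=
  ContinuousLinearMap.completion_apply_coe _ _

/-- `E ⊗_{C(X)} B` is a right `B`-module, that is, a left module over the opposite algebra. -/
instance : SMul Bᵐᵒᵖ (IntTensor X E B) := ⟨fun b s => IntTensor.mulRight b.unop s⟩

lemma IntTensor.innerB_induction {P : IntTensor X E B → IntTensor X E B → Prop}
    (hc : IsClosed {p : IntTensor X E B × IntTensor X E B | P p.1 p.2})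
    (h : ∀ s t : E ⊗[ℂ] B, P ((toPreInt X s : PreIntTensor X E B) : IntTensor X E B)
      ((toPreInt X t : PreIntTensor X E B) : IntTensor X E B)) (s t : IntTensor X E B) : P s t :=
  Completion.induction_on₂ s t hc fun s t => h ((toPreInt X).symm s) ((toPreInt X).symm t)

lemma IntTensor.innerB_add_right (r s t : IntTensor X E B) :
    IntTensor.innerB r (s + t) = IntTensor.innerB r s + IntTensor.innerB r t := by
  have hc := IntTensor.continuous_innerB (X := X) (E := E) (B := B)
  refine Completion.induction_on₃ r s t (isClosed_eq
    (hc.comp (f := fun p : IntTensor X E B × IntTensor X E B × IntTensor X E B =>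
      (p.1, p.2.1 + p.2.2)) (by fun_prop))
    ((hc.comp (f := fun p : IntTensor X E B × IntTensor X E B × IntTensor X E B =>
      (p.1, p.2.1)) (by fun_prop)).add
    (hc.comp (f := fun p : IntTensor X E B × IntTensor X E B × IntTensor X E B =>
      (p.1, p.2.2)) (by fun_prop)))) fun r s t => ?_
  rw [← Completion.coe_add, innerB_coe, innerB_coe, innerB_coe]
  exact map_add (preInnerHom r) s t

lemma IntTensor.innerB_smul_right (z : ℂ) (s t : IntTensor X E B) :
    IntTensor.innerB s (z • t) = z • IntTensor.innerB s t := by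
  have hc := IntTensor.continuous_innerB (X := X) (E := E) (B := B)
  have h1 : Continuous fun p : IntTensor X E B × IntTensor X E B =>
      IntTensor.innerB p.1 (z • p.2) :=
    hc.comp (continuous_fst.prodMk ((continuous_const_smul z).comp continuous_snd))
  have h2 : Continuous fun p : IntTensor X E B × IntTensor X E B =>
      z • IntTensor.innerB p.1 p.2 := (continuous_const_smul z).comp hc
  refine IntTensor.innerB_induction
    (P := fun s t => IntTensor.innerB s (z • t) = z • IntTensor.innerB s t)
    (isClosed_eq h1 h2) (fun s t => ?_) s t
  rw [← Completion.coe_smul, innerB_coe, innerB_coe]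
  exact (intInner X s).map_smul z t

lemma IntTensor.innerB_mulRight (b : B) (s t : IntTensor X E B) :
    IntTensor.innerB s (IntTensor.mulRight b t) = IntTensor.innerB s t * b := by
  have hc := IntTensor.continuous_innerB (X := X) (E := E) (B := B)
  refine IntTensor.innerB_induction
    (P := fun s t => IntTensor.innerB s (IntTensor.mulRight b t) = IntTensor.innerB s t * b)
    (isClosed_eq (hc.comp (f := fun p : IntTensor X E B × IntTensor X E B =>
      (p.1, IntTensor.mulRight b p.2)) (by fun_prop)) (hc.mul continuous_const))
    (fun s t => ?_) s t
  rw [mulRight_coe, innerB_coe, innerB_coe]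
  exact intInner_mulRight s t b

lemma IntTensor.star_innerB (s t : IntTensor X E B) :
    star (IntTensor.innerB s t) = IntTensor.innerB t s := by
  have hc := IntTensor.continuous_innerB (X := X) (E := E) (B := B)
  refine IntTensor.innerB_induction
    (P := fun s t => star (IntTensor.innerB s t) = IntTensor.innerB t s)
    (isClosed_eq hc.star (hc.comp continuous_swap)) (fun s t => ?_) s t
  rw [innerB_coe, innerB_coe]
  exact star_intInner s t

lemma IntTensor.norm_sq_eq (s : IntTensor X E B) : ‖s‖ ^ 2 = ‖IntTensor.innerB s s‖ := by
  have hc := IntTensor.continuous_innerB (X := X) (E := E) (B := B)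
  refine Completion.induction_on s (isClosed_eq (by fun_prop)
    (hc.comp (f := fun p => (p, p)) (by fun_prop)).norm) fun s => ?_
  rw [innerB_coe, norm_preInner_self, Completion.norm_coe]

lemma IntTensor.innerB_self_nonneg (s : IntTensor X E B) : 0 ≤ IntTensor.innerB s s := by
  have hc := IntTensor.continuous_innerB (X := X) (E := E) (B := B)
  refine Completion.induction_on s (CStarAlgebra.isClosed_nonneg.preimage
    (hc.comp (f := fun p => (p, p)) (by fun_prop))) fun s => ?_
  rw [innerB_coe]
  exact intInner_self_nonneg ((toPreInt X).symm s)

/-- `E ⊗_{C(X)} B` is a Hilbert `B`-module, with the inner product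
`⟨ξ ⊗ b, η ⊗ c⟩ = b⋆ (⟨ξ, η⟩ c)`. -/
instance : CStarModule Bᵐᵒᵖ (IntTensor X E B) where
  inner s t := MulOpposite.op (IntTensor.innerB s t)
  inner_add_right := congr_arg MulOpposite.op (IntTensor.innerB_add_right _ _ _)
  inner_self_nonneg {s} := IntTensor.innerB_self_nonneg s
  inner_self {s} := by
    rw [MulOpposite.op_eq_zero_iff, ← norm_eq_zero, ← IntTensor.norm_sq_eq, sq_eq_zero_iff,
      norm_eq_zero]
  inner_op_smul_right := congr_arg MulOpposite.op (IntTensor.innerB_mulRight _ _ _)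
  inner_smul_right_complex := congr_arg MulOpposite.op (IntTensor.innerB_smul_right _ _ _)
  star_inner s t := congr_arg MulOpposite.op (IntTensor.star_innerB s t)
  norm_eq_sqrt_norm_inner_self s := by
    rw [MulOpposite.norm_op, ← IntTensor.norm_sq_eq, Real.sqrt_sq (norm_nonneg _)]

lemma IntTensor.inner_tmul (ξ η : E) (b c : B) :
    inner Bᵐᵒᵖ (IntTensor.tmul X ξ b) (IntTensor.tmul X η c) =
      MulOpposite.op (star b * act (inner C(X, ℂ) ξ η) c) := by
  change MulOpposite.op (IntTensor.innerB _ _) = _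
  rw [tmul, tmul, innerB_coe]
  refine congr_arg MulOpposite.op ?_
  exact intInner_tmul ξ η b c

end IntTensor
end CX

end

noncomputable section

namespace CX

universe u v w t

/-! ### Norm bounds from the growth of orbits -/

section Growth

/-! All norms are rewritten through product functionals. For `C > 0`, the spatial norm of `α` is at
most `C` exactly when `(s ⊗ t)(z⋆ α⋆ α z) ≤ C² (s ⊗ t)(z⋆ z)` (real parts) for all positive
functionals `s`, `t` and all `z` in the algebraic tensor product (`leftBdd_of_spatialNorm_le`,
`spatialNorm_le_of_leftBdd`). Bounds on elementary vectors suffice because of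
`norm_apply_le_of_orbit`: if `S` is adjoint to `T` and `‖(ST)ⁿ w‖ ≤ K C²ⁿ`, then `‖T w‖ ≤ C ‖w‖`.
The constant `K` may depend on `w`, so growth bounds survive sums, and crude estimates sharpen to
exact ones.

Put `γ = C² z⋆ z - z⋆ α⋆ α z`. Slicing by `t` gives `(s ⊗ t)(γ) = s((1 ⊗ t)(γ))`. Hence the
inequality for fixed `t` and all `s` follows once the real part of the single element `(1 ⊗ t)(γ)`
has no negative part, and that can be tested in representations chosen for convenience.

(1) A functional `t` on `B_x` maps `E ⊗ B` to `E_x ⊗ H_t`, where `H_t` is the GNS space, and this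
map intertwines the action of `α` with `(π_x ⊗ π_t)(α_x)`. The norm of `B` is the supremum of the
fibre norms (`norm_le_of_norm_toFibre_le`), and fibre norms are attained by positive functionals, so
`α` acts with norm at most `‖α‖_m` (`intNorm_intRep_le`). Conversely, a bound on `E ⊗_{C(X)} B`
passes to `E_x ⊗ H_t` by the orbit argument; it makes the slice of `γ` positive on vectors of `E_x`,
and faithfulness of `π_x` extends this to every functional `s` on `A_x` (`mNorm_le_of_intRep`).

(2) Both iterated norms are shown to be the supremum of `‖(ρ ⊗ σ ⊗ τ)(α)‖` over all points `x` and
all representations of the three fibres at `x`, an expression which does not see the bracketing. The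
difficulty is that the fibre of `A ⊗^m B` at `x` need not be `A_x ⊗_min B_x`, so a functional on
that fibre is not controlled by product representations over `x` alone. However, the product
representations over all points are jointly isometric on `A ⊗^m B`. If the last factor is a
continuous field, a functional on its fibre at `x` is approximated, on finitely many sections, by
functionals on the fibres at nearby `y` (`IsContinuousField.eventually_exists_posFun`). The slice of
`γ` is then almost positive in all product representations over a neighbourhood of `x`. Cutting off
by a function supported there, its negative part is small in the fibre at `x`
(`IsContinuousField.mNorm_le_of_reps`). -/

lemma le_of_forall_pow_le_mul_pow {r q K : ℝ} (hq : 0 ≤ q)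
    (h : ∀ k : ℕ, r ^ 2 ^ k ≤ K * q ^ 2 ^ k) : r ≤ q := by
  refine le_of_forall_pos_le_add fun ε hε => ?_
  by_contra! hlt
  have hq' : 0 < q + ε := by linarith
  have hr : 1 < r / (q + ε) := (one_lt_div hq').2 hlt
  -- If `r` exceeded `q + ε`, the powers of the quotient would outgrow any constant `K`.
  have hT := (tendsto_pow_atTop_atTop_of_one_lt hr).comp
    (tendsto_pow_atTop_atTop_of_one_lt (one_lt_two (α := ℕ)))
  obtain ⟨k, hk⟩ := (hT.eventually_gt_atTop |K|).exists
  simp only [Function.comp_apply, div_pow] at hk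
  rw [lt_div_iff₀ (by positivity)] at hk
  have h1 := h k
  have h2 : q ^ 2 ^ k ≤ (q + ε) ^ 2 ^ k := by gcongr; linarith
  have h3 : K * q ^ 2 ^ k ≤ |K| * (q + ε) ^ 2 ^ k :=
    mul_le_mul (le_abs_self K) h2 (by positivity) (abs_nonneg K)
  linarith

/-- A bound on the orbit of a vector under `S T`, with `S` a formal adjoint of `T`, bounds the
image of the vector under `T`. -/
lemma norm_apply_le_of_orbit {V : Type*} [SeminormedAddCommGroup V] [InnerProductSpace ℂ V]
    {T S : V → V} (hTS : ∀ v w, inner ℂ (T v) w = inner ℂ v (S w)) {w : V} {K C : ℝ}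
    (hC : 0 ≤ C) (h : ∀ n : ℕ, ‖(fun v => S (T v))^[n] w‖ ≤ K * (C ^ 2) ^ n) :
    ‖T w‖ ≤ C * ‖w‖ := by
  set a : V → V := fun v => S (T v) with ha
  have hST : ∀ v w, inner ℂ (S v) w = inner ℂ v (T w) := fun v w => by
    rw [← inner_conj_symm, ← hTS, inner_conj_symm]
  have hsymm : ∀ v w, inner ℂ (a v) w = inner ℂ v (a w) := fun v w => by
    simp only [ha]; rw [hST, hTS]
  have hit : ∀ (n : ℕ) v w, inner ℂ (a^[n] v) w = inner ℂ v (a^[n] w) := fun n => by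
    induction n with
    | zero => intro v w; rfl
    | succ n ih =>
      intro v w
      rw [Function.iterate_succ_apply, ih, hsymm, Function.iterate_succ_apply' a n w]
  -- Symmetry of `a` gives `‖aⁿ w‖² = ⟨w, a²ⁿ w⟩`. Neither linearity nor boundedness of `T` and `S`
  -- enters, only the adjoint relation.
  have hstep : ∀ n : ℕ, ‖a^[n] w‖ ^ 2 ≤ ‖w‖ * ‖a^[n + n] w‖ := fun n => by
    rw [← inner_self_eq_norm_sq (𝕜 := ℂ), hit, ← Function.iterate_add_apply]
    exact (RCLike.re_le_norm _).trans (norm_inner_le_norm _ _)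
  -- Repeated squaring by `hstep`: the growth of the orbit along the exponents `2 ^ k` controls its
  -- first step.
  have hpow : ∀ k : ℕ, ‖a w‖ ^ 2 ^ k ≤ ‖w‖ ^ (2 ^ k - 1) * ‖a^[2 ^ k] w‖ := fun k => by
    induction k with
    | zero => simp
    | succ k ih =>
      have e : 2 ^ (k + 1) - 1 = (2 ^ k - 1) * 2 + 1 := by
        have := Nat.one_le_two_pow (n := k); omega
      rw [pow_succ 2 k, pow_mul, ← pow_succ, e, pow_succ ‖w‖, pow_mul, mul_assoc]
      calc (‖a w‖ ^ 2 ^ k) ^ 2 ≤ (‖w‖ ^ (2 ^ k - 1) * ‖a^[2 ^ k] w‖) ^ 2 := by gcongr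
        _ = (‖w‖ ^ (2 ^ k - 1)) ^ 2 * ‖a^[2 ^ k] w‖ ^ 2 := mul_pow _ _ _
        _ ≤ (‖w‖ ^ (2 ^ k - 1)) ^ 2 * (‖w‖ * ‖a^[2 ^ k + 2 ^ k] w‖) := by gcongr; exact hstep _
        _ = _ := by rw [pow_succ 2 k, mul_two]
  have hTw : ‖T w‖ ^ 2 ≤ ‖w‖ * ‖a w‖ := by
    rw [← inner_self_eq_norm_sq (𝕜 := ℂ), hTS]
    exact (RCLike.re_le_norm _).trans (norm_inner_le_norm _ _)
  -- Null vectors, possible in a seminormed space, are separated because the root argument divides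
  -- by `‖w‖`.
  rcases eq_or_lt_of_le (norm_nonneg w) with hw | hw
  · rw [← hw, zero_mul] at hTw
    rw [← hw, mul_zero]
    exact (pow_eq_zero_iff two_ne_zero).1 (le_antisymm hTw (sq_nonneg _)) |>.le
  have key : ‖a w‖ / ‖w‖ ≤ C ^ 2 := by
    refine le_of_forall_pow_le_mul_pow (K := K / ‖w‖) (sq_nonneg C) fun k => ?_
    rw [div_pow, div_le_iff₀ (by positivity)]
    have e : ‖w‖ ^ 2 ^ k = ‖w‖ ^ (2 ^ k - 1) * ‖w‖ := by
      rw [← pow_succ, Nat.sub_add_cancel Nat.one_le_two_pow]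
    refine (hpow k).trans ?_
    rw [e]
    calc _ ≤ ‖w‖ ^ (2 ^ k - 1) * (K * (C ^ 2) ^ 2 ^ k) := by gcongr; exact h _
      _ = _ := by field_simp
  rw [div_le_iff₀ hw] at key
  refine le_of_sq_le_sq ?_ (by positivity)
  nlinarith

end Growth

/-! ### Positive functionals and their GNS representations -/

section PosFun

/-- A bounded positive functional on a C⋆-algebra. -/
structure PosFun (A : Type*) [NonUnitalCStarAlgebra A] where
  toCLM : A →L[ℂ] ℂ
  nonneg : ∀ a, 0 ≤ toCLM (star a * a)

variable {A : Type u} [NonUnitalCStarAlgebra A]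

/-- A positive functional as a positive linear map for the spectral order. -/
def PosFun.toPositive (s : PosFun A) :
    letI := CStarAlgebra.spectralOrder A
    A →ₚ[ℂ] ℂ :=
  letI := CStarAlgebra.spectralOrder A
  haveI := CStarAlgebra.spectralOrderedRing A
  PositiveLinearMap.mk₀ s.toCLM.toLinearMap fun a ha => by
    obtain ⟨b, rfl⟩ := CStarAlgebra.nonneg_iff_eq_star_mul_self.1 ha
    exact s.nonneg b

lemma PosFun.map_star (s : PosFun A) (a : A) : s.toCLM (star a) = star (s.toCLM a) := by
  let _ := CStarAlgebra.spectralOrder A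
  have := CStarAlgebra.spectralOrderedRing A
  exact StarHomClass.map_star s.toPositive a

/-- The GNS representation of a positive functional. -/
lemma PosFun.exists_gns (s : PosFun A) : ∃ (ρ : HilbertRep A) (κ : A →ₗ[ℂ] ρ.H),
    (∀ a b, inner ℂ (κ a) (κ b) = s.toCLM (star a * b)) ∧
    ∀ a b, ρ.π a (κ b) = κ (a * b) := by
  let _ := CStarAlgebra.spectralOrder A
  have := CStarAlgebra.spectralOrderedRing A
  let f : A →ₚ[ℂ] ℂ := s.toPositive
  refine ⟨⟨f.GNS, f.gnsNonUnitalStarAlgHom⟩,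
    (Completion.toComplL : f.PreGNS →L[ℂ] f.GNS).toLinearMap ∘ₗ f.toPreGNS.toLinearMap,
    fun a b => ?_, fun a b => ?_⟩
  · exact Completion.inner_coe _ _
  · exact f.gnsNonUnitalStarAlgHom_apply_coe

/-- The GNS representation of a positive functional. -/
def PosFun.gns (s : PosFun A) : HilbertRep A := s.exists_gns.choose

/-- The canonical map from the algebra to the GNS space. -/
def PosFun.cls (s : PosFun A) : A →ₗ[ℂ] s.gns.H := s.exists_gns.choose_spec.choose

lemma PosFun.inner_cls (s : PosFun A) (a b : A) :
    inner ℂ (s.cls a) (s.cls b) = s.toCLM (star a * b) :=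
  s.exists_gns.choose_spec.choose_spec.1 a b

lemma PosFun.gns_cls (s : PosFun A) (a b : A) : s.gns.π a (s.cls b) = s.cls (a * b) :=
  s.exists_gns.choose_spec.choose_spec.2 a b

/-- The vector functional `a ↦ ⟨e, ρ(a) e⟩`. -/
def PosFun.ofVec {H : Type*} [NormedAddCommGroup H] [InnerProductSpace ℂ H] [CompleteSpace H]
    (ρ : A →⋆ₙₐ[ℂ] (H →L[ℂ] H)) (e : H) : PosFun A where
  toCLM := LinearMap.mkContinuous
    { toFun := fun a => inner ℂ e (ρ a e)
      map_add' := fun a b => by rw [map_add, add_apply, inner_add_right]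
      map_smul' := fun z a => by rw [map_smul, smul_apply, inner_smul_right]; rfl }
    (‖e‖ * ‖e‖) fun a => by
      refine (norm_inner_le_norm _ _).trans ?_
      have h1 := (ρ a).le_opNorm e
      have h2 := NonUnitalStarAlgHom.norm_apply_le ρ a
      calc ‖e‖ * ‖ρ a e‖ ≤ ‖e‖ * (‖a‖ * ‖e‖) := by
            gcongr; exact h1.trans (by gcongr)
        _ = _ := by ring
  nonneg a := by
    change 0 ≤ inner ℂ e (ρ (star a * a) e)
    rw [map_mul, StarHomClass.map_star, mul_apply_eq_comp,
      ContinuousLinearMap.star_eq_adjoint, ContinuousLinearMap.adjoint_inner_right,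
      inner_self_eq_norm_sq_to_K, ← RCLike.ofReal_pow]
    exact RCLike.ofReal_nonneg.2 (sq_nonneg _)

lemma PosFun.ofVec_apply {H : Type*} [NormedAddCommGroup H] [InnerProductSpace ℂ H]
    [CompleteSpace H] (ρ : A →⋆ₙₐ[ℂ] (H →L[ℂ] H)) (e : H) (a : A) :
    (PosFun.ofVec ρ e).toCLM a = inner ℂ e (ρ a e) := rfl

/-- A linear combination `p s + q t` of positive functionals with nonnegative coefficients. -/
def PosFun.comb (s t : PosFun A) {p q : ℝ} (hp : 0 ≤ p) (hq : 0 ≤ q) : PosFun A where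
  toCLM := (p : ℂ) • s.toCLM + (q : ℂ) • t.toCLM
  nonneg a := by
    have hp' : (0 : ℂ) ≤ p := by exact_mod_cast hp
    have hq' : (0 : ℂ) ≤ q := by exact_mod_cast hq
    exact add_nonneg (mul_nonneg hp' (s.nonneg a)) (mul_nonneg hq' (t.nonneg a))

/-- The positive functional `a ↦ s (b⋆ a b)`. -/
def PosFun.conj (s : PosFun A) (b : A) : PosFun A where
  toCLM := s.toCLM ∘L ContinuousLinearMap.mul ℂ A (star b) ∘L
    (ContinuousLinearMap.mul ℂ A).flip b
  nonneg a := by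
    have := s.nonneg (a * b)
    rw [star_mul, mul_assoc] at this
    simpa [mul_assoc] using this

lemma PosFun.conj_apply (s : PosFun A) (a b : A) :
    (s.conj b).toCLM a = s.toCLM (star b * (a * b)) := rfl

end PosFun

/-! ### States and norm-attaining positive functionals -/

section States

/-- A functional of norm one on a unital C⋆-algebra which maps `1` to `1` is positive. -/
lemma nonneg_of_norm_le_one {U : Type*} [CStarAlgebra U] (g : U →L[ℂ] ℂ) (hg : ‖g‖ ≤ 1)
    (h1 : g 1 = 1) (b : U) : 0 ≤ g (star b * b) := by
  let _ := CStarAlgebra.spectralOrder U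
  have := CStarAlgebra.spectralOrderedRing U
  set h := star b * b with hh
  have hh0 : 0 ≤ h := star_mul_self_nonneg b
  have hsa : IsSelfAdjoint h := IsSelfAdjoint.star_mul_self b
  have hle : ∀ c, ‖g c‖ ≤ ‖c‖ := fun c => (g.le_opNorm c).trans
    (mul_le_of_le_one_left (norm_nonneg _) hg)
  have him : (g h).im = 0 := by
    -- Adding `it` to `h` shifts the imaginary part of `g h` by `t`, while the C⋆-identity gives `‖h
    -- + it‖² = ‖h² + t²‖`. The left side has a term linear in `t` and the right side has none, so
    -- `Im (g h)` must vanish.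
    have key : ∀ t : ℝ, ((g h).im + t) ^ 2 ≤ ‖h‖ ^ 2 + t ^ 2 * ‖(1 : U)‖ := fun t => by
      have e1 : g (h + (t * Complex.I) • 1) = g h + t * Complex.I := by
        rw [map_add, map_smul, h1, smul_eq_mul, mul_one]
      have e2 : star (h + (t * Complex.I : ℂ) • (1 : U)) * (h + (t * Complex.I : ℂ) • 1) =
          h * h + ((t : ℂ) ^ 2) • 1 := by
        rw [star_add, star_smul, star_one, hsa.star_eq]
        have e3 : star (t * Complex.I : ℂ) = -(t * Complex.I) := by simp
        have e4 : (t * Complex.I : ℂ) * (t * Complex.I) = -(t : ℂ) ^ 2 := by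
          rw [mul_mul_mul_comm, Complex.I_mul_I]; ring
        rw [e3]
        simp only [mul_add, add_mul, smul_mul_assoc, mul_smul_comm, one_mul, mul_one, smul_add,
          smul_smul, mul_neg, e4, neg_neg]
        rw [neg_smul]
        abel
      have e5 : ‖h + (t * Complex.I : ℂ) • (1 : U)‖ ^ 2 ≤ ‖h‖ ^ 2 + t ^ 2 * ‖(1 : U)‖ := by
        rw [sq, ← CStarRing.norm_star_mul_self, e2]
        refine (norm_add_le _ _).trans (add_le_add ((norm_mul_le _ _).trans_eq (sq _).symm) ?_)
        rw [norm_smul, norm_pow, Complex.norm_real, Real.norm_eq_abs, sq_abs]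
      have e6 := hle (h + (t * Complex.I : ℂ) • (1 : U))
      rw [e1] at e6
      have e7 : ((g h).im + t) ^ 2 ≤ ‖g h + t * Complex.I‖ ^ 2 := by
        have e8 : (g h + t * Complex.I).im = (g h).im + t := by simp
        rw [← e8, ← sq_abs]
        gcongr
        exact Complex.abs_im_le_norm _
      exact e7.trans ((pow_le_pow_left₀ (norm_nonneg _) e6 2).trans e5)
    have hn : Nontrivial U := by
      refine ⟨1, 0, fun h0 => ?_⟩
      rw [h0, map_zero] at h1
      exact zero_ne_one h1
    rw [CStarRing.norm_one] at key
    by_contra hne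
    -- The value of `t` for which the linear term `2 t Im (g h)` is `‖h‖² + 1`, too large for the
    -- bound.
    have := key ((‖h‖ ^ 2 + 1) / (2 * (g h).im))
    have e : 2 * (g h).im * ((‖h‖ ^ 2 + 1) / (2 * (g h).im)) = ‖h‖ ^ 2 + 1 := by
      field_simp
    nlinarith [sq_nonneg (g h).im]
  have hre : 0 ≤ (g h).re := by
    -- From `0 ≤ ‖h‖ - h ≤ ‖h‖`; applying `g` yields `‖h‖ - Re (g h) ≤ ‖h‖`.
    have e1 : ‖algebraMap ℝ U ‖h‖ - h‖ ≤ ‖h‖ := by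
      have h2 : h ≤ algebraMap ℝ U ‖h‖ := hsa.le_algebraMap_norm_self
      have h3 : algebraMap ℝ U ‖h‖ - h ≤ algebraMap ℝ U ‖h‖ := sub_le_self _ hh0
      exact (CStarAlgebra.norm_le_iff_le_algebraMap _ (norm_nonneg _) (sub_nonneg.2 h2)).2 h3
    have e2 : g (algebraMap ℝ U ‖h‖ - h) = ‖h‖ - g h := by
      rw [map_sub, Algebra.algebraMap_eq_smul_one, ← Complex.coe_smul, map_smul, h1, smul_eq_mul,
        mul_one]
    have e3 := (hle _).trans e1
    rw [e2] at e3
    have e4 := (Complex.re_le_norm _).trans e3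
    rw [Complex.sub_re, Complex.ofReal_re] at e4
    linarith
  exact Complex.nonneg_iff.2 ⟨hre, him.symm⟩

/-- Hahn–Banach in the unitization, applied to `1 + p` with `p = a⋆ a` rather than to `p`: since `‖1
+ p‖ = 1 + ‖p‖`, a norming functional of norm at most one must attain both `g 1 = 1` and `g p =
‖p‖`. The first equality makes it positive; its restriction to `A` is the required functional. -/
lemma exists_posFun_eq_norm {A : Type*} [NonUnitalCStarAlgebra A] (a : A) :
    ∃ t : PosFun A, (∀ b, ‖t.toCLM b‖ ≤ ‖b‖) ∧ t.toCLM (star a * a) = ((‖a‖ ^ 2 : ℝ) : ℂ) := by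
  let U := Unitization ℂ A
  let _ := CStarAlgebra.spectralOrder U
  have := CStarAlgebra.spectralOrderedRing U
  set p : U := (Unitization.inr (star a * a) : U) with hp
  have hpn : ‖p‖ = ‖a‖ ^ 2 := by
    rw [hp, Unitization.norm_inr, CStarRing.norm_star_mul_self, sq]
  have hp0 : 0 ≤ p := by
    have : p = star (a : U) * (a : U) := by
      rw [hp, Unitization.inr_mul, Unitization.inr_star]
    rw [this]
    exact star_mul_self_nonneg _
  have hnorm : 1 + ‖p‖ ≤ ‖1 + p‖ := by
    have h1 : ‖p‖ ∈ spectrum ℝ p := CStarAlgebra.norm_mem_spectrum_of_nonneg hp0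
    have h2 : 1 + ‖p‖ ∈ spectrum ℝ (algebraMap ℝ U 1 + p) := by
      rw [← spectrum.singleton_add_eq]
      exact Set.add_mem_add rfl h1
    rw [map_one] at h2
    exact (Real.le_norm_self _).trans (spectrum.norm_le_norm_of_mem h2)
  obtain ⟨g, hg, hgp⟩ := exists_dual_vector'' ℂ (1 + p)
  have hle : ∀ c, ‖g c‖ ≤ ‖c‖ := fun c => (g.le_opNorm c).trans
    (mul_le_of_le_one_left (norm_nonneg _) hg)
  rw [map_add] at hgp
  have h1 := hle 1
  have h2 := hle p
  rw [CStarRing.norm_one] at h1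
  have h3 : 1 + ‖p‖ ≤ (g 1).re + (g p).re := by
    rw [← Complex.add_re, hgp]
    exact hnorm
  have h4 := Complex.re_le_norm (g 1)
  have h5 := Complex.re_le_norm (g p)
  -- The real parts of `g 1` and `g p` are bounded by `1` and `‖p‖` and add up to at least `1 +
  -- ‖p‖`, so both bounds are equalities. A number whose modulus does not exceed its real part is
  -- real.
  have aux : ∀ (z : ℂ) (r : ℝ), ‖z‖ ≤ r → z.re = r → z = r := fun z r hz hr => by
    refine Complex.ext hr ?_
    have h7 : z.re ^ 2 + z.im ^ 2 ≤ r ^ 2 := by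
      have := Complex.sq_norm z
      rw [Complex.normSq_apply] at this
      nlinarith [norm_nonneg z]
    rw [hr] at h7
    exact (pow_eq_zero_iff two_ne_zero).1 (le_antisymm (by linarith) (sq_nonneg _))
  have g1 : g 1 = 1 := by exact_mod_cast aux (g 1) 1 h1 (by linarith)
  have gp : g p = (‖p‖ : ℝ) := aux (g p) ‖p‖ h2 (by linarith)
  refine ⟨⟨LinearMap.mkContinuous (g.toLinearMap ∘ₗ
    (Unitization.inrNonUnitalAlgHom ℂ A : A →ₗ[ℂ] U)) 1 fun b => ?_, fun b => ?_⟩,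
    fun b => ?_, ?_⟩
  · rw [one_mul]
    exact (hle _).trans_eq (Unitization.norm_inr b)
  · have := nonneg_of_norm_le_one g hg g1 (b : U)
    rw [← Unitization.inr_star, ← Unitization.inr_mul] at this
    exact this
  · exact (hle _).trans_eq (Unitization.norm_inr b)
  · rw [← hpn]
    exact gp

end States

/-! ### Tensor products of ⋆-representations on pre-Hilbert spaces -/

section TensorOp

variable {R S : Type*} [NonUnitalRing R] [NonUnitalRing S] [Module ℂ R] [Module ℂ S]
variable {V W : Type*} [NormedAddCommGroup V] [InnerProductSpace ℂ V] [NormedAddCommGroup W]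
  [InnerProductSpace ℂ W]

/-- The map `a ⊗ b ↦ φ(a) ⊗ ψ(b)` with values in the bounded operators on `V ⊗ W`. -/
def tensorOp (φ : R →ₗ[ℂ] (V →L[ℂ] V)) (ψ : S →ₗ[ℂ] (W →L[ℂ] W)) :
    R ⊗[ℂ] S →ₗ[ℂ] (V ⊗[ℂ] W →L[ℂ] V ⊗[ℂ] W) :=
  TensorProduct.lift (LinearMap.mk₂ ℂ (fun a b => TensorProduct.mapL (φ a) (ψ b))
    (fun a a' b => by rw [map_add, TensorProduct.mapL_add_left])
    (fun z a b => by rw [map_smul, TensorProduct.mapL_smul_left])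
    (fun a b b' => by rw [map_add, TensorProduct.mapL_add_right])
    (fun z a b => by rw [map_smul, TensorProduct.mapL_smul_right]))

lemma tensorOp_tmul (φ : R →ₗ[ℂ] (V →L[ℂ] V)) (ψ : S →ₗ[ℂ] (W →L[ℂ] W)) (a : R) (b : S) :
    tensorOp φ ψ (a ⊗ₜ b) = TensorProduct.mapL (φ a) (ψ b) := by
  simp [tensorOp]

lemma tensorOp_tmul_tmul (φ : R →ₗ[ℂ] (V →L[ℂ] V)) (ψ : S →ₗ[ℂ] (W →L[ℂ] W)) (a : R) (b : S)
    (e : V) (k : W) : tensorOp φ ψ (a ⊗ₜ b) (e ⊗ₜ k) = φ a e ⊗ₜ ψ b k := by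
  rw [tensorOp_tmul, TensorProduct.mapL_tmul]

/-- A linear map into the bounded operators on a pre-Hilbert space which is multiplicative and
compatible with adjoints. -/
structure IsStarRep [Star R] (φ : R →ₗ[ℂ] (V →L[ℂ] V)) : Prop where
  map_mul : ∀ a b, φ (a * b) = φ a * φ b
  adj : ∀ a v w, inner ℂ (φ a v) w = inner ℂ v (φ (star a) w)

/-- A bound on the orbits of the vectors in a spanning set bounds the operator. -/
lemma IsStarRep.norm_le_of_span [Star R] {T : R →ₗ[ℂ] (V →L[ℂ] V)} (hT : IsStarRep T) {α : R}
    {C : ℝ} (hC : 0 < C) {G : Set V} (hG : Submodule.span ℂ G = ⊤)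
    (h : ∀ u ∈ G, ∀ z, ‖T α (T z u)‖ ≤ C * ‖T z u‖) : ‖T α‖ ≤ C := by
  -- On the cyclic subspace generated by `u`, the bound for `T α` passes to `T α⋆`: `‖T(α⋆) v‖² =
  -- ⟨T(α) T(α⋆) v, v⟩`, and `T(α⋆) v` lies in the same subspace.
  have hstar : ∀ u ∈ G, ∀ z, ‖T (star α) (T z u)‖ ≤ C * ‖T z u‖ := fun u hu z => by
    have h1 := h u hu (star α * z)
    rw [hT.map_mul, mul_apply_eq_comp] at h1
    have h2 : ‖T (star α) (T z u)‖ ^ 2 ≤ ‖T α (T (star α) (T z u))‖ * ‖T z u‖ := by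
      rw [← inner_self_eq_norm_sq (𝕜 := ℂ), ← hT.adj]
      exact (RCLike.re_le_norm _).trans (norm_inner_le_norm _ _)
    rcases eq_or_lt_of_le (norm_nonneg (T (star α) (T z u))) with h0 | h0
    · rw [← h0]; positivity
    · have h3 : ‖T (star α) (T z u)‖ ^ 2 ≤ (C * ‖T (star α) (T z u)‖) * ‖T z u‖ :=
        h2.trans (by gcongr)
      nlinarith
  set a : V →L[ℂ] V := T (star α) * T α with ha
  -- An inequality `‖T α w‖ ≤ C ‖w‖` would not pass to sums of vectors, but the growth rate `C²` of
  -- the orbit does, since `K` may depend on `w`. So it is enough to treat the spanning set.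
  have horb : ∀ w, ∃ K, ∀ n : ℕ, ‖(a ^ n) w‖ ≤ K * (C ^ 2) ^ n := fun w => by
    have hw : w ∈ Submodule.span ℂ G := hG ▸ Submodule.mem_top
    induction hw using Submodule.span_induction with
    | mem u hu =>
      -- The vector `u` need not lie in its own cyclic subspace `T(R) u`, but `a u` does. Hence the
      -- estimate starts at the first power, and the constant chosen below absorbs the zeroth.
      have key : ∀ n : ℕ, ∃ z, (a ^ (n + 1)) u = T z u ∧ ‖T z u‖ ≤ ‖a u‖ * (C ^ 2) ^ n := by
        intro n
        induction n with
        | zero => exact ⟨star α * α, by rw [zero_add, pow_one, hT.map_mul], by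
            rw [hT.map_mul, pow_zero, mul_one]⟩
        | succ n ih =>
          obtain ⟨z, hz, hz'⟩ := ih
          refine ⟨star α * (α * z), ?_, ?_⟩
          · rw [pow_succ', mul_apply_eq_comp, hz, hT.map_mul, hT.map_mul]; rfl
          · rw [hT.map_mul, mul_apply_eq_comp]
            have h1 := hstar u hu (α * z)
            rw [hT.map_mul, mul_apply_eq_comp] at h1 ⊢
            have h2 := h u hu z
            calc _ ≤ C * ‖T α (T z u)‖ := h1
              _ ≤ C * (C * (‖a u‖ * (C ^ 2) ^ n)) := by gcongr; exact h2.trans (by gcongr)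
              _ = _ := by ring
      refine ⟨‖u‖ + ‖a u‖ / C ^ 2, fun n => ?_⟩
      cases n with
      | zero =>
        rw [pow_zero, pow_zero, mul_one, one_apply_eq_self]
        have : 0 ≤ ‖a u‖ / C ^ 2 := by positivity
        linarith
      | succ n =>
        obtain ⟨z, hz, hz'⟩ := key n
        rw [hz, add_mul, pow_succ, div_mul_eq_mul_div, mul_div_assoc, mul_div_cancel_right₀ _ (by positivity)]
        have : 0 ≤ ‖u‖ * ((C ^ 2) ^ n * C ^ 2) := by positivity
        linarith
    | zero => exact ⟨0, fun n => by simp⟩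
    | add v w _ _ hv hw =>
      obtain ⟨K, hK⟩ := hv
      obtain ⟨K', hK'⟩ := hw
      refine ⟨K + K', fun n => ?_⟩
      rw [map_add, add_mul]
      exact (norm_add_le _ _).trans (add_le_add (hK n) (hK' n))
    | smul z w _ hw =>
      obtain ⟨K, hK⟩ := hw
      refine ⟨‖z‖ * K, fun n => ?_⟩
      rw [map_smul, norm_smul, mul_assoc]
      gcongr
      exact hK n
  refine ContinuousLinearMap.opNorm_le_bound _ hC.le fun w => ?_
  obtain ⟨K, hK⟩ := horb w
  refine norm_apply_le_of_orbit (S := T (star α)) (K := K) (hT.adj α) hC.le fun n => ?_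
  have e : (fun v => T (star α) (T α v))^[n] w = (a ^ n) w := by
    induction n with
    | zero => rfl
    | succ n ih => rw [Function.iterate_succ_apply', ih, pow_succ']; rfl
  rw [e]
  exact hK n

variable [IsScalarTower ℂ R R] [SMulCommClass ℂ R R] [IsScalarTower ℂ S S] [SMulCommClass ℂ S S]

lemma IsStarRep.tensor [StarRing R] [StarRing S] [StarModule ℂ R] [StarModule ℂ S]
    {φ : R →ₗ[ℂ] (V →L[ℂ] V)} {ψ : S →ₗ[ℂ] (W →L[ℂ] W)} (hφ : IsStarRep φ) (hψ : IsStarRep ψ) :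
    IsStarRep (tensorOp φ ψ) where
  map_mul α β := by
    induction α with
    | zero => simp
    | add α α' h h' => rw [add_mul, map_add, h, h', map_add, add_mul]
    | tmul a b =>
      induction β with
      | zero => simp
      | add β β' h h' => rw [mul_add, map_add, h, h', map_add, mul_add]
      | tmul c d =>
        rw [Algebra.TensorProduct.tmul_mul_tmul, tensorOp_tmul, tensorOp_tmul, tensorOp_tmul,
          hφ.map_mul, hψ.map_mul, TensorProduct.mapL_mul]
  adj α s t := by
    induction α with
    | zero => simp
    | add α α' h h' => simp only [map_add, star_add, add_apply, inner_add_left,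
        inner_add_right, h, h']
    | tmul a b =>
      rw [TensorProduct.star_tmul, tensorOp_tmul, tensorOp_tmul]
      induction s with
      | zero => simp
      | add s s' h h' => simp only [map_add, inner_add_left, h, h']
      | tmul ξ η =>
        induction t with
        | zero => simp
        | add s s' h h' => simp only [map_add, inner_add_right, h, h']
        | tmul ξ' η' =>
          simp only [TensorProduct.mapL_tmul, TensorProduct.inner_tmul, hφ.adj, hψ.adj]

end TensorOp

/-! ### The spatial norm in terms of product functionals -/

section Spatial

variable {A : Type*} [NonUnitalCStarAlgebra A] {B : Type*} [NonUnitalCStarAlgebra B]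
variable {H : Type*} [NormedAddCommGroup H] [InnerProductSpace ℂ H] [CompleteSpace H]
variable {K : Type*} [NormedAddCommGroup K] [InnerProductSpace ℂ K] [CompleteSpace K]

/-- The linear map underlying a representation. -/
def repLin (ρ : A →⋆ₙₐ[ℂ] (H →L[ℂ] H)) : A →ₗ[ℂ] (H →L[ℂ] H) where
  toFun := ρ
  map_add' := map_add ρ
  map_smul' := map_smul ρ

@[simp] lemma repLin_apply (ρ : A →⋆ₙₐ[ℂ] (H →L[ℂ] H)) (a : A) : repLin ρ a = ρ a := rfl

lemma isStarRep_repLin (ρ : A →⋆ₙₐ[ℂ] (H →L[ℂ] H)) : IsStarRep (repLin ρ) where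
  map_mul := map_mul ρ
  adj a v w := by
    rw [repLin_apply, repLin_apply, StarHomClass.map_star, ContinuousLinearMap.star_eq_adjoint,
      ContinuousLinearMap.adjoint_inner_right]

/-- The tensor product of two representations, as bounded operators on the algebraic tensor
product of the Hilbert spaces. -/
def repTensor (ρ : A →⋆ₙₐ[ℂ] (H →L[ℂ] H)) (σ : B →⋆ₙₐ[ℂ] (K →L[ℂ] K)) :
    A ⊗[ℂ] B →ₗ[ℂ] (H ⊗[ℂ] K →L[ℂ] H ⊗[ℂ] K) := tensorOp (repLin ρ) (repLin σ)

lemma isStarRep_repTensor (ρ : A →⋆ₙₐ[ℂ] (H →L[ℂ] H)) (σ : B →⋆ₙₐ[ℂ] (K →L[ℂ] K)) :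
    IsStarRep (repTensor ρ σ) := (isStarRep_repLin ρ).tensor (isStarRep_repLin σ)

lemma tensorRep_eq {A : Type u} [NonUnitalCStarAlgebra A] {B : Type v} [NonUnitalCStarAlgebra B]
    (ρ : HilbertRep A) (σ : HilbertRep B) : tensorRep ρ σ = repTensor ρ.π σ.π := rfl

lemma norm_tensorRep_le_spatialNorm {A : Type u} [NonUnitalCStarAlgebra A] {B : Type v}
    [NonUnitalCStarAlgebra B] (ρ : HilbertRep A) (σ : HilbertRep B) (α : A ⊗[ℂ] B) :
    ‖repTensor ρ.π σ.π α‖ ≤ spatialNorm α := by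
  obtain ⟨C, hC⟩ := exists_tensorRep_bound α
  exact le_ciSup (f := fun p : HilbertRep A × HilbertRep B => ‖tensorRep p.1 p.2 α‖)
    ⟨C, by rintro _ ⟨p, rfl⟩; exact hC p.1 p.2⟩ (ρ, σ)

/-- The functional `s ⊗ t` on the algebraic tensor product. -/
def PosFun.prod (s : PosFun A) (t : PosFun B) : A ⊗[ℂ] B →ₗ[ℂ] ℂ :=
  LinearMap.mul' ℂ ℂ ∘ₗ TensorProduct.map s.toCLM.toLinearMap t.toCLM.toLinearMap

lemma PosFun.prod_tmul (s : PosFun A) (t : PosFun B) (a : A) (b : B) :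
    s.prod t (a ⊗ₜ b) = s.toCLM a * t.toCLM b := rfl

/-- The slice map `1 ⊗ t` on the algebraic tensor product. -/
def PosFun.slice (t : PosFun B) : A ⊗[ℂ] B →ₗ[ℂ] A :=
  (TensorProduct.rid ℂ A).toLinearMap ∘ₗ TensorProduct.map LinearMap.id t.toCLM.toLinearMap

lemma PosFun.slice_tmul (t : PosFun B) (a : A) (b : B) :
    t.slice (a ⊗ₜ[ℂ] b) = t.toCLM b • a := by
  simp [PosFun.slice]

/-- For fixed `t`, a positivity statement about `s ⊗ t` for all `s` becomes one about a single
element of `A`, which can be tested in a suitable family of representations. -/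
lemma PosFun.prod_eq_slice (s : PosFun A) (t : PosFun B) (α : A ⊗[ℂ] B) :
    s.prod t α = s.toCLM (t.slice α) := by
  induction α with
  | zero => simp
  | add α β h h' => rw [map_add, map_add, map_add, h, h']
  | tmul a b => rw [PosFun.prod_tmul, PosFun.slice_tmul, map_smul, smul_eq_mul, mul_comm]

/-- The left multiplication by `α` has norm at most `C` for the semi-inner product defined by the
functional `u`. -/
def LeftBdd (u : A ⊗[ℂ] B →ₗ[ℂ] ℂ) (α : A ⊗[ℂ] B) (C : ℝ) : Prop :=
  ∀ z, (u (star (α * z) * (α * z))).re ≤ C ^ 2 * (u (star z * z)).re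

lemma inner_repTensor_tmul (ρ : A →⋆ₙₐ[ℂ] (H →L[ℂ] H)) (σ : B →⋆ₙₐ[ℂ] (K →L[ℂ] K)) (e : H) (k : K)
    (α : A ⊗[ℂ] B) : inner ℂ (e ⊗ₜ[ℂ] k) (repTensor ρ σ α (e ⊗ₜ k)) =
      (PosFun.ofVec ρ e).prod (PosFun.ofVec σ k) α := by
  induction α with
  | zero => simp
  | add α β h h' => rw [map_add, map_add, add_apply, inner_add_right, h, h']
  | tmul a b =>
    rw [repTensor, tensorOp_tmul_tmul, TensorProduct.inner_tmul]
    rfl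

lemma norm_repTensor_sq (ρ : A →⋆ₙₐ[ℂ] (H →L[ℂ] H)) (σ : B →⋆ₙₐ[ℂ] (K →L[ℂ] K)) (e : H) (k : K)
    (z : A ⊗[ℂ] B) : ‖repTensor ρ σ z (e ⊗ₜ[ℂ] k)‖ ^ 2 =
      ((PosFun.ofVec ρ e).prod (PosFun.ofVec σ k) (star z * z)).re := by
  rw [← inner_repTensor_tmul, (isStarRep_repTensor ρ σ).map_mul, mul_apply_eq_comp,
    ← (isStarRep_repTensor ρ σ).adj]
  exact (inner_self_eq_norm_sq (𝕜 := ℂ) _).symm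

/-- The hypothesis is the bound on the cyclic subspaces of the elementary vectors `e ⊗ k`. These
span `H ⊗ K`, so `IsStarRep.norm_le_of_span` applies. -/
lemma norm_repTensor_le_of_leftBdd (ρ : A →⋆ₙₐ[ℂ] (H →L[ℂ] H)) (σ : B →⋆ₙₐ[ℂ] (K →L[ℂ] K))
    {α : A ⊗[ℂ] B} {C : ℝ} (hC : 0 < C)
    (h : ∀ e k, LeftBdd ((PosFun.ofVec ρ e).prod (PosFun.ofVec σ k)) α C) :
    ‖repTensor ρ σ α‖ ≤ C := by
  refine (isStarRep_repTensor ρ σ).norm_le_of_span hC (TensorProduct.span_tmul_eq_top ℂ H K) ?_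
  rintro _ ⟨e, k, rfl⟩ z
  refine le_of_sq_le_sq ?_ (by positivity)
  have := h e k z
  rwa [← norm_repTensor_sq, ← norm_repTensor_sq, (isStarRep_repTensor ρ σ).map_mul,
    mul_apply_eq_comp, ← mul_pow] at this

/-- A bound on `(ρ ⊗ σ)(α)` bounds `α` for the product of the functionals given by vectors of the
two representations. -/
lemma leftBdd_of_norm_repTensor_le {D : Type*} [NonUnitalCStarAlgebra D] {A : Type*}
    [NonUnitalCStarAlgebra A] {K H : Type*} [NormedAddCommGroup K] [InnerProductSpace ℂ K]
    [CompleteSpace K] [NormedAddCommGroup H] [InnerProductSpace ℂ H] [CompleteSpace H]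
    {ρ : D →⋆ₙₐ[ℂ] (K →L[ℂ] K)} {σ : A →⋆ₙₐ[ℂ] (H →L[ℂ] H)} {κ : D →ₗ[ℂ] K} {μ : A →ₗ[ℂ] H}
    (hκ : ∀ a b, ρ a (κ b) = κ (a * b)) (hμ : ∀ a b, σ a (μ b) = μ (a * b))
    {s : PosFun D} {t : PosFun A} (hs : ∀ a b, inner ℂ (κ a) (κ b) = s.toCLM (star a * b))
    (ht : ∀ a b, inner ℂ (μ a) (μ b) = t.toCLM (star a * b)) {α : D ⊗[ℂ] A} {C : ℝ}
    (h : ‖repTensor ρ σ α‖ ≤ C) : LeftBdd (s.prod t) α C := fun z => by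
  -- The map `κ ⊗ μ` carries the semi-inner product of `s ⊗ t` to that of `K ⊗ H` and, by `h2`, left
  -- multiplication to the representation. Density of its range is not needed.
  have h1 : ∀ y z : D ⊗[ℂ] A, inner ℂ (TensorProduct.map κ μ y) (TensorProduct.map κ μ z) =
      s.prod t (star y * z) := fun y z => by
    induction y with
    | zero => simp
    | add y y' h h' => rw [map_add, star_add, inner_add_left, h, h', add_mul, map_add]
    | tmul a b =>
      induction z with
      | zero => simp
      | add z z' h h' => rw [map_add, inner_add_right, h, h', mul_add, map_add]
      | tmul a' b' =>
        rw [TensorProduct.map_tmul, TensorProduct.map_tmul, TensorProduct.inner_tmul, hs, ht,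
          TensorProduct.star_tmul, Algebra.TensorProduct.tmul_mul_tmul, PosFun.prod_tmul]
  have h2 : ∀ y z : D ⊗[ℂ] A, repTensor ρ σ y (TensorProduct.map κ μ z) =
      TensorProduct.map κ μ (y * z) := fun y z => by
    induction y with
    | zero => simp
    | add y y' h h' => rw [map_add, add_apply, h, h', add_mul, map_add]
    | tmul a b =>
      induction z with
      | zero => simp
      | add z z' h h' => rw [map_add, map_add, h, h', mul_add, map_add]
      | tmul a' b' =>
        rw [TensorProduct.map_tmul, repTensor, tensorOp_tmul_tmul, repLin_apply, repLin_apply,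
          hκ, hμ, Algebra.TensorProduct.tmul_mul_tmul, TensorProduct.map_tmul]
  have e : ∀ v : K ⊗[ℂ] H, (inner ℂ v v : ℂ).re = ‖v‖ ^ 2 :=
    fun v => inner_self_eq_norm_sq (𝕜 := ℂ) v
  rw [← h1, ← h1, ← h2, e, e, ← mul_pow]
  gcongr
  exact ContinuousLinearMap.le_of_opNorm_le _ h _

/-- The two GNS representations are among those over which `spatialNorm` takes its supremum.
Together with `spatialNorm_le_of_leftBdd` this characterises the spatial norm without mention of
Hilbert spaces. -/
lemma leftBdd_of_spatialNorm_le {A : Type u} [NonUnitalCStarAlgebra A] {B : Type v}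
    [NonUnitalCStarAlgebra B] {α : A ⊗[ℂ] B} {C : ℝ} (h : spatialNorm α ≤ C) (s : PosFun A)
    (t : PosFun B) : LeftBdd (s.prod t) α C :=
  leftBdd_of_norm_repTensor_le s.gns_cls t.gns_cls s.inner_cls t.inner_cls
    ((norm_tensorRep_le_spatialNorm s.gns t.gns α).trans h)

/-- The norm of a tensor product of representations is at most the spatial norm, whatever the
universes of the Hilbert spaces. -/
lemma norm_repTensor_le_spatialNorm (ρ : A →⋆ₙₐ[ℂ] (H →L[ℂ] H)) (σ : B →⋆ₙₐ[ℂ] (K →L[ℂ] K))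
    (α : A ⊗[ℂ] B) : ‖repTensor ρ σ α‖ ≤ spatialNorm α := by
  refine le_of_forall_pos_le_add fun ε hε => ?_
  have h0 := isCStarSeminorm_spatialNorm.nonneg α
  -- Vector functionals forget the universes of `H` and `K`; their GNS spaces live in those of `A`
  -- and `B`.
  exact norm_repTensor_le_of_leftBdd ρ σ (by linarith) fun e k =>
    leftBdd_of_spatialNorm_le (by linarith) _ _

lemma spatialNorm_le_of_leftBdd {A : Type u} [NonUnitalCStarAlgebra A] {B : Type v}
    [NonUnitalCStarAlgebra B] {α : A ⊗[ℂ] B} {C : ℝ} (hC : 0 < C)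
    (h : ∀ (s : PosFun A) (t : PosFun B), LeftBdd (s.prod t) α C) : spatialNorm α ≤ C :=
  Real.iSup_le (fun p => norm_repTensor_le_of_leftBdd p.1.π p.2.π hC fun _ _ => h _ _) hC.le

end Spatial

/-! ### The norm of a `C(X)`-algebra as the supremum of the fibre norms -/

section FibreNorm

variable {X : Type*} [TopologicalSpace X] [CompactSpace X]
variable {A : Type*} [NonUnitalCStarAlgebra A] [CXAlgebra X A]

@[simp] lemma toFibreₗ_eq_toFibre (x : X) (a : A) : toFibreₗ x a = toFibre x a := rfl

lemma toFibre_surjective (x : X) : Function.Surjective (toFibre (A := A) x) :=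
  toFibreₗ_surjective x

lemma toFibre_act (x : X) (f : C(X, ℂ)) (a : A) : toFibre x (act f a) = f x • toFibre x a :=
  toFibreₗ_act x f a

lemma norm_toFibre_le (x : X) (a : A) : ‖toFibre x a‖ ≤ ‖a‖ := norm_toFibreₗ_le x a

lemma act_sum {ι : Type*} (s : Finset ι) (f : ι → C(X, ℂ)) (a : A) :
    act (∑ i ∈ s, f i) a = ∑ i ∈ s, act (f i) a :=
  map_sum (⟨⟨fun f => act f a, act_zero a⟩, fun f f' => act_add f f' a⟩ : C(X, ℂ) →+ A) f s

/-- An element which is small at `x` is small near `x`, after multiplication by a function equal to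
`1` near `x`. -/
lemma exists_norm_act_lt_of_norm_toFibre_lt {x : X} {a : A} {c : ℝ} (h : ‖toFibre x a‖ < c) :
    ∃ k : C(X, ℂ), (∀ᶠ y in nhds x, k y = 1) ∧ ‖act k a‖ < c := by
  obtain ⟨f, hfx, hf1, hfa⟩ := exists_norm_act_lt x a (sub_pos.2 h)
  rw [toFibreₗ_eq_toFibre, add_sub_cancel] at hfa
  have hcont : Filter.Tendsto (fun t : ℝ => (1 - t)⁻¹ * ‖act f a‖)
      (nhdsWithin 0 (Set.Ioi 0)) (nhds ((1 - 0)⁻¹ * ‖act f a‖)) :=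
    (ContinuousAt.tendsto (by
      refine ContinuousAt.mul (ContinuousAt.inv₀ (by fun_prop) (by norm_num))
        continuousAt_const)).mono_left nhdsWithin_le_nhds
  rw [sub_zero, inv_one, one_mul] at hcont
  obtain ⟨δ, ⟨hδ, hδ0⟩, hδ1⟩ := (((hcont.eventually_lt_const hfa).and
    self_mem_nhdsWithin).and (mem_nhdsWithin_of_mem_nhds (Iio_mem_nhds zero_lt_one))).exists
  replace hδ0 : 0 < δ := hδ0
  replace hδ1 : δ < 1 := hδ1
  have hpos : ∀ y, 0 < max (‖f y‖ ^ 2) (1 - δ) := fun y => lt_max_of_lt_right (by linarith)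
  -- The product `g f = |f|² / max(|f|², 1 - δ)` is exactly `1` where `|f|² ≥ 1 - δ`, hence near
  -- `x`. Multiplication by `g` costs a factor of at most `(1 - δ)⁻¹`, and `δ` was chosen so that
  -- this keeps the norm below `c`.
  let g : C(X, ℂ) := ⟨fun y => star (f y) * (((max (‖f y‖ ^ 2) (1 - δ))⁻¹ : ℝ) : ℂ), by
    refine Continuous.mul (by fun_prop) (Complex.continuous_ofReal.comp
      (Continuous.inv₀ (by fun_prop) fun y => (hpos y).ne'))⟩
  have hg : ‖g‖ ≤ (1 - δ)⁻¹ := by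
    refine (ContinuousMap.norm_le _ (by rw [inv_nonneg]; linarith)).2 fun y => ?_
    change ‖star (f y) * (((max (‖f y‖ ^ 2) (1 - δ))⁻¹ : ℝ) : ℂ)‖ ≤ _
    rw [norm_mul, norm_star, Complex.norm_real, Real.norm_eq_abs, abs_of_pos (inv_pos.2 (hpos y))]
    calc ‖f y‖ * (max (‖f y‖ ^ 2) (1 - δ))⁻¹ ≤ 1 * (1 - δ)⁻¹ := by
          gcongr
          · exact (f.norm_coe_le_norm y).trans hf1
          · exact le_max_right _ _
      _ = _ := one_mul _
  refine ⟨g * f, ?_, ?_⟩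
  · have h1 : ∀ᶠ y in nhds x, 1 - δ < ‖f y‖ ^ 2 := by
      have h2 : Continuous fun y => ‖f y‖ ^ 2 := by fun_prop
      exact (h2.tendsto x).eventually_const_lt (by simp [hfx, hδ0])
    filter_upwards [h1] with y hy
    change star (f y) * (((max (‖f y‖ ^ 2) (1 - δ))⁻¹ : ℝ) : ℂ) * f y = 1
    have h0 : ‖f y‖ ^ 2 ≠ 0 := by linarith
    rw [max_eq_left hy.le, mul_right_comm, RCLike.star_def, mul_comm _ (f y), Complex.mul_conj,
      Complex.normSq_eq_norm_sq, ← Complex.ofReal_mul, mul_inv_cancel₀ h0, Complex.ofReal_one]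
  · rw [← act_act]
    refine (norm_act_le _ _).trans_lt (lt_of_le_of_lt ?_ hδ)
    gcongr

variable [T2Space X]

/-- The norm of an element of a `C(X)`-algebra is the supremum of the norms in the fibres. -/
lemma norm_le_of_norm_toFibre_le {a : A} {c : ℝ} (h : ∀ x : X, ‖toFibre x a‖ ≤ c)
    (hc : 0 ≤ c) : ‖a‖ ≤ c := by
  set p := star a * a with hp
  have hpsa : IsSelfAdjoint p := IsSelfAdjoint.star_mul_self a
  suffices ‖p‖ ≤ c ^ 2 by
    rw [hp, CStarRing.norm_star_mul_self, ← sq] at this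
    exact le_of_sq_le_sq this hc
  refine le_of_forall_pos_le_add fun ε hε => ?_
  have hx : ∀ x : X, ∃ k : C(X, ℂ), (∀ᶠ y in nhds x, k y = 1) ∧ ‖act k p‖ < c ^ 2 + ε := by
    intro x
    refine exists_norm_act_lt_of_norm_toFibre_lt ?_
    rw [hp, map_mul, StarHomClass.map_star, CStarRing.norm_star_mul_self]
    nlinarith [h x, norm_nonneg (toFibre x a)]
  choose k hk hkp using hx
  choose U hU hUo hxU using fun x => eventually_nhds_iff.1 (hk x)
  obtain ⟨t, ht⟩ := isCompact_univ.elim_finite_subcover U hUo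
    fun x _ => Set.mem_iUnion.2 ⟨x, hxU x⟩
  obtain ⟨f, hf⟩ := PartitionOfUnity.exists_isSubordinate isClosed_univ
    (fun i : t => U i) (fun i => hUo i) (fun y hy => by
      obtain ⟨i, hi, hy⟩ := Set.mem_iUnion₂.1 (ht hy)
      exact Set.mem_iUnion.2 ⟨⟨i, hi⟩, hy⟩)
  let F : t → C(X, ℂ) := fun i => ⟨fun y => ((f i y : ℝ) : ℂ), by fun_prop⟩
  have hF1 : ∀ i, ‖F i‖ ≤ 1 := fun i => by
    refine (ContinuousMap.norm_le _ zero_le_one).2 fun y => ?_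
    change ‖((f i y : ℝ) : ℂ)‖ ≤ 1
    rw [Complex.norm_real, Real.norm_eq_abs, abs_of_nonneg (f.nonneg i y)]
    exact f.le_one i y
  have hFsum : ∑ i, F i = 1 := by
    ext y
    rw [ContinuousMap.coe_sum, Finset.sum_apply]
    change ∑ i, ((f i y : ℝ) : ℂ) = 1
    rw [← Complex.ofReal_sum, ← finsum_eq_sum_of_fintype, f.sum_eq_one (Set.mem_univ y),
      Complex.ofReal_one]
  -- The support of `F i` lies in `U i`, where `k i = 1`; so powers of `k i` can be inserted freely.
  have hFk : ∀ (i : t) (n : ℕ), F i * k i ^ n = F i := fun i n => by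
    ext y
    by_cases hy : y ∈ U i
    · rw [ContinuousMap.mul_apply, ContinuousMap.pow_apply, hU i y hy, one_pow, mul_one]
    · have h0 : f i y = 0 := image_eq_zero_of_notMem_tsupport fun hy' => hy (hf i hy')
      have h1 : F i y = 0 := by
        change ((f i y : ℝ) : ℂ) = 0
        rw [h0, Complex.ofReal_zero]
      rw [ContinuousMap.mul_apply, h1, zero_mul]
  -- Here `P = p ^ 2 ^ n`, and `k ^ 2 ^ n P` is the corresponding power of `k p`. Gluing by a
  -- partition of unity loses the number of pieces as a factor; applied to these powers of `p`, the
  -- loss disappears on taking roots.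
  have hP : ∀ n : ℕ, ∃ P : A, IsSelfAdjoint P ∧ ‖P‖ = ‖p‖ ^ 2 ^ n ∧
      ∀ i : t, ‖act (k i ^ 2 ^ n) P‖ ≤ (c ^ 2 + ε) ^ 2 ^ n := fun n => by
    induction n with
    | zero => exact ⟨p, hpsa, by simp, fun i => by simpa using (hkp i).le⟩
    | succ n ih =>
      obtain ⟨P, hPsa, hPn, hPk⟩ := ih
      refine ⟨P * P, by rw [IsSelfAdjoint, star_mul, hPsa.star_eq], ?_, fun i => ?_⟩
      · have := CStarRing.norm_star_mul_self (x := P)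
        rw [hPsa.star_eq] at this
        rw [this, hPn, pow_succ 2 n, pow_mul, sq]
      · have e : act (k i ^ 2 ^ (n + 1)) (P * P) = act (k i ^ 2 ^ n) P * act (k i ^ 2 ^ n) P := by
          rw [mul_act, ← act_mul, act_act, ← sq, ← pow_mul, ← pow_succ, act_mul]
        rw [e, pow_succ 2 n, pow_mul, sq]
        exact (norm_mul_le _ _).trans (mul_le_mul (hPk i) (hPk i) (norm_nonneg _) (by positivity))
  refine le_of_forall_pow_le_mul_pow (K := Fintype.card t) (by positivity) fun n => ?_
  obtain ⟨P, hPsa, hPn, hPk⟩ := hP n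
  rw [← hPn]
  have e : P = ∑ i, act (F i) P := by rw [← act_sum, hFsum, act_one]
  rw [e]
  refine (norm_sum_le _ _).trans ((Finset.sum_le_card_nsmul _ _ ((c ^ 2 + ε) ^ 2 ^ n)
    fun i _ => ?_).trans_eq ?_)
  · rw [← hFk i (2 ^ n), ← act_act]
    refine (norm_act_le _ _).trans ?_
    calc _ ≤ 1 * (c ^ 2 + ε) ^ 2 ^ n := mul_le_mul (hF1 i) (hPk i) (norm_nonneg _) zero_le_one
      _ = _ := one_mul _
  · rw [nsmul_eq_mul, Finset.card_univ]

end FibreNorm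

/-! ### Negative parts as a test for positivity -/

section NegRe

variable {D : Type*} [NonUnitalCStarAlgebra D]

/-- The negative part of the real part of an element. -/
def negRe (d : D) : D := (realPart d : D)⁻

lemma PosFun.re_realPart (s : PosFun D) (d : D) :
    s.toCLM (realPart d : D) = ((s.toCLM d).re : ℂ) := by
  rw [realPart_apply_coe, ← Complex.coe_smul, map_smul, map_add, s.map_star, smul_eq_mul,
    RCLike.star_def, Complex.add_conj]
  push_cast
  ring

lemma PosFun.nonneg_of_nonneg (s : PosFun D) {d : D}
    (hd : letI := CStarAlgebra.spectralOrder D; 0 ≤ d) : 0 ≤ s.toCLM d := by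
  let _ := CStarAlgebra.spectralOrder D
  have := CStarAlgebra.spectralOrderedRing D
  exact s.toPositive.map_nonneg hd

/-- In `Re d = (Re d)⁺ - (Re d)⁻` the first summand contributes nonnegatively. Thus smallness of the
one element `negRe d` bounds the real parts of all functionals at `d` from below. -/
lemma PosFun.neg_re_negRe_le (s : PosFun D) (d : D) :
    -(s.toCLM (negRe d)).re ≤ (s.toCLM d).re := by
  let _ := CStarAlgebra.spectralOrder D
  have := CStarAlgebra.spectralOrderedRing D
  have h1 : ((realPart d : D))⁺ - negRe d = realPart d :=
    CFC.posPart_sub_negPart _ (realPart d).2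
  have h2 := s.nonneg_of_nonneg (CFC.posPart_nonneg (realPart d : D))
  have h3 := congr_arg (fun z => (s.toCLM z).re) h1
  simp only [s.re_realPart, map_sub, Complex.sub_re, Complex.ofReal_re] at h3
  have h4 := (Complex.nonneg_iff.1 h2).1
  linarith

/-- A ⋆-homomorphism commutes with the functional calculus, so `ρ (negRe d)` is the negative part of
`ρ (Re d)`, whose spectrum lies in `[-ε, ∞)`. This turns a bound on quadratic forms into a norm
bound on an element of the algebra, which can be compared across representations. -/
lemma norm_map_negRe_le {H : Type*} [NormedAddCommGroup H] [InnerProductSpace ℂ H]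
    [CompleteSpace H] (ρ : D →⋆ₙₐ[ℂ] (H →L[ℂ] H)) (d : D) {ε : ℝ} (hε : 0 ≤ ε)
    (h : ∀ e : H, -(ε * ‖e‖ ^ 2) ≤ (inner ℂ e (ρ d e) : ℂ).re) : ‖ρ (negRe d)‖ ≤ ε := by
  have hsa : IsSelfAdjoint (realPart d : D) := (realPart d).2
  have hsa' : IsSelfAdjoint (ρ (realPart d : D)) := hsa.map ρ
  have e1 : ρ (negRe d) = (ρ (realPart d : D))⁻ := by
    rw [negRe, CFC.negPart_def, CFC.negPart_def]
    exact NonUnitalStarAlgHom.map_cfcₙ ρ _ _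
      (hφ := AddMonoidHomClass.continuous_of_bound ρ 1 fun a => by
        rw [one_mul]; exact NonUnitalStarAlgHom.norm_apply_le ρ a)
  have hle : algebraMap ℝ (H →L[ℂ] H) (-ε) ≤ ρ (realPart d : D) := by
    rw [ContinuousLinearMap.le_def, ContinuousLinearMap.isPositive_def]
    have hs : IsSelfAdjoint (ρ (realPart d : D) - algebraMap ℝ (H →L[ℂ] H) (-ε)) :=
      hsa'.sub (IsSelfAdjoint.algebraMap _ (IsSelfAdjoint.all _))
    refine ⟨hs.isSymmetric, fun e => ?_⟩
    have e2 : (inner ℂ e (ρ (realPart d : D) e) : ℂ) = ((inner ℂ e (ρ d e) : ℂ).re : ℂ) :=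
      (PosFun.ofVec ρ e).re_realPart d
    rw [ContinuousLinearMap.reApplyInnerSelf_apply, inner_re_symm, sub_apply,
      inner_sub_right, e2, Algebra.algebraMap_eq_smul_one]
    change 0 ≤ ((((inner ℂ e (ρ d e) : ℂ).re : ℂ) - inner ℂ e (-ε • e))).re
    rw [← Complex.coe_smul, inner_smul_right, inner_self_eq_norm_sq_to_K, Complex.sub_re]
    have := h e
    simp only [← Complex.ofReal_pow, Complex.ofReal_re, Complex.coe_algebraMap,
      ← Complex.ofReal_mul]
    linarith
  rw [e1, CFC.negPart_def]
  refine norm_cfcₙ_le fun x hx => ?_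
  rw [quasispectrum_eq_spectrum_union_zero] at hx
  rcases hx with hx | rfl
  · have hx' := (algebraMap_le_iff_le_spectrum (ha := hsa')).1 hle x hx
    rw [Real.norm_eq_abs, abs_of_nonneg (negPart_nonneg x)]
    exact sup_le (by linarith) hε
  · simpa using hε

end NegRe

/-! ### Extending bounded maps to `A ⊗^m_{C(X)} B` -/

section Lift

variable {X : Type*} [TopologicalSpace X] [CompactSpace X]
variable {A : Type*} [NonUnitalCStarAlgebra A] [CXAlgebra X A]
variable {B : Type*} [NonUnitalCStarAlgebra B] [CXAlgebra X B]

variable (X) in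
/-- The canonical map from the algebraic tensor product to `A ⊗^m_{C(X)} B`. -/
def MinTensor.ofAlg : A ⊗[ℂ] B →ₗ[ℂ] MinTensor X A B where
  toFun α := ((preOf X α : PreMinTensor X A B) : MinTensor X A B)
  map_add' α β := Completion.coe_add (preOf X α) (preOf X β)
  map_smul' z α := Completion.coe_smul z (preOf X α)

lemma MinTensor.ofAlg_tmul (a : A) (b : B) :
    MinTensor.ofAlg X (a ⊗ₜ[ℂ] b) = MinTensor.tmul X a b := rfl

lemma MinTensor.norm_ofAlg (α : A ⊗[ℂ] B) : ‖MinTensor.ofAlg X α‖ = mNorm X α :=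
  Completion.norm_coe (preOf X α)

lemma MinTensor.denseRange_ofAlg : DenseRange (MinTensor.ofAlg X (A := A) (B := B)) :=
  Completion.denseRange_coe (α := PreMinTensor X A B)

lemma MinTensor.ofAlg_mul (α β : A ⊗[ℂ] B) :
    MinTensor.ofAlg X (α * β) = MinTensor.ofAlg X α * MinTensor.ofAlg X β :=
  MinTensor.coe_mul X A B (preOf X α) (preOf X β)

lemma MinTensor.ofAlg_star (α : A ⊗[ℂ] B) :
    MinTensor.ofAlg X (star α) = star (MinTensor.ofAlg X α) :=
  MinTensor.coe_star X A B (preOf X α)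

variable {F : Type*} [NormedAddCommGroup F] [NormedSpace ℂ F] [CompleteSpace F]

/-- The continuous extension of a linear map bounded for `‖·‖_m`. -/
def MinTensor.lift (φ : A ⊗[ℂ] B →ₗ[ℂ] F) : MinTensor X A B →L[ℂ] F :=
  φ.extendOfNorm (MinTensor.ofAlg X)

lemma MinTensor.lift_ofAlg {φ : A ⊗[ℂ] B →ₗ[ℂ] F} (h : ∀ α, ‖φ α‖ ≤ mNorm X α) (α : A ⊗[ℂ] B) :
    MinTensor.lift φ (MinTensor.ofAlg X α) = φ α :=
  LinearMap.extendOfNorm_eq MinTensor.denseRange_ofAlg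
    ⟨1, fun α => by rw [one_mul, MinTensor.norm_ofAlg]; exact h α⟩ α

end Lift

/-! ### The action of `A ⊗ B` on `E ⊗ B` and its localisations -/

section InteriorRep

variable {X : Type*} [TopologicalSpace X] [CompactSpace X]
variable {E : Type*} [NormedAddCommGroup E] [NormedSpace ℂ E] [SMul C(X, ℂ) E]
  [CStarModule C(X, ℂ) E]
variable {A : Type*} [NonUnitalCStarAlgebra A] {B : Type*} [NonUnitalCStarAlgebra B]

/-- The underlying linear map of a representation on a Hilbert module. -/
def adjLin (π : A →⋆ₙₐ[ℂ] Adj C(X, ℂ) E) : A →ₗ[ℂ] (E →ₗ[ℂ] E) where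
  toFun a := (π a).1.toLinearMap
  map_add' a b := by rw [map_add]; rfl
  map_smul' z a := by rw [map_smul]; rfl

/-- The action `(a ⊗ b) (ξ ⊗ c) = π(a) ξ ⊗ b c` of `A ⊗ B` on the algebraic tensor product
`E ⊗ B`. -/
def intRep (π : A →⋆ₙₐ[ℂ] Adj C(X, ℂ) E) :
    A ⊗[ℂ] B →ₗ[ℂ] (E ⊗[ℂ] B →ₗ[ℂ] E ⊗[ℂ] B) :=
  TensorProduct.homTensorHomMap (RingHom.id ℂ) E B E B ∘ₗ TensorProduct.map (adjLin π) (LinearMap.mul ℂ B)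

variable (π : A →⋆ₙₐ[ℂ] Adj C(X, ℂ) E)

lemma intRep_tmul_tmul (a : A) (b c : B) (ξ : E) :
    intRep π (a ⊗ₜ[ℂ] b) (ξ ⊗ₜ[ℂ] c) = (π a).1 ξ ⊗ₜ[ℂ] (b * c) := rfl

variable [CXAlgebra X A] [CXAlgebra X B]

lemma intRep_mul (α β : A ⊗[ℂ] B) (s : E ⊗[ℂ] B) :
    intRep π (α * β) s = intRep π α (intRep π β s) := by
  induction α with
  | zero => simp
  | add α α' h h' => rw [add_mul, map_add, map_add, LinearMap.add_apply, LinearMap.add_apply, h, h']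
  | tmul a b =>
    induction β with
    | zero => simp
    | add β β' h h' =>
      rw [mul_add, map_add, map_add, LinearMap.add_apply, LinearMap.add_apply, h, h', map_add]
    | tmul a' b' =>
      induction s with
      | zero => simp
      | add s s' h h' => simp only [map_add, h, h']
      | tmul ξ c =>
        rw [Algebra.TensorProduct.tmul_mul_tmul, intRep_tmul_tmul, intRep_tmul_tmul,
          intRep_tmul_tmul, map_mul, mul_assoc]
        rfl

lemma intInner_intRep (α : A ⊗[ℂ] B) (s t : E ⊗[ℂ] B) :
    intInner X (intRep π α s) t = intInner X s (intRep π (star α) t) := by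
  induction α with
  | zero => simp
  | add α α' h h' =>
    rw [star_add, map_add, map_add, LinearMap.add_apply, LinearMap.add_apply, map_add, map_add,
      LinearMap.add_apply, h, h']
  | tmul a b =>
    refine tensor_induction₂ (P := fun s t => intInner X (intRep π (a ⊗ₜ b) s) t =
      intInner X s (intRep π (star (a ⊗ₜ b)) t)) (fun t => by simp) (fun s => by simp)
      (fun ξ c η d => ?_) (fun s s' t h h' => ?_) (fun s t t' h h' => ?_) s t
    · rw [TensorProduct.star_tmul, intRep_tmul_tmul, intRep_tmul_tmul, intInner_tmul,
        intInner_tmul, Adj.inner_left, StarHomClass.map_star, star_mul, mul_assoc, mul_act]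
    · simp only [map_add, LinearMap.add_apply, h, h']
    · simp only [map_add, h, h']

/-- The canonical map `E → E_x`. -/
def locVec (x : X) : E →ₗ[ℂ] Loc E x where
  toFun ξ := ((toPreLoc x ξ : PreLoc E x) : Loc E x)
  map_add' ξ η := Completion.coe_add (toPreLoc x ξ) (toPreLoc x η)
  map_smul' z ξ := Completion.coe_smul z (toPreLoc x ξ)

lemma inner_locVec (x : X) (ξ η : E) :
    inner ℂ (locVec x ξ) (locVec x η) = (inner C(X, ℂ) ξ η) x :=
  Completion.inner_coe (𝕜 := ℂ) (toPreLoc x ξ) (toPreLoc x η)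

lemma denseRange_locVec (x : X) : DenseRange (locVec (E := E) x) :=
  Completion.denseRange_coe (α := PreLoc E x)

/-- The canonical map from `E ⊗ B` to `E_x ⊗ H_t` for a positive functional `t` on `B_x`. -/
def locMap {x : X} (t : PosFun (Fibre B x)) : E ⊗[ℂ] B →ₗ[ℂ] Loc E x ⊗[ℂ] t.gns.H :=
  TensorProduct.map (locVec x) (t.cls ∘ₗ toFibreₗ x)

/-- Composing the `B`-valued inner product with a functional on `B_x` gives a scalar inner product,
realised in `E_x ⊗ H_t`. This is the bridge between the Hilbert `B`-module and the Hilbert spaces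
that define `‖·‖_m`. -/
lemma inner_locMap {x : X} (t : PosFun (Fibre B x)) (r s : E ⊗[ℂ] B) :
    inner ℂ (locMap t r) (locMap t s) = t.toCLM (toFibre x (intInner X r s)) := by
  refine tensor_induction₂ (P := fun r s => inner ℂ (locMap t r) (locMap t s) =
    t.toCLM (toFibre x (intInner X r s))) (fun s => by simp) (fun r => by simp)
    (fun ξ b η c => ?_) (fun r r' s h h' => ?_) (fun r s s' h h' => ?_) r s
  · change inner ℂ (locVec x ξ ⊗ₜ[ℂ] t.cls (toFibre x b)) (locVec x η ⊗ₜ[ℂ] t.cls (toFibre x c)) = _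
    rw [TensorProduct.inner_tmul, inner_locVec, PosFun.inner_cls, intInner_tmul, map_mul (toFibre x),
      toFibre_act, mul_smul_comm, map_smul, StarHomClass.map_star, smul_eq_mul]
  · rw [map_add, inner_add_left, h, h', map_add, LinearMap.add_apply, map_add, map_add]
  · rw [map_add, inner_add_right, h, h', map_add, map_add, map_add]

lemma norm_locMap_sq {x : X} (t : PosFun (Fibre B x)) (s : E ⊗[ℂ] B) :
    ‖locMap t s‖ ^ 2 = (t.toCLM (toFibre x (intInner X s s))).re := by
  rw [← inner_locMap]
  exact (inner_self_eq_norm_sq (𝕜 := ℂ) _).symm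

lemma norm_locMap_le {x : X} (t : PosFun (Fibre B x)) (s : E ⊗[ℂ] B) :
    ‖locMap t s‖ ≤ √‖t.toCLM‖ * intNorm X s := by
  refine le_of_sq_le_sq ?_ (mul_nonneg (Real.sqrt_nonneg _) (intNorm_nonneg _))
  rw [norm_locMap_sq, mul_pow, Real.sq_sqrt (norm_nonneg _), intNorm_sq]
  refine (Complex.re_le_norm _).trans ((t.toCLM.le_opNorm _).trans ?_)
  gcongr
  exact norm_toFibre_le _ _

variable {π}

/-- Localisation is equivariant; only the factorisation of `π_x` through the fibre is used, not its
faithfulness. -/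
lemma locMap_intRep {x : X} {ρ : Fibre A x →⋆ₙₐ[ℂ] (Loc E x →L[ℂ] Loc E x)}
    (hρ : ∀ a, ρ (toFibre x a) = loc x (π a)) (t : PosFun (Fibre B x)) (α : A ⊗[ℂ] B)
    (s : E ⊗[ℂ] B) : locMap t (intRep π α s) =
      repTensor ρ t.gns.π (tensorFibre X x α) (locMap t s) := by
  induction α with
  | zero => simp
  | add α α' h h' =>
    rw [map_add, LinearMap.add_apply, map_add, h, h', map_add, map_add, add_apply]
  | tmul a b =>
    induction s with
    | zero => simp
    | add s s' h h' => simp only [map_add, h, h']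
    | tmul ξ c =>
      change locVec x ((π a).1 ξ) ⊗ₜ[ℂ] t.cls (toFibre x (b * c)) =
        repTensor ρ t.gns.π (toFibre x a ⊗ₜ toFibre x b) (locVec x ξ ⊗ₜ t.cls (toFibre x c))
      rw [repTensor, tensorOp_tmul_tmul, repLin_apply, repLin_apply, PosFun.gns_cls, hρ, map_mul]
      exact congr_arg (· ⊗ₜ[ℂ] _) (loc_coe x (π a) ξ).symm

/-- A bound for the action of `α` and `α⋆` on `E ⊗_{C(X)} B` bounds `‖α‖_m`. -/
lemma mNorm_le_of_intRep (hπ : IsFieldOfFaithfulReps π) {α : A ⊗[ℂ] B} {C : ℝ} (hC : 0 < C)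
    (h : ∀ s : E ⊗[ℂ] B, intNorm X (intRep π α s) ≤ C * intNorm X s)
    (h' : ∀ s : E ⊗[ℂ] B, intNorm X (intRep π (star α) s) ≤ C * intNorm X s) :
    mNorm X α ≤ C := by
  refine Real.iSup_le (fun x => spatialNorm_le_of_leftBdd hC fun s t z => ?_) hC.le
  obtain ⟨ρ, hρ, hinj⟩ := hπ.faithful x
  obtain ⟨z, rfl⟩ : ∃ z₀ : A ⊗[ℂ] B, tensorFibre X x z₀ = z :=
    TensorProduct.map_surjective (toFibreₗ_surjective x) (toFibreₗ_surjective x) z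
  -- The hypotheses give only `‖locMap t (α v)‖ ≤ √‖t‖ C ‖v‖`, with the module norm of `v` on the
  -- right. Iterating `α⋆ α` gives growth rate `C²` with a constant depending on `v`, and the orbit
  -- argument replaces that norm by `‖locMap t v‖`.
  have hbound : ∀ v : E ⊗[ℂ] B, ‖locMap t (intRep π α v)‖ ≤ C * ‖locMap t v‖ := fun v => by
    have horb : ∀ n : ℕ, ∃ v', (fun w => repTensor ρ t.gns.π (tensorFibre X x (star α))
        (repTensor ρ t.gns.π (tensorFibre X x α) w))^[n] (locMap t v) = locMap t v' ∧
        intNorm X v' ≤ intNorm X v * (C ^ 2) ^ n := fun n => by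
      induction n with
      | zero => exact ⟨v, rfl, by simp⟩
      | succ n ih =>
        obtain ⟨v', hv', hn⟩ := ih
        refine ⟨intRep π (star α) (intRep π α v'), ?_, ?_⟩
        · rw [Function.iterate_succ_apply', hv', locMap_intRep hρ, locMap_intRep hρ]
        · calc _ ≤ C * (C * intNorm X v') := (h' _).trans (by gcongr; exact h v')
            _ ≤ C * (C * (intNorm X v * (C ^ 2) ^ n)) := by gcongr
            _ = _ := by ring
    rw [locMap_intRep hρ]
    refine norm_apply_le_of_orbit (S := repTensor ρ t.gns.π (tensorFibre X x (star α)))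
      (K := √‖t.toCLM‖ * intNorm X v) (fun v w => ?_) hC.le fun n => ?_
    · rw [(isStarRep_repTensor ρ t.gns.π).adj, tensorFibre_star]
    · obtain ⟨v', hv', hn⟩ := horb n
      rw [hv', mul_assoc]
      exact (norm_locMap_le t v').trans (by gcongr)
  -- For a vector functional coming from `ξ ∈ E`, the product functional is computed on the
  -- localisations of the vectors `w · ξ`, where `(a ⊗ b) · ξ = π(a) ξ ⊗ b`. There `hbound` is
  -- available.
  have hvec : ∀ (ξ : E) (w w' : A ⊗[ℂ] B), (PosFun.ofVec ρ (locVec x ξ)).prod t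
      (star (tensorFibre X x w) * tensorFibre X x w') =
      inner ℂ (locMap t (TensorProduct.map ((adjLin π).flip ξ) LinearMap.id w))
        (locMap t (TensorProduct.map ((adjLin π).flip ξ) LinearMap.id w')) := fun ξ w w' => by
    induction w with
    | zero => simp
    | add w₁ w₂ h₁ h₂ => simp only [map_add, star_add, add_mul, inner_add_left, h₁, h₂]
    | tmul a b =>
      induction w' with
      | zero => simp
      | add w₁ w₂ h₁ h₂ => simp only [map_add, mul_add, inner_add_right, h₁, h₂]
      | tmul a' b' =>
        rw [show tensorFibre X x (a ⊗ₜ[ℂ] b) = toFibre x a ⊗ₜ toFibre x b from rfl,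
          show tensorFibre X x (a' ⊗ₜ[ℂ] b') = toFibre x a' ⊗ₜ toFibre x b' from rfl,
          TensorProduct.star_tmul, Algebra.TensorProduct.tmul_mul_tmul]
        change (PosFun.ofVec ρ (locVec x ξ)).toCLM (star (toFibre x a) * toFibre x a') *
          t.toCLM (star (toFibre x b) * toFibre x b') =
          inner ℂ (locVec x ((π a).1 ξ) ⊗ₜ[ℂ] t.cls (toFibre x b))
            (locVec x ((π a').1 ξ) ⊗ₜ[ℂ] t.cls (toFibre x b'))
        have e : ∀ a, locVec x ((π a).1 ξ) = ρ (toFibre x a) (locVec x ξ) := fun a => by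
          rw [hρ]; exact (loc_coe x (π a) ξ).symm
        rw [TensorProduct.inner_tmul, PosFun.inner_cls, e, e, PosFun.ofVec_apply, map_mul,
          StarHomClass.map_star, mul_apply_eq_comp, ContinuousLinearMap.star_eq_adjoint,
          ContinuousLinearMap.adjoint_inner_right]
  have hmul : ∀ (ξ : E) (w : A ⊗[ℂ] B),
      TensorProduct.map ((adjLin π).flip ξ) LinearMap.id (α * w) =
        intRep π α (TensorProduct.map ((adjLin π).flip ξ) LinearMap.id w) := fun ξ w => by
    generalize α = α
    induction α with
    | zero => simp
    | add α₁ α₂ h₁ h₂ => simp only [add_mul, map_add, LinearMap.add_apply, h₁, h₂]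
    | tmul a b =>
      induction w with
      | zero => simp
      | add w₁ w₂ h₁ h₂ => simp only [mul_add, map_add, h₁, h₂]
      | tmul a' b' =>
        rw [Algebra.TensorProduct.tmul_mul_tmul]
        change (π (a * a')).1 ξ ⊗ₜ[ℂ] (b * b') = (π a).1 ((π a').1 ξ) ⊗ₜ[ℂ] (b * b')
        rw [map_mul]
        rfl
  -- The required inequality says that `s ⊗ t` has nonnegative real part at `γ`, for an arbitrary
  -- functional `s` on `A_x`.
  set γ := (C : ℂ) ^ 2 • (star (tensorFibre X x z) * tensorFibre X x z) -
    star (tensorFibre X x α * tensorFibre X x z) * (tensorFibre X x α * tensorFibre X x z) with hγ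
  have hre : ∀ u : Fibre A x ⊗[ℂ] Fibre B x →ₗ[ℂ] ℂ, (u γ).re =
      C ^ 2 * (u (star (tensorFibre X x z) * tensorFibre X x z)).re -
        (u (star (tensorFibre X x α * tensorFibre X x z) *
          (tensorFibre X x α * tensorFibre X x z))).re := fun u => by
    rw [hγ, map_sub, map_smul, smul_eq_mul, ← Complex.ofReal_pow, Complex.sub_re,
      Complex.re_ofReal_mul]
  -- So far only vectors `ξ ∈ E` are covered; their images are dense in `E_x` and the condition is
  -- closed.
  have hpos : ∀ e : Loc E x, 0 ≤ (inner ℂ e (ρ (t.slice γ) e) : ℂ).re := fun e => by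
    refine (denseRange_locVec x).induction_on
      (p := fun e => 0 ≤ (inner ℂ e (ρ (t.slice γ) e) : ℂ).re) e
      (isClosed_le continuous_const (by fun_prop)) fun ξ => ?_
    rw [← PosFun.ofVec_apply, ← PosFun.prod_eq_slice, hre, ← tensorFibre_mul, hvec, hvec, hmul]
    have e : ∀ v : Loc E x ⊗[ℂ] t.gns.H, (inner ℂ v v : ℂ).re = ‖v‖ ^ 2 :=
      fun v => inner_self_eq_norm_sq (𝕜 := ℂ) v
    rw [e, e, ← mul_pow, sub_nonneg]
    gcongr
    exact hbound _
  -- Faithfulness of `ρ` enters here: vanishing of the negative part in `E_x` means vanishing in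
  -- `A_x`, so every `s` is covered, not only the vector functionals of `ρ`.
  have hneg : negRe (t.slice γ) = 0 := by
    refine hinj ?_
    rw [map_zero, ← norm_le_zero_iff]
    exact norm_map_negRe_le ρ _ le_rfl fun e => by simpa using hpos e
  have hfin := s.neg_re_negRe_le (t.slice γ)
  rw [hneg, map_zero, Complex.zero_re, neg_zero, ← PosFun.prod_eq_slice, hre] at hfin
  linarith

/-! ### Boundedness of the action by `‖·‖_m` -/

section Bounded

variable [T2Space X] [PartialOrder B] [StarOrderedRing B]

/-- The norm of `⟨α s, α s⟩ ∈ B` is tested in each fibre, where a positive functional `t` attains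
it. In `E_x ⊗ H_t` the element acts through a tensor product of representations of `A_x` and `B_x`,
hence with norm at most `‖α‖_m`. -/
lemma intNorm_intRep_le (hπ : IsFieldOfFaithfulReps π) (α : A ⊗[ℂ] B) (s : E ⊗[ℂ] B) :
    intNorm X (intRep π α s) ≤ mNorm X α * intNorm X s := by
  have h0 : 0 ≤ mNorm X α := (isCStarSeminorm_mNorm X).nonneg α
  refine le_of_sq_le_sq ?_ (mul_nonneg h0 (intNorm_nonneg _))
  rw [intNorm_sq]
  refine norm_le_of_norm_toFibre_le (X := X) (fun x => ?_) (by positivity)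
  obtain ⟨a, ha⟩ := CStarAlgebra.nonneg_iff_eq_star_mul_self.1
    (intInner_self_nonneg (X := X) (intRep π α s))
  -- Writing the inner product as `a⋆ a` lets `t` attain its norm in the fibre at `x`; `ht` keeps
  -- `‖locMap t s‖` below the norm of `s`.
  obtain ⟨t, ht, hta⟩ := exists_posFun_eq_norm (toFibre x a)
  obtain ⟨ρ, hρ, -⟩ := hπ.faithful x
  have h1 := norm_locMap_sq t (intRep π α s)
  rw [ha, map_mul, StarHomClass.map_star, hta, Complex.ofReal_re, locMap_intRep hρ] at h1
  rw [ha, map_mul, StarHomClass.map_star, CStarRing.norm_star_mul_self, ← sq, ← h1, mul_pow]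
  have h2 : ‖repTensor ρ t.gns.π (tensorFibre X x α)‖ ≤ mNorm X α :=
    (norm_repTensor_le_spatialNorm _ _ _).trans
      (le_ciSup (bddAbove_spatialNorm_tensorFibre X α) x)
  have h3 : ‖locMap t s‖ ^ 2 ≤ intNorm X s ^ 2 := by
    rw [norm_locMap_sq, intNorm_sq]
    exact (Complex.re_le_norm _).trans ((ht _).trans (norm_toFibre_le _ _))
  calc _ ≤ (mNorm X α * ‖locMap t s‖) ^ 2 := by
        gcongr
        exact ContinuousLinearMap.le_of_opNorm_le _ h2 _
    _ ≤ _ := by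
        rw [mul_pow]
        gcongr

end Bounded

end InteriorRep

/-! ### The representation on `E ⊗_{C(X)} B` -/

section InteriorOperators

variable {X : Type*} [TopologicalSpace X] [CompactSpace X]
variable {E : Type*} [NormedAddCommGroup E] [NormedSpace ℂ E] [SMul C(X, ℂ) E]
  [CStarModule C(X, ℂ) E]
variable {A : Type*} [NonUnitalCStarAlgebra A] [CXAlgebra X A]
variable {B : Type*} [NonUnitalCStarAlgebra B] [CXAlgebra X B]
variable [PartialOrder B] [StarOrderedRing B]

/-- The canonical map from the algebraic tensor product to `E ⊗_{C(X)} B`. -/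
def IntTensor.ofAlg : E ⊗[ℂ] B →ₗ[ℂ] IntTensor X E B where
  toFun s := ((toPreInt X s : PreIntTensor X E B) : IntTensor X E B)
  map_add' s t := Completion.coe_add (toPreInt X s) (toPreInt X t)
  map_smul' z s := Completion.coe_smul z (toPreInt X s)

lemma IntTensor.norm_ofAlg (s : E ⊗[ℂ] B) : ‖IntTensor.ofAlg (X := X) s‖ = intNorm X s :=
  Completion.norm_coe (toPreInt X s)

lemma IntTensor.denseRange_ofAlg : DenseRange (IntTensor.ofAlg (X := X) (E := E) (B := B)) :=
  Completion.denseRange_coe (α := PreIntTensor X E B)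

lemma IntTensor.innerB_ofAlg (s t : E ⊗[ℂ] B) :
    IntTensor.innerB (IntTensor.ofAlg (X := X) s) (IntTensor.ofAlg (X := X) t) = intInner X s t :=
  IntTensor.innerB_coe _ _

/-- The two actions of `C(X)` on `E ⊗_{C(X)} B` agree. -/
lemma IntTensor.smul_tmul (f : C(X, ℂ)) (ξ : E) (b : B) :
    IntTensor.tmul X (f • ξ) b = IntTensor.tmul X ξ (act f b) := by
  have h : ∀ v : E ⊗[ℂ] B, intInner X v ((f • ξ) ⊗ₜ[ℂ] b - ξ ⊗ₜ[ℂ] act f b) = 0 := fun v => by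
    induction v with
    | zero => simp
    | add v w hv hw => rw [map_add, LinearMap.add_apply, hv, hw, add_zero]
    | tmul η c =>
      rw [map_sub, intInner_tmul, intInner_tmul, CStarModule.inner_op_smul_right, act_act,
        mul_comm f, sub_self]
  rw [← sub_eq_zero, ← norm_eq_zero]
  have e : IntTensor.tmul X (f • ξ) b - IntTensor.tmul X ξ (act f b) =
      IntTensor.ofAlg (X := X) ((f • ξ) ⊗ₜ[ℂ] b - ξ ⊗ₜ[ℂ] act f b) :=
    (map_sub IntTensor.ofAlg ((f • ξ) ⊗ₜ[ℂ] b) (ξ ⊗ₜ[ℂ] act f b)).symm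
  rw [e, IntTensor.norm_ofAlg, intNorm, h, norm_zero, Real.sqrt_zero]

variable [T2Space X] {π : A →⋆ₙₐ[ℂ] Adj C(X, ℂ) E}

lemma norm_ofAlg_intRep_le (hπ : IsFieldOfFaithfulReps π) (α : A ⊗[ℂ] B) (s : E ⊗[ℂ] B) :
    ‖IntTensor.ofAlg (X := X) (intRep π α s)‖ ≤ mNorm X α * ‖IntTensor.ofAlg (X := X) s‖ := by
  rw [IntTensor.norm_ofAlg, IntTensor.norm_ofAlg]
  exact intNorm_intRep_le hπ α s

/-- The operator on `E ⊗_{C(X)} B` given by an element of the algebraic tensor product. -/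
def intOp (hπ : IsFieldOfFaithfulReps π) :
    A ⊗[ℂ] B →ₗ[ℂ] (IntTensor X E B →L[ℂ] IntTensor X E B) where
  toFun α := (IntTensor.ofAlg ∘ₗ intRep π α).extendOfNorm IntTensor.ofAlg
  map_add' α β := by
    refine LinearMap.extendOfNorm_unique IntTensor.denseRange_ofAlg (mNorm X (α + β))
      (norm_ofAlg_intRep_le hπ (α + β)) _ (LinearMap.ext fun s => ?_)
    change LinearMap.extendOfNorm _ _ (IntTensor.ofAlg s) +
      LinearMap.extendOfNorm _ _ (IntTensor.ofAlg s) = IntTensor.ofAlg (intRep π (α + β) s)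
    rw [LinearMap.extendOfNorm_eq IntTensor.denseRange_ofAlg
      ⟨_, norm_ofAlg_intRep_le hπ α⟩, LinearMap.extendOfNorm_eq IntTensor.denseRange_ofAlg
      ⟨_, norm_ofAlg_intRep_le hπ β⟩, map_add, LinearMap.add_apply, map_add]
    rfl
  map_smul' z α := by
    refine LinearMap.extendOfNorm_unique IntTensor.denseRange_ofAlg (mNorm X (z • α))
      (norm_ofAlg_intRep_le hπ (z • α)) _ (LinearMap.ext fun s => ?_)
    change z • LinearMap.extendOfNorm _ _ (IntTensor.ofAlg s) =
      IntTensor.ofAlg (intRep π (z • α) s)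
    rw [LinearMap.extendOfNorm_eq IntTensor.denseRange_ofAlg
      ⟨_, norm_ofAlg_intRep_le hπ α⟩, map_smul, LinearMap.smul_apply, map_smul]
    rfl

variable (hπ : IsFieldOfFaithfulReps π)

lemma intOp_ofAlg (α : A ⊗[ℂ] B) (s : E ⊗[ℂ] B) :
    intOp hπ α (IntTensor.ofAlg s) = IntTensor.ofAlg (intRep π α s) :=
  LinearMap.extendOfNorm_eq IntTensor.denseRange_ofAlg ⟨_, norm_ofAlg_intRep_le hπ α⟩ s

lemma norm_intOp_le (α : A ⊗[ℂ] B) : ‖intOp hπ α‖ ≤ mNorm X α :=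
  LinearMap.opNorm_extendOfNorm_le IntTensor.denseRange_ofAlg
    ((isCStarSeminorm_mNorm X).nonneg α) (norm_ofAlg_intRep_le hπ α)

lemma intOp_mul (α β : A ⊗[ℂ] B) : intOp hπ (α * β) = intOp hπ α * intOp hπ β := by
  ext s
  refine IntTensor.denseRange_ofAlg.induction_on
    (p := fun s => intOp hπ (α * β) s = (intOp hπ α * intOp hπ β) s) s
    (isClosed_eq (by fun_prop) (by fun_prop)) fun s => ?_
  rw [mul_apply_eq_comp, intOp_ofAlg, intOp_ofAlg, intOp_ofAlg, intRep_mul]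

lemma innerB_intOp (α : A ⊗[ℂ] B) (s t : IntTensor X E B) :
    IntTensor.innerB (intOp hπ α s) t = IntTensor.innerB s (intOp hπ (star α) t) := by
  have hc := IntTensor.continuous_innerB (X := X) (E := E) (B := B)
  refine IntTensor.innerB_induction (P := fun s t =>
    IntTensor.innerB (intOp hπ α s) t = IntTensor.innerB s (intOp hπ (star α) t))
    (isClosed_eq (hc.comp (f := fun p : IntTensor X E B × IntTensor X E B =>
      (intOp hπ α p.1, p.2)) (by fun_prop)) (hc.comp
      (f := fun p : IntTensor X E B × IntTensor X E B => (p.1, intOp hπ (star α) p.2))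
      (by fun_prop))) (fun s t => ?_) s t
  change IntTensor.innerB (intOp hπ α (IntTensor.ofAlg s)) (IntTensor.ofAlg t) =
    IntTensor.innerB (IntTensor.ofAlg s) (intOp hπ (star α) (IntTensor.ofAlg t))
  rw [intOp_ofAlg, intOp_ofAlg, IntTensor.innerB_ofAlg, IntTensor.innerB_ofAlg, intInner_intRep]

/-- `mNorm_le_of_intRep` asks for a bound on both `α` and `α⋆`, whence the maximum; the added `ε`
makes the constant positive. -/
lemma mNorm_le_norm_intOp (α : A ⊗[ℂ] B) :
    mNorm X α ≤ max ‖intOp hπ α‖ ‖intOp hπ (star α)‖ := by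
  refine le_of_forall_pos_le_add fun ε hε => ?_
  have h0 : 0 ≤ max ‖intOp hπ α‖ ‖intOp hπ (star α)‖ := le_max_of_le_left (norm_nonneg _)
  refine mNorm_le_of_intRep (hπ := hπ) (by linarith) (fun s => ?_) fun s => ?_
  · rw [← IntTensor.norm_ofAlg, ← IntTensor.norm_ofAlg, ← intOp_ofAlg hπ]
    exact ContinuousLinearMap.le_of_opNorm_le _ (le_add_of_le_of_nonneg (le_max_left _ _) hε.le) _
  · rw [← IntTensor.norm_ofAlg, ← IntTensor.norm_ofAlg, ← intOp_ofAlg hπ]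
    exact ContinuousLinearMap.le_of_opNorm_le _ (le_add_of_le_of_nonneg (le_max_right _ _) hε.le) _

/-- The operator on `E ⊗_{C(X)} B` given by an element of `A ⊗^m_{C(X)} B`. -/
def minIntOp : MinTensor X A B →L[ℂ] (IntTensor X E B →L[ℂ] IntTensor X E B) :=
  MinTensor.lift (intOp hπ)

lemma minIntOp_ofAlg (α : A ⊗[ℂ] B) : minIntOp hπ (MinTensor.ofAlg X α) = intOp hπ α :=
  MinTensor.lift_ofAlg (norm_intOp_le hπ) α

lemma minIntOp_tmul_tmul (a : A) (b c : B) (ξ : E) :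
    minIntOp hπ (MinTensor.tmul X a b) (IntTensor.tmul X ξ c) =
      IntTensor.tmul X ((π a).1 ξ) (b * c) := by
  rw [← MinTensor.ofAlg_tmul, minIntOp_ofAlg]
  exact intOp_ofAlg hπ (a ⊗ₜ b) (ξ ⊗ₜ c)

lemma minIntOp_mul (d e : MinTensor X A B) :
    minIntOp hπ (d * e) = minIntOp hπ d * minIntOp hπ e := by
  refine MinTensor.denseRange_ofAlg.induction_on₂
    (p := fun d e => minIntOp hπ (d * e) = minIntOp hπ d * minIntOp hπ e)
    (isClosed_eq (by fun_prop) (by fun_prop)) (fun α β => ?_) d e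
  rw [← MinTensor.ofAlg_mul, minIntOp_ofAlg, minIntOp_ofAlg, minIntOp_ofAlg, intOp_mul]

lemma innerB_minIntOp (d : MinTensor X A B) (s t : IntTensor X E B) :
    IntTensor.innerB (minIntOp hπ d s) t = IntTensor.innerB s (minIntOp hπ (star d) t) := by
  have hc := IntTensor.continuous_innerB (X := X) (E := E) (B := B)
  refine MinTensor.denseRange_ofAlg.induction_on (p := fun d =>
    IntTensor.innerB (minIntOp hπ d s) t = IntTensor.innerB s (minIntOp hπ (star d) t)) d
    (isClosed_eq (hc.comp (f := fun d : MinTensor X A B => (minIntOp hπ d s, t)) (by fun_prop))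
      (hc.comp (f := fun d : MinTensor X A B => (s, minIntOp hπ (star d) t)) (by fun_prop)))
    fun α => ?_
  rw [← MinTensor.ofAlg_star, minIntOp_ofAlg, minIntOp_ofAlg, innerB_intOp]

lemma norm_le_norm_minIntOp (d : MinTensor X A B) :
    ‖d‖ ≤ max ‖minIntOp hπ d‖ ‖minIntOp hπ (star d)‖ := by
  refine MinTensor.denseRange_ofAlg.induction_on (p := fun d =>
    ‖d‖ ≤ max ‖minIntOp hπ d‖ ‖minIntOp hπ (star d)‖) d
    (isClosed_le (by fun_prop) (by fun_prop)) fun α => ?_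
  rw [← MinTensor.ofAlg_star, minIntOp_ofAlg, minIntOp_ofAlg, MinTensor.norm_ofAlg]
  exact mNorm_le_norm_intOp hπ α

/-- On elementary tensors, `π(f a) ξ ⊗ b c = f π(a) ξ ⊗ b c`, and `f` crosses the balanced tensor
product to the factor in `B`. -/
lemma minIntOp_act (f : C(X, ℂ)) (d : MinTensor X A B) (z : IntTensor X E B) :
    minIntOp hπ (act f d) z = IntTensor.actL f (minIntOp hπ d z) := by
  refine MinTensor.ext_of_tmul (P := fun d => minIntOp hπ (act f d) z)
    (Q := fun d => IntTensor.actL f (minIntOp hπ d z)) (by fun_prop) (by fun_prop)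
    (fun s t => by rw [map_add, map_add, add_apply])
    (fun s t => by rw [map_add, add_apply, map_add]) (fun a b => ?_) d
  refine IntTensor.denseRange_ofAlg.induction_on (p := fun z =>
    minIntOp hπ (act f (MinTensor.tmul X a b)) z =
      IntTensor.actL f (minIntOp hπ (MinTensor.tmul X a b) z)) z
    (isClosed_eq (by fun_prop) (by fun_prop)) fun s => ?_
  induction s with
  | zero => simp
  | add s t hs ht => simp only [map_add, hs, ht]
  | tmul ξ c =>
    change minIntOp hπ (act f (MinTensor.tmul X a b)) (IntTensor.tmul X ξ c) =
      IntTensor.actL f (minIntOp hπ (MinTensor.tmul X a b) (IntTensor.tmul X ξ c))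
    rw [MinTensor.act_tmul, minIntOp_tmul_tmul, minIntOp_tmul_tmul, hπ.map_act,
      IntTensor.smul_tmul, IntTensor.actL_tmul]

/-- The operator given by an element of `A ⊗^m_{C(X)} B`, as an adjointable operator. -/
def minIntAdj (d : MinTensor X A B) : Adj Bᵐᵒᵖ (IntTensor X E B) :=
  ⟨minIntOp hπ d, minIntOp hπ (star d), fun s t =>
    congr_arg MulOpposite.op (innerB_minIntOp hπ d s t)⟩

lemma star_minIntAdj (d : MinTensor X A B) :
    star (minIntAdj hπ d) = minIntAdj hπ (star d) :=
  Adj.eq_star fun s t => congr_arg MulOpposite.op (innerB_minIntOp hπ d s t)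

/-- The representation of `A ⊗^m_{C(X)} B` in the Hilbert `B`-module `E ⊗_{C(X)} B`. -/
def minIntRep : MinTensor X A B →⋆ₙₐ[ℂ] Adj Bᵐᵒᵖ (IntTensor X E B) where
  toFun := minIntAdj hπ
  map_smul' z d := Subtype.ext ((minIntOp hπ).map_smul z d)
  map_zero' := Subtype.ext (map_zero (minIntOp hπ))
  map_add' d e := Subtype.ext (map_add (minIntOp hπ) d e)
  map_mul' d e := Subtype.ext (minIntOp_mul hπ d e)
  map_star' d := (star_minIntAdj hπ d).symm

/-- The estimate below involves `d` and `d⋆`; if the first acts as zero, so does the second, because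
the representation preserves adjoints. -/
lemma minIntRep_injective : Function.Injective (minIntRep (B := B) hπ) := by
  rw [injective_iff_map_eq_zero]
  intro d hd
  have h1 : minIntOp hπ d = 0 := congr_arg Subtype.val hd
  have h2 : minIntOp hπ (star d) = 0 := by
    have h3 := congr_arg Subtype.val (StarHomClass.map_star (minIntRep (B := B) hπ) d)
    rw [hd, star_zero] at h3
    exact h3
  have h4 := norm_le_norm_minIntOp hπ d
  rwa [h1, h2, norm_zero, max_self, norm_le_zero_iff] at h4

end InteriorOperators

/-! ### Functionals concentrated on a positive part -/

section PosPart

variable {A : Type*} [NonUnitalCStarAlgebra A]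

/-- The decomposition of a self-adjoint element into its positive and negative parts. -/
lemma exists_eq_sub_of_isSelfAdjoint {h : A} (hh : IsSelfAdjoint h) :
    ∃ r c : A, IsSelfAdjoint r ∧ h = r * r - star c * c ∧ star c * c * r = 0 := by
  let _ := CStarAlgebra.spectralOrder A
  have := CStarAlgebra.spectralOrderedRing A
  obtain ⟨c, hc⟩ := CStarAlgebra.nonneg_iff_eq_star_mul_self.1 (CFC.negPart_nonneg h)
  have hr : CFC.sqrt h⁺ * CFC.sqrt h⁺ = h⁺ := CFC.sqrt_mul_sqrt_self _ (CFC.posPart_nonneg h)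
  have hrsa : IsSelfAdjoint (CFC.sqrt h⁺) := (CFC.sqrt_nonneg h⁺).isSelfAdjoint
  refine ⟨CFC.sqrt h⁺, c, hrsa, ?_, ?_⟩
  · rw [hr, ← hc, CFC.posPart_sub_negPart h hh]
  -- With `r = √h⁺` and `n = h⁻`, one has `(n r)(n r)⋆ = h⁻ h⁺ h⁻ = 0`.
  · rw [← hc, ← CStarRing.mul_star_self_eq_zero_iff, star_mul, hrsa.star_eq,
      (CFC.negPart_nonneg h).isSelfAdjoint.star_eq, mul_assoc, ← mul_assoc (CFC.sqrt h⁺), hr,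
      ← mul_assoc, CFC.negPart_mul_posPart, zero_mul]

lemma map_realPart {F : Type*} [NonUnitalCStarAlgebra F] (ρ : A →⋆ₙₐ[ℂ] F) (a : A) :
    ρ (realPart a : A) = (realPart (ρ a) : F) := by
  rw [realPart_apply_coe, realPart_apply_coe, ← Complex.coe_smul, map_smul, map_add,
    StarHomClass.map_star, Complex.coe_smul]

/-- The pullback of a positive functional along a ⋆-homomorphism. -/
def PosFun.comap {F : Type*} [NonUnitalCStarAlgebra F] (s : PosFun F) (ρ : A →⋆ₙₐ[ℂ] F) :
    PosFun A where
  toCLM := LinearMap.mkContinuous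
    { toFun := fun a => s.toCLM (ρ a)
      map_add' := fun a b => by rw [map_add, map_add]
      map_smul' := fun z a => by rw [map_smul, map_smul]; rfl } ‖s.toCLM‖ fun a =>
    (s.toCLM.le_opNorm _).trans (by gcongr; exact NonUnitalStarAlgHom.norm_apply_le ρ a)
  nonneg a := by
    change 0 ≤ s.toCLM (ρ (star a * a))
    rw [map_mul, StarHomClass.map_star]
    exact s.nonneg _

lemma PosFun.comap_apply {F : Type*} [NonUnitalCStarAlgebra F] (s : PosFun F) (ρ : A →⋆ₙₐ[ℂ] F)
    (a : A) : (s.comap ρ).toCLM a = s.toCLM (ρ a) := rfl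

/-- A positive functional of norm at most `R` which attains `R ‖h⁺‖` at `h = h⁺ - h⁻`. -/
lemma exists_posFun_of_posPart {r n : A} (hr : IsSelfAdjoint r) (hn : n * r = 0) {R : ℝ}
    (hR : 0 ≤ R) : ∃ t : PosFun A, ‖t.toCLM‖ ≤ R ∧
      t.toCLM (r * r - n) = ((R * ‖r * r‖ : ℝ) : ℂ) := by
  obtain ⟨t, ht, htp⟩ := exists_posFun_eq_norm (r * r)
  have hrr : ‖r * r‖ = ‖r‖ ^ 2 := by
    have := CStarRing.norm_star_mul_self (x := r)
    rwa [hr.star_eq, ← sq] at this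
  have hk : √(R / ‖r * r‖) * √(R / ‖r * r‖) = R / ‖r * r‖ := Real.mul_self_sqrt (by positivity)
  have happ : ∀ a, (t.conj ((√(R / ‖r * r‖) : ℂ) • r)).toCLM a =
      ((R / ‖r * r‖ : ℝ) : ℂ) * t.toCLM (r * (a * r)) := fun a => by
    rw [PosFun.conj_apply, star_smul, hr.star_eq, mul_smul_comm, mul_smul_comm, smul_mul_assoc,
      map_smul, map_smul, RCLike.star_def, Complex.conj_ofReal, smul_eq_mul, smul_eq_mul,
      ← mul_assoc, ← Complex.ofReal_mul, hk]
  have hdiv : R / ‖r * r‖ * ‖r * r‖ ^ 2 = R * ‖r * r‖ := by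
    -- If `r² = 0`, division by zero makes the scaling factor `0`, and the zero functional satisfies
    -- both claims.
    rcases eq_or_ne ‖r * r‖ 0 with h0 | h0
    · rw [h0]; simp
    · field_simp
  have hdiv' : R / ‖r * r‖ * ‖r * r‖ ≤ R := by
    rcases eq_or_ne ‖r * r‖ 0 with h0 | h0
    · rw [h0]; simpa using hR
    · rw [div_mul_cancel₀ _ h0]
  -- The functional is `a ↦ (R / ‖r²‖) t(r a r)`, with `t` attaining `‖r²‖²` at `r⁴`. Compression by
  -- `r` kills `n`, as `n r = 0`; the scaling makes the norm at most `R` and the value at `r²` equal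
  -- to `R ‖r²‖`.
  refine ⟨t.conj ((√(R / ‖r * r‖) : ℂ) • r), ?_, ?_⟩
  · refine ContinuousLinearMap.opNorm_le_bound _ hR fun a => ?_
    rw [happ, norm_mul, Complex.norm_real, Real.norm_eq_abs, abs_of_nonneg (by positivity)]
    calc R / ‖r * r‖ * ‖t.toCLM (r * (a * r))‖ ≤ R / ‖r * r‖ * (‖r‖ * (‖a‖ * ‖r‖)) := by
          gcongr
          exact (ht _).trans ((norm_mul_le _ _).trans (by gcongr; exact norm_mul_le _ _))
      _ = R / ‖r * r‖ * ‖r * r‖ * ‖a‖ := by rw [hrr]; ring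
      _ ≤ R * ‖a‖ := by gcongr
  · rw [star_mul, hr.star_eq] at htp
    rw [happ, sub_mul, hn, sub_zero, mul_assoc, ← mul_assoc r r, htp, ← Complex.ofReal_mul, hdiv]

end PosPart

/-! ### Approximating functionals on neighbouring fibres -/

section Semicontinuity

open Filter Topology

variable {X : Type*} [TopologicalSpace X] [CompactSpace X]
variable {A : Type*} [NonUnitalCStarAlgebra A] [CXAlgebra X A]

/-- In a continuous field, a positive functional on a fibre can be approximated, on finitely many
sections, by positive functionals on the neighbouring fibres. -/
lemma IsContinuousField.eventually_exists_posFun (hA : IsContinuousField X A) {x : X}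
    (s : PosFun (Fibre A x)) {ι : Type*} [Fintype ι] (b : ι → A) {ε : ℝ} (hε : 0 < ε) :
    ∀ᶠ y in 𝓝 x, ∃ t : PosFun (Fibre A y),
      ∀ i, ‖t.toCLM (toFibre y (b i)) - s.toCLM (toFibre x (b i))‖ < ε := by
  classical
  -- Along an ultrafilter converging to `x`, bounded families of values have limits, so no subnets
  -- are needed.
  refine Filter.mem_iff_ultrafilter.2 fun F hF => ?_
  set R := ‖s.toCLM‖ with hR
  let q₀ : ι → ℂ := fun i => s.toCLM (toFibre x (b i))
  -- The value vectors at `x` obtainable as limits of functionals of norm at most `R = ‖s‖` on the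
  -- fibres. The claim reduces to showing that the values of `s` lie in the closure of this convex
  -- set.
  let Q : Set (ι → ℂ) := {q | ∃ τ : ∀ y, PosFun (Fibre A y), (∀ y, ‖(τ y).toCLM‖ ≤ R) ∧
    Tendsto (fun y i => (τ y).toCLM (toFibre y (b i))) (F : Filter X) (𝓝 q)}
  have hQ : Convex ℝ Q := by
    rintro q ⟨τ, hτ, hq⟩ q' ⟨τ', hτ', hq'⟩ k k' hk hk' hkk
    refine ⟨fun y => (τ y).comb (τ' y) hk hk', fun y => ?_, ?_⟩
    · refine (norm_add_le _ _).trans ?_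
      rw [norm_smul, norm_smul, Complex.norm_real, Complex.norm_real, Real.norm_eq_abs,
        Real.norm_eq_abs, abs_of_nonneg hk, abs_of_nonneg hk']
      calc _ ≤ k * R + k' * R := by gcongr; exacts [hτ y, hτ' y]
        _ = R := by rw [← add_mul, hkk, one_mul]
    · exact (hq.const_smul k).add (hq'.const_smul k')
  have hmem : q₀ ∈ closure Q := by
    by_contra hnot
    -- A separating functional on `ι → ℂ` is a linear combination of coordinates, hence evaluation
    -- at the single section `d = ∑ f(eᵢ) bᵢ`.
    obtain ⟨f, u, hfQ, hfq⟩ := RCLike.geometric_hahn_banach_closed_point (𝕜 := ℂ) hQ.closure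
      isClosed_closure hnot
    let d : A := ∑ i, f (Pi.single i 1) • b i
    have hf₀ : ∀ v : ι → ℂ, f v = ∑ i, f (Pi.single i 1) * v i := fun v => by
      conv_lhs => rw [← Finset.univ_sum_single v, map_sum]
      refine Finset.sum_congr rfl fun i _ => ?_
      rw [← mul_one (v i), ← smul_eq_mul, Pi.single_smul, map_smul, smul_eq_mul, smul_eq_mul,
        mul_one, mul_comm]
    have hf : ∀ (y : X) (t : PosFun (Fibre A y)),
        f (fun i => t.toCLM (toFibre y (b i))) = t.toCLM (toFibre y d) := fun y t => by
      rw [hf₀, map_sum, map_sum]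
      refine Finset.sum_congr rfl fun i _ => ?_
      rw [map_smul, map_smul, smul_eq_mul]
    obtain ⟨r, c, hr, hd, hcr⟩ := exists_eq_sub_of_isSelfAdjoint (realPart d).2
    have hre : ∀ (y : X) (t : PosFun (Fibre A y)), (t.toCLM (toFibre y d)).re =
        (t.toCLM (toFibre y r * toFibre y r - toFibre y (star c * c))).re := fun y t => by
      rw [← map_mul, ← map_sub, ← hd, map_realPart, PosFun.re_realPart, Complex.ofReal_re]
    -- In every fibre a functional is chosen with real part at `d` equal to `R ‖(Re d)⁺‖`; here `r²`
    -- is the positive part of `Re d`.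
    have hτ : ∀ y : X, ∃ t : PosFun (Fibre A y), ‖t.toCLM‖ ≤ R ∧
        (t.toCLM (toFibre y d)).re = R * ‖toFibre y (r * r)‖ := fun y => by
      obtain ⟨t, ht, ht'⟩ := exists_posFun_of_posPart (r := toFibre y r)
        (n := toFibre y (star c * c)) (hr.map _) (by rw [← map_mul, hcr, map_zero])
        (norm_nonneg s.toCLM)
      exact ⟨t, ht, by rw [hre, ht', Complex.ofReal_re, map_mul (toFibre y) r r]⟩
    choose τ hτR hτd using hτ
    obtain ⟨q, -, hq⟩ := (isCompact_univ_pi fun i =>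
      isCompact_closedBall (0 : ℂ) (R * ‖b i‖)).ultrafilter_le_nhds'
      (F.map fun y i => (τ y).toCLM (toFibre y (b i))) (Ultrafilter.mem_map.2 (Filter.univ_mem' fun y => by
        refine Set.mem_univ_pi.2 fun i => mem_closedBall_zero_iff.2 ?_
        refine ((τ y).toCLM.le_opNorm _).trans ?_
        gcongr
        exacts [hτR y, norm_toFibre_le _ _]))
    have hqQ : q ∈ Q := ⟨τ, hτR, hq⟩
    have h1 : Tendsto (fun y => (f fun i => (τ y).toCLM (toFibre y (b i))).re) (F : Filter X) (𝓝 (f q).re) :=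
      (Complex.continuous_re.comp f.continuous).continuousAt.tendsto.comp hq
    -- The continuous field hypothesis: the chosen values `R ‖(r²)_y‖` converge to `R ‖(r²)_x‖`. So
    -- the limit point `q` does at least as well on `d` as `s`, which contradicts the separation.
    have h2 : Tendsto (fun y => R * ‖toFibre y (r * r)‖) (F : Filter X) (𝓝 (R * ‖toFibre x (r * r)‖)) :=
      (((hA (r * r)).tendsto x).const_mul R).mono_left hF
    simp only [hf, hτd] at h1
    have h3 := tendsto_nhds_unique h1 h2
    have h4 := hfQ q (subset_closure hqQ)
    -- Dropping the negative part `c⋆ c` can only increase the value, and `‖s‖ = R`.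
    have h5 : (s.toCLM (toFibre x d)).re ≤ R * ‖toFibre x (r * r)‖ := by
      rw [hre, map_sub, Complex.sub_re, ← map_mul]
      have h6 := (Complex.nonneg_iff.1 (s.nonneg (toFibre x c))).1
      rw [← StarHomClass.map_star, ← map_mul] at h6
      have h7 := (Complex.re_le_norm _).trans (s.toCLM.le_opNorm (toFibre x (r * r)))
      linarith
    have h8 : (f q₀).re = (s.toCLM (toFibre x d)).re := by rw [hf x s]
    simp only [RCLike.re_eq_complex_re] at h4 hfq
    linarith
  obtain ⟨q, ⟨τ, -, hq⟩, hqd⟩ := Metric.mem_closure_iff.1 hmem (ε / 2) (half_pos hε)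
  have h1 := Metric.tendsto_nhds.1 hq (ε / 2) (half_pos hε)
  refine h1.mono fun y hy => ⟨τ y, fun i => ?_⟩
  have h2 := (dist_le_pi_dist (fun i => (τ y).toCLM (toFibre y (b i))) q₀ i).trans_lt
    ((dist_triangle _ q _).trans_lt (add_lt_add hy (by rwa [dist_comm])))
  rw [add_halves] at h2
  rwa [← dist_eq_norm]

end Semicontinuity

/-! ### Controlling `‖·‖_m` on `D ⊗ A` by representations of `D` over nearby points -/

section LocalCriterion

variable {X : Type*} [TopologicalSpace X] [CompactSpace X]
variable {A : Type*} [NonUnitalCStarAlgebra A]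
variable {D : Type*} [NonUnitalCStarAlgebra D]

lemma PosFun.prod_sum {ι : Type*} [Fintype ι] (s : PosFun D) (t : PosFun A) (d : ι → D)
    (b : ι → A) : s.prod t (∑ m, d m ⊗ₜ b m) = s.toCLM (∑ m, t.toCLM (b m) • d m) := by
  rw [map_sum, map_sum]
  refine Finset.sum_congr rfl fun m _ => ?_
  rw [PosFun.prod_tmul, map_smul, smul_eq_mul, mul_comm]

variable [CXAlgebra X A] [CXAlgebra X D] [T2Space X]

/-- If `A` is a continuous field, then `‖α‖_m` for `α ∈ D ⊗ A` is controlled by any jointly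
isometric family of representations of `D` over points of `X`. -/
lemma IsContinuousField.mNorm_le_of_reps (hA : IsContinuousField X A) {ι : Type*} (y : ι → X)
    {K : ι → Type*} [∀ i, NormedAddCommGroup (K i)] [∀ i, InnerProductSpace ℂ (K i)]
    [∀ i, CompleteSpace (K i)] (ρ : ∀ i, D →⋆ₙₐ[ℂ] (K i →L[ℂ] K i))
    (hact : ∀ i (f : C(X, ℂ)) d, ρ i (act f d) = f (y i) • ρ i d)
    (hiso : ∀ (d : D) (c : ℝ), 0 ≤ c → (∀ i, ‖ρ i d‖ ≤ c) → ‖d‖ ≤ c) {α : D ⊗[ℂ] A} {C : ℝ}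
    (hC : 0 < C) (hα : ∀ i (t : PosFun (Fibre A (y i))),
      ‖repTensor (ρ i) (t.gns.π.comp (toFibre (y i))) α‖ ≤ C) : mNorm X α ≤ C := by
  refine Real.iSup_le (fun x => spatialNorm_le_of_leftBdd hC fun s t z => ?_) hC.le
  obtain ⟨z, rfl⟩ : ∃ z₀ : D ⊗[ℂ] A, tensorFibre X x z₀ = z :=
    TensorProduct.map_surjective (toFibreₗ_surjective x) (toFibreₗ_surjective x) z
  -- In contrast to the fibrewise argument, `γ` is kept in `D ⊗ A`, so that it can be evaluated over
  -- every point near `x`.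
  set γ := (C : ℂ) ^ 2 • (star z * z) - star (α * z) * (α * z) with hγ
  have hre : ∀ u : D ⊗[ℂ] A →ₗ[ℂ] ℂ, (u γ).re =
      C ^ 2 * (u (star z * z)).re - (u (star (α * z) * (α * z))).re := fun u => by
    rw [hγ, map_sub, map_smul, smul_eq_mul, ← Complex.ofReal_pow, Complex.sub_re,
      Complex.re_ofReal_mul]
  have hpull : ∀ w : D ⊗[ℂ] A, s.prod t (tensorFibre X x w) =
      (s.comap (toFibre x)).prod (t.comap (toFibre x)) w := fun w => by
    induction w with
    | zero => simp
    | add w w' h h' => simp only [map_add, h, h']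
    | tmul d a => rfl
  rw [← tensorFibre_mul, ← tensorFibre_star, ← tensorFibre_star, ← tensorFibre_mul,
    ← tensorFibre_mul, hpull, hpull]
  suffices 0 ≤ ((s.comap (toFibre x)).prod (t.comap (toFibre x)) γ).re by
    rw [hre] at this; linarith
  -- As `γ` is a finite sum, its slice `δ` depends only on the values of `t` at the finitely many
  -- sections `b m`; approximating these to within `ε` changes the slice by at most `ε M`.
  obtain ⟨n, d, b, hdb⟩ := exists_eq_sum_tmul γ
  rw [hdb, PosFun.prod_sum]
  set δ := ∑ m, (t.comap (toFibre x)).toCLM (b m) • d m with hδ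
  set M := ∑ m, ‖d m‖ with hM
  have hM0 : 0 ≤ M := Finset.sum_nonneg fun m _ => norm_nonneg _
  have key : ∀ ε : ℝ, 0 < ε → -(‖s.toCLM‖ * (ε * M)) ≤ ((s.comap (toFibre x)).toCLM δ).re := by
    intro ε hε
    obtain ⟨U, hU, hUo, hxU⟩ := eventually_nhds_iff.1 (hA.eventually_exists_posFun t b hε)
    -- Over `y i` near `x`, the slice `δ'` by the approximating functional `t'` has nonnegative real
    -- part in the representation `ρ i`, by the assumed bound. Hence `δ` is positive there up to `ε
    -- M`.
    have hneg : ∀ i, y i ∈ U → ‖ρ i (negRe δ)‖ ≤ ε * M := fun i hi => by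
      obtain ⟨t', ht'⟩ := hU _ hi
      refine norm_map_negRe_le (ρ i) δ (by positivity) fun e => ?_
      set δ' := ∑ m, (t'.comap (toFibre (y i))).toCLM (b m) • d m with hδ'
      have h1 : 0 ≤ (inner ℂ e (ρ i δ' e) : ℂ).re := by
        have h2 := leftBdd_of_norm_repTensor_le (ρ := ρ i)
          (σ := t'.gns.π.comp (toFibre (y i))) (κ := (ContinuousLinearMap.apply ℂ (K i) e).toLinearMap ∘ₗ repLin (ρ i))
          (μ := t'.cls ∘ₗ toFibreₗ (y i)) (s := PosFun.ofVec (ρ i) e)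
          (t := t'.comap (toFibre (y i)))
          (fun a b => by
            change ρ i a (ρ i b e) = ρ i (a * b) e
            rw [map_mul]; rfl)
          (fun a b => t'.gns_cls _ _)
          (fun a b => by
            change inner ℂ (ρ i a e) (ρ i b e) = inner ℂ e (ρ i (star a * b) e)
            rw [map_mul, StarHomClass.map_star, mul_apply_eq_comp,
              ContinuousLinearMap.star_eq_adjoint, ContinuousLinearMap.adjoint_inner_right])
          (fun a b => t'.inner_cls _ _) (hα i t') z
        have h3 := hre ((PosFun.ofVec (ρ i) e).prod (t'.comap (toFibre (y i))))
        rw [hdb, PosFun.prod_sum, PosFun.ofVec_apply] at h3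
        linarith
      have h4 : ‖δ - δ'‖ ≤ ε * M := by
        rw [hδ, hδ', ← Finset.sum_sub_distrib, hM, Finset.mul_sum]
        refine norm_sum_le_of_le _ fun m _ => ?_
        rw [← sub_smul, norm_smul]
        gcongr
        rw [norm_sub_rev]
        exact (ht' m).le
      have h5 : ‖(inner ℂ e (ρ i (δ - δ') e) : ℂ)‖ ≤ ε * M * ‖e‖ ^ 2 := by
        calc _ ≤ ‖e‖ * (‖ρ i (δ - δ')‖ * ‖e‖) :=
              (norm_inner_le_norm _ _).trans (by gcongr; exact ContinuousLinearMap.le_opNorm _ _)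
          _ ≤ ‖e‖ * (ε * M * ‖e‖) := by
              gcongr
              exact (NonUnitalStarAlgHom.norm_apply_le _ _).trans h4
          _ = _ := by ring
      have h6 := (abs_le.1 ((Complex.abs_re_le_norm _).trans h5)).1
      rw [map_sub, sub_apply, inner_sub_right, Complex.sub_re] at h6
      linarith
    -- A Urysohn function removes the points outside `U`, where nothing is known, without changing
    -- the value in the fibre at `x`.
    obtain ⟨h, h0, h1, h01⟩ := exists_continuous_zero_one_of_isClosed
      hUo.isClosed_compl (isClosed_singleton (x := x)) (Set.disjoint_singleton_right.2
        fun hx => hx hxU)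
    let k : C(X, ℂ) := ⟨fun y => ((h y : ℝ) : ℂ), by fun_prop⟩
    -- Joint isometry of the family turns the estimates at the `y i` into a norm estimate in `D`
    -- itself. It then descends to the fibre of `D` at `x`, although no representation over `x` is
    -- assumed to be present.
    have hk : ‖act k (negRe δ)‖ ≤ ε * M := by
      refine hiso _ _ (by positivity) fun i => ?_
      rw [hact, norm_smul]
      change ‖((h (y i) : ℝ) : ℂ)‖ * _ ≤ _
      by_cases hi : y i ∈ U
      · rw [Complex.norm_real, Real.norm_eq_abs, abs_of_nonneg (h01 _).1]
        calc _ ≤ 1 * (ε * M) := by gcongr; exacts [(h01 _).2, hneg i hi]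
          _ = _ := one_mul _
      · rw [h0 hi]
        simp only [Pi.zero_apply, Complex.ofReal_zero, norm_zero, zero_mul]
        positivity
    have hkx : ‖toFibre x (negRe δ)‖ ≤ ε * M := by
      have h2 := toFibre_act x k (negRe δ)
      have h3 : k x = 1 := by
        change ((h x : ℝ) : ℂ) = 1
        rw [h1 rfl]
        simp
      rw [h3, one_smul] at h2
      rw [← h2]
      exact (norm_toFibre_le _ _).trans hk
    refine le_trans ?_ ((s.comap (toFibre x)).neg_re_negRe_le δ)
    rw [neg_le_neg_iff, PosFun.comap_apply]
    exact (Complex.re_le_norm _).trans ((s.toCLM.le_opNorm _).trans (by gcongr))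
  have hlim : Filter.Tendsto (fun ε : ℝ => -(‖s.toCLM‖ * (ε * M)))
      (nhdsWithin 0 (Set.Ioi 0)) (nhds (-(‖s.toCLM‖ * (0 * M)))) :=
    (Continuous.tendsto (by fun_prop) _).mono_left nhdsWithin_le_nhds
  rw [zero_mul, mul_zero, neg_zero] at hlim
  exact le_of_tendsto hlim (Filter.eventually_of_mem self_mem_nhdsWithin fun ε hε => key ε hε)

end LocalCriterion

/-! ### Passing from pre-Hilbert spaces to their completions -/

section CompletionRep

variable {V W : Type*} [NormedAddCommGroup V] [InnerProductSpace ℂ V]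
  [NormedAddCommGroup W] [InnerProductSpace ℂ W]

lemma norm_le_of_intertwine {V W : Type*} [SeminormedAddCommGroup V] [NormedSpace ℂ V]
    [SeminormedAddCommGroup W] [NormedSpace ℂ W] {U : V →ₗᵢ[ℂ] W} {T : V →L[ℂ] V} {S : W →L[ℂ] W}
    (h : ∀ v, S (U v) = U (T v)) : ‖T‖ ≤ ‖S‖ := by
  refine T.opNorm_le_bound (norm_nonneg _) fun v => ?_
  rw [← U.norm_map (T v), ← h, ← U.norm_map v]
  exact S.le_opNorm _

/-- An isometry with dense range which intertwines two operators preserves the norm. -/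
lemma norm_eq_of_intertwine {V W : Type*} [SeminormedAddCommGroup V] [NormedSpace ℂ V]
    [SeminormedAddCommGroup W] [NormedSpace ℂ W] {U : V →ₗᵢ[ℂ] W} (hU : DenseRange U)
    {T : V →L[ℂ] V} {S : W →L[ℂ] W} (h : ∀ v, S (U v) = U (T v)) : ‖S‖ = ‖T‖ := by
  refine le_antisymm (S.opNorm_le_bound (norm_nonneg _) fun w => ?_) (norm_le_of_intertwine h)
  refine hU.induction_on (p := fun w => ‖S w‖ ≤ ‖T‖ * ‖w‖) w
    (isClosed_le (by fun_prop) (by fun_prop)) fun v => ?_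
  rw [h, U.norm_map, U.norm_map]
  exact T.le_opNorm _

/-- The Hilbert space completion of a pre-Hilbert space. -/
def HilbertCompletion (V : Type*) [NormedAddCommGroup V] [InnerProductSpace ℂ V] : Type _ :=
  Completion V

instance : NormedAddCommGroup (HilbertCompletion V) :=
  inferInstanceAs (NormedAddCommGroup (Completion V))
instance : InnerProductSpace ℂ (HilbertCompletion V) :=
  inferInstanceAs (InnerProductSpace ℂ (Completion V))
instance : CompleteSpace (HilbertCompletion V) :=
  inferInstanceAs (CompleteSpace (Completion V))

variable (V) in
/-- The canonical isometry from a pre-Hilbert space to its completion. -/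
def toHilbertCompletion : V →ₗᵢ[ℂ] HilbertCompletion V := Completion.toComplₗᵢ (𝕜 := ℂ) (E := V)

lemma denseRange_toHilbertCompletion : DenseRange (toHilbertCompletion V) :=
  Completion.denseRange_coe (α := V)

lemma clm_ext_completion {F : Type*} [NormedAddCommGroup F] [NormedSpace ℂ F]
    {S T : HilbertCompletion V →L[ℂ] F}
    (h : ∀ v : V, S (toHilbertCompletion V v) = T (toHilbertCompletion V v)) : S = T :=
  ContinuousLinearMap.ext fun v => denseRange_toHilbertCompletion.induction_on
    (p := fun v => S v = T v) v (isClosed_eq S.continuous T.continuous) h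

/-- The extension of an operator to the completion. -/
def completionMap (T : V →L[ℂ] V) : HilbertCompletion V →L[ℂ] HilbertCompletion V :=
  ((toHilbertCompletion V).toLinearMap ∘ₗ T.toLinearMap).extendOfNorm
    (toHilbertCompletion V).toLinearMap

lemma completionMap_apply (T : V →L[ℂ] V) (v : V) :
    completionMap T (toHilbertCompletion V v) = toHilbertCompletion V (T v) :=
  LinearMap.extendOfNorm_eq (e := (toHilbertCompletion V).toLinearMap)
    denseRange_toHilbertCompletion ⟨‖T‖, fun v => by
    simpa using T.le_opNorm v⟩ v

/-- The extension of a linear family of operators to the completion. -/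
def completionLin {R : Type*} [AddCommGroup R] [Module ℂ R] (T : R →ₗ[ℂ] (V →L[ℂ] V)) :
    R →ₗ[ℂ] (HilbertCompletion V →L[ℂ] HilbertCompletion V) where
  toFun a := completionMap (T a)
  map_add' a b := clm_ext_completion fun v => by
    rw [map_add, add_apply, completionMap_apply, completionMap_apply, completionMap_apply,
      add_apply, map_add]
  map_smul' z a := clm_ext_completion fun v => by
    rw [map_smul, smul_apply, completionMap_apply, completionMap_apply, smul_apply, map_smul,
      RingHom.id_apply]

lemma completionLin_apply {R : Type*} [AddCommGroup R] [Module ℂ R] (T : R →ₗ[ℂ] (V →L[ℂ] V))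
    (a : R) (v : V) :
    completionLin T a (toHilbertCompletion V v) = toHilbertCompletion V (T a v) :=
  completionMap_apply (T a) v

lemma norm_completionLin {R : Type*} [AddCommGroup R] [Module ℂ R] (T : R →ₗ[ℂ] (V →L[ℂ] V))
    (a : R) : ‖completionLin T a‖ = ‖T a‖ :=
  norm_eq_of_intertwine denseRange_toHilbertCompletion (completionLin_apply T a)

lemma IsStarRep.completionLin {R : Type*} [NonUnitalRing R] [Module ℂ R] [Star R]
    {T : R →ₗ[ℂ] (V →L[ℂ] V)} (hT : IsStarRep T) : IsStarRep (completionLin T) where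
  map_mul a b := clm_ext_completion fun v => by
    rw [mul_apply_eq_comp, completionLin_apply, completionLin_apply, completionLin_apply,
      hT.map_mul, mul_apply_eq_comp]
  adj a v w := by
    refine denseRange_toHilbertCompletion.induction_on₂ (p := fun v w =>
      inner ℂ (CX.completionLin T a v) w = inner ℂ v (CX.completionLin T (star a) w))
      (isClosed_eq (by fun_prop) (by fun_prop)) (fun v w => ?_) v w
    rw [completionLin_apply, completionLin_apply, LinearIsometry.inner_map_map,
      LinearIsometry.inner_map_map, hT.adj]

end CompletionRep

/-! ### Product representations of `A ⊗^m_{C(X)} B` over a point -/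

section ProdRep

variable {X : Type w} [TopologicalSpace X] [CompactSpace X]
variable {A : Type u} [NonUnitalCStarAlgebra A] [CXAlgebra X A]
variable {B : Type v} [NonUnitalCStarAlgebra B] [CXAlgebra X B]

/-- The extension of a bounded representation of the algebraic tensor product. -/
def MinTensor.liftRep {K : Type*} [NormedAddCommGroup K] [InnerProductSpace ℂ K] [CompleteSpace K]
    (φ : A ⊗[ℂ] B →ₗ[ℂ] (K →L[ℂ] K)) (hφ : IsStarRep φ) (h : ∀ α, ‖φ α‖ ≤ mNorm X α) :
    MinTensor X A B →⋆ₙₐ[ℂ] (K →L[ℂ] K) where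
  toFun := MinTensor.lift φ
  map_smul' := map_smul (MinTensor.lift φ)
  map_zero' := map_zero (MinTensor.lift φ)
  map_add' := map_add (MinTensor.lift φ)
  map_mul' d e := by
    refine MinTensor.denseRange_ofAlg.induction_on₂ (p := fun d e =>
      MinTensor.lift (X := X) φ (d * e) = MinTensor.lift φ d * MinTensor.lift φ e)
      (isClosed_eq (by fun_prop) (by fun_prop)) (fun α β => ?_) d e
    rw [← MinTensor.ofAlg_mul, MinTensor.lift_ofAlg h, MinTensor.lift_ofAlg h,
      MinTensor.lift_ofAlg h, hφ.map_mul]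
  map_star' d := by
    refine MinTensor.denseRange_ofAlg.induction_on
      (p := fun d => MinTensor.lift (X := X) φ (star d) = star (MinTensor.lift φ d)) d
      (isClosed_eq (by fun_prop) (by fun_prop)) fun α => ?_
    rw [← MinTensor.ofAlg_star, MinTensor.lift_ofAlg h, MinTensor.lift_ofAlg h,
      ContinuousLinearMap.star_eq_adjoint, ContinuousLinearMap.eq_adjoint_iff]
    intro v w
    rw [hφ.adj, star_star]

lemma MinTensor.liftRep_ofAlg {K : Type*} [NormedAddCommGroup K] [InnerProductSpace ℂ K]
    [CompleteSpace K] (φ : A ⊗[ℂ] B →ₗ[ℂ] (K →L[ℂ] K)) (hφ : IsStarRep φ)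
    (h : ∀ α, ‖φ α‖ ≤ mNorm X α) (α : A ⊗[ℂ] B) :
    MinTensor.liftRep φ hφ h (MinTensor.ofAlg X α) = φ α :=
  MinTensor.lift_ofAlg h α

lemma MinTensor.liftRep_act {K : Type*} [NormedAddCommGroup K] [InnerProductSpace ℂ K]
    [CompleteSpace K] {φ : A ⊗[ℂ] B →ₗ[ℂ] (K →L[ℂ] K)} (hφ : IsStarRep φ)
    (h : ∀ α, ‖φ α‖ ≤ mNorm X α) {y : X}
    (hact : ∀ (f : C(X, ℂ)) α, φ (algAct f α) = f y • φ α) (f : C(X, ℂ)) (d : MinTensor X A B) :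
    MinTensor.liftRep φ hφ h (act f d) = f y • MinTensor.liftRep φ hφ h d := by
  refine MinTensor.ext_of_tmul (P := fun d => MinTensor.lift φ (act f d))
    (Q := fun d => f y • MinTensor.lift φ d) (by fun_prop) (by fun_prop)
    (fun s t => by rw [map_add, map_add]) (fun s t => by rw [map_add, smul_add])
    (fun a b => ?_) d
  rw [MinTensor.act_tmul, ← MinTensor.ofAlg_tmul, ← MinTensor.ofAlg_tmul, MinTensor.lift_ofAlg h,
    MinTensor.lift_ofAlg h, ← hact]
  rfl

/-- The representation of the algebraic tensor product given by representations of two fibres over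
the same point. -/
def fibreTensorRep {y : X} (ρ : HilbertRep (Fibre A y)) (σ : HilbertRep (Fibre B y)) :
    A ⊗[ℂ] B →ₗ[ℂ] (ρ.H ⊗[ℂ] σ.H →L[ℂ] ρ.H ⊗[ℂ] σ.H) :=
  repTensor ρ.π σ.π ∘ₗ tensorFibre X y

lemma fibreTensorRep_apply {y : X} (ρ : HilbertRep (Fibre A y)) (σ : HilbertRep (Fibre B y))
    (α : A ⊗[ℂ] B) : fibreTensorRep ρ σ α = repTensor ρ.π σ.π (tensorFibre X y α) := rfl

lemma norm_fibreTensorRep_le {y : X} (ρ : HilbertRep (Fibre A y))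
    (σ : HilbertRep (Fibre B y)) (α : A ⊗[ℂ] B) : ‖fibreTensorRep ρ σ α‖ ≤ mNorm X α :=
  (norm_tensorRep_le_spatialNorm ρ σ _).trans
    (le_ciSup (bddAbove_spatialNorm_tensorFibre X α) y)

lemma isStarRep_fibreTensorRep {y : X} (ρ : HilbertRep (Fibre A y))
    (σ : HilbertRep (Fibre B y)) : IsStarRep (fibreTensorRep ρ σ) where
  map_mul a b := by
    rw [fibreTensorRep_apply, tensorFibre_mul, (isStarRep_repTensor _ _).map_mul]; rfl
  adj a v w := by
    rw [fibreTensorRep_apply, (isStarRep_repTensor _ _).adj, ← tensorFibre_star]; rfl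

/-- The representation of `A ⊗^m_{C(X)} B` given by representations of two fibres over the same
point. -/
def prodRep {y : X} (ρ : HilbertRep (Fibre A y)) (σ : HilbertRep (Fibre B y)) :
    MinTensor X A B →⋆ₙₐ[ℂ] (HilbertCompletion (ρ.H ⊗[ℂ] σ.H) →L[ℂ] HilbertCompletion (ρ.H ⊗[ℂ] σ.H)) :=
  MinTensor.liftRep (completionLin (fibreTensorRep ρ σ))
    (isStarRep_fibreTensorRep ρ σ).completionLin fun α =>
      (norm_completionLin _ α).trans_le (norm_fibreTensorRep_le ρ σ α)

lemma prodRep_ofAlg {y : X} (ρ : HilbertRep (Fibre A y)) (σ : HilbertRep (Fibre B y))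
    (α : A ⊗[ℂ] B) :
    prodRep ρ σ (MinTensor.ofAlg X α) = completionLin (fibreTensorRep ρ σ) α :=
  MinTensor.liftRep_ofAlg _ _ _ _

lemma prodRep_act {y : X} (ρ : HilbertRep (Fibre A y)) (σ : HilbertRep (Fibre B y)) (f : C(X, ℂ))
    (d : MinTensor X A B) : prodRep ρ σ (act f d) = f y • prodRep ρ σ d := by
  refine MinTensor.liftRep_act _ _ (fun f α => ?_) f d
  rw [← map_smul]
  refine clm_ext_completion fun v => ?_
  rw [completionLin_apply, completionLin_apply, fibreTensorRep_apply, fibreTensorRep_apply, map_smul,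
    tensorFibre_algAct]

/-- The representations of `A ⊗^m_{C(X)} B` given by representations of the fibres are jointly
isometric. -/
lemma norm_le_of_prodRep {d : MinTensor X A B} {c : ℝ} (hc : 0 ≤ c)
    (h : ∀ (y : X) (ρ : HilbertRep (Fibre A y)) (σ : HilbertRep (Fibre B y)),
      ‖prodRep ρ σ d‖ ≤ c) : ‖d‖ ≤ c := by
  refine le_of_forall_pos_le_add fun ε hε => ?_
  -- For algebraic tensors `‖·‖_m` is by definition the supremum of these norms; a general element
  -- is reached by approximation, all representations being contractive.
  obtain ⟨α, hα⟩ := MinTensor.denseRange_ofAlg.exists_dist_lt d (half_pos hε)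
  rw [dist_eq_norm] at hα
  have h1 : ‖MinTensor.ofAlg X α‖ ≤ c + ε / 2 := by
    rw [MinTensor.norm_ofAlg]
    refine Real.iSup_le (fun y => Real.iSup_le (fun p => ?_) (by positivity)) (by positivity)
    have e := norm_completionLin (fibreTensorRep p.1 p.2) α
    rw [← prodRep_ofAlg] at e
    refine e.symm.trans_le ?_
    have h2 : ‖prodRep p.1 p.2 (d - MinTensor.ofAlg X α)‖ ≤ ε / 2 :=
      (NonUnitalStarAlgHom.norm_apply_le _ _).trans hα.le
    rw [map_sub] at h2
    have h3 := h y p.1 p.2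
    have h4 := norm_sub_norm_le (prodRep p.1 p.2 (MinTensor.ofAlg X α)) (prodRep p.1 p.2 d)
    rw [norm_sub_rev] at h4
    linarith
  have h5 := norm_sub_norm_le d (MinTensor.ofAlg X α)
  linarith

end ProdRep

/-! ### Representations over a point factor through the fibre -/

section FibreRep

variable {X : Type*} [TopologicalSpace X] [CompactSpace X]
variable {D : Type*} [NonUnitalCStarAlgebra D] [CXAlgebra X D]
variable {A : Type*} [NonUnitalCStarAlgebra A] [CXAlgebra X A]
variable {K : Type*} [NormedAddCommGroup K] [InnerProductSpace ℂ K] [CompleteSpace K]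

/-- A representation over a point factors through the fibre. -/
lemma exists_fibre_rep {y : X} (ρ : D →⋆ₙₐ[ℂ] (K →L[ℂ] K))
    (hact : ∀ (f : C(X, ℂ)) d, ρ (act f d) = f y • ρ d) :
    ∃ ρ' : Fibre D y →⋆ₙₐ[ℂ] (K →L[ℂ] K), ∀ d, ρ' (toFibre y d) = ρ d := by
  have hcont : Continuous ρ := AddMonoidHomClass.continuous_of_bound ρ 1 fun a => by
    rw [one_mul]; exact NonUnitalStarAlgHom.norm_apply_le ρ a
  have hker : fibreIdeal D y ≤ LinearMap.ker (repLin ρ) := by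
    refine Submodule.topologicalClosure_minimal _ ?_ ?_
    · rw [Submodule.span_le]
      rintro _ ⟨f, a, hf, rfl⟩
      change ρ (act f a) = 0
      rw [hact, hf, zero_smul]
    · exact isClosed_singleton.preimage hcont
  let φ : Fibre D y →ₗ[ℂ] (K →L[ℂ] K) := (fibreIdeal D y).liftQ (repLin ρ) hker
  have hφ : ∀ d, φ (toFibre y d) = ρ d := fun d => rfl
  refine ⟨{ toFun := φ, map_smul' := map_smul φ, map_zero' := map_zero φ, map_add' := map_add φ,
            map_mul' := fun d e => ?_, map_star' := fun d => ?_ }, hφ⟩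
  · obtain ⟨d, rfl⟩ := toFibre_surjective y d
    obtain ⟨e, rfl⟩ := toFibre_surjective y e
    rw [← map_mul, hφ, hφ, hφ, map_mul]
  · obtain ⟨d, rfl⟩ := toFibre_surjective y d
    rw [← StarHomClass.map_star, hφ, hφ, StarHomClass.map_star]

/-- Since `ρ` factors through `D_y`, the operator is a tensor product of representations of `D_y`
and `A_y` evaluated at `w_y`, and its norm is at most the spatial norm of `w_y`. -/
lemma norm_repTensor_comp_toFibre_le {H : Type*} [NormedAddCommGroup H] [InnerProductSpace ℂ H]
    [CompleteSpace H] {y : X} (ρ : D →⋆ₙₐ[ℂ] (K →L[ℂ] K))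
    (hact : ∀ (f : C(X, ℂ)) d, ρ (act f d) = f y • ρ d) (σ : Fibre A y →⋆ₙₐ[ℂ] (H →L[ℂ] H))
    (w : D ⊗[ℂ] A) : ‖repTensor ρ (σ.comp (toFibre y)) w‖ ≤ mNorm X w := by
  obtain ⟨ρ', hρ'⟩ := exists_fibre_rep ρ hact
  have e : repTensor ρ (σ.comp (toFibre y)) w = repTensor ρ' σ (tensorFibre X y w) := by
    induction w with
    | zero => simp
    | add w w' h h' => simp only [map_add, h, h']
    | tmul d a =>
      change _ = repTensor ρ' σ (toFibre y d ⊗ₜ toFibre y a)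
      rw [repTensor, repTensor, tensorOp_tmul, tensorOp_tmul]
      simp only [repLin_apply, hρ']
      rfl
  rw [e]
  exact (norm_repTensor_le_spatialNorm _ _ _).trans
    (le_ciSup (bddAbove_spatialNorm_tensorFibre X w) y)

end FibreRep

/-! ### Threefold tensor products of fibre representations -/

section TripleRep

set_option maxSynthPendingDepth 3

variable {X : Type w} [TopologicalSpace X] [CompactSpace X]
variable {A : Type u} [NonUnitalCStarAlgebra A] [CXAlgebra X A]
variable {B : Type v} [NonUnitalCStarAlgebra B] [CXAlgebra X B]
variable {C : Type t} [NonUnitalCStarAlgebra C] [CXAlgebra X C]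

/-- Induction on a threefold tensor product. -/
lemma tensor_induction_three {A B C : Type*} [AddCommMonoid A] [Module ℂ A] [AddCommMonoid B]
    [Module ℂ B] [AddCommMonoid C] [Module ℂ C] {P : (A ⊗[ℂ] B) ⊗[ℂ] C → Prop} (zero : P 0)
    (add : ∀ α β, P α → P β → P (α + β)) (tmul : ∀ a b c, P ((a ⊗ₜ b) ⊗ₜ c))
    (α : (A ⊗[ℂ] B) ⊗[ℂ] C) : P α := by
  induction α with
  | zero => exact zero
  | add α β h h' => exact add _ _ h h'
  | tmul α c =>
    induction α with
    | zero => rwa [TensorProduct.zero_tmul]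
    | add α β h h' => rw [TensorProduct.add_tmul]; exact add _ _ h h'
    | tmul a b => exact tmul a b c

/-- The representation of the algebraic threefold tensor product given by representations of three
fibres over the same point. -/
def tripleRep {y : X} (ρ : HilbertRep (Fibre A y)) (σ : HilbertRep (Fibre B y))
    (τ : HilbertRep (Fibre C y)) : (A ⊗[ℂ] B) ⊗[ℂ] C →ₗ[ℂ]
      ((ρ.H ⊗[ℂ] σ.H) ⊗[ℂ] τ.H →L[ℂ] (ρ.H ⊗[ℂ] σ.H) ⊗[ℂ] τ.H) :=
  tensorOp (fibreTensorRep ρ σ) (repLin (τ.π.comp (toFibre y)))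

lemma tripleRep_tmul {y : X} (ρ : HilbertRep (Fibre A y)) (σ : HilbertRep (Fibre B y))
    (τ : HilbertRep (Fibre C y)) (a : A) (b : B) (c : C) (e : ρ.H) (f : σ.H) (g : τ.H) :
    tripleRep ρ σ τ ((a ⊗ₜ b) ⊗ₜ c) ((e ⊗ₜ f) ⊗ₜ g) =
      (ρ.π (toFibre y a) e ⊗ₜ σ.π (toFibre y b) f) ⊗ₜ τ.π (toFibre y c) g := by
  rw [tripleRep, tensorOp_tmul_tmul, fibreTensorRep_apply]
  refine congr_arg (· ⊗ₜ[ℂ] _) ?_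
  exact tensorOp_tmul_tmul (repLin ρ.π) (repLin σ.π) (toFibre y a) (toFibre y b) e f

/-- The isometry from the algebraic threefold tensor product of Hilbert spaces into the tensor
product with the completed one. -/
def tripleIsometry {y : X} (ρ : HilbertRep (Fibre A y)) (σ : HilbertRep (Fibre B y))
    (τ : HilbertRep (Fibre C y)) :
    (ρ.H ⊗[ℂ] σ.H) ⊗[ℂ] τ.H →ₗᵢ[ℂ] HilbertCompletion (ρ.H ⊗[ℂ] σ.H) ⊗[ℂ] τ.H :=
  TensorProduct.mapIsometry (toHilbertCompletion (ρ.H ⊗[ℂ] σ.H)) LinearIsometry.id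

lemma denseRange_tripleIsometry {y : X} (ρ : HilbertRep (Fibre A y)) (σ : HilbertRep (Fibre B y))
    (τ : HilbertRep (Fibre C y)) : DenseRange (tripleIsometry ρ σ τ) := by
  intro w
  change w ∈ ((LinearMap.range (tripleIsometry ρ σ τ).toLinearMap).topologicalClosure : Set _)
  rw [SetLike.mem_coe]
  induction w with
  | zero => exact zero_mem _
  | add w w' h h' => exact add_mem h h'
  | tmul k g =>
    refine denseRange_toHilbertCompletion.induction_on (p := fun k => k ⊗ₜ[ℂ] g ∈
      (LinearMap.range (tripleIsometry ρ σ τ).toLinearMap).topologicalClosure) k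
      ((Submodule.isClosed_topologicalClosure _).preimage (by fun_prop)) fun u => ?_
    exact Submodule.le_topologicalClosure _ ⟨u ⊗ₜ g, rfl⟩

/-- The map `(A ⊗ B) ⊗ C → (A ⊗^m B) ⊗ C`. -/
def assocLeft (X : Type w) [TopologicalSpace X] [CompactSpace X]
    (A : Type u) [NonUnitalCStarAlgebra A] [CXAlgebra X A]
    (B : Type v) [NonUnitalCStarAlgebra B] [CXAlgebra X B]
    (C : Type t) [NonUnitalCStarAlgebra C] :
    (A ⊗[ℂ] B) ⊗[ℂ] C →ₗ[ℂ] MinTensor X A B ⊗[ℂ] C :=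
  TensorProduct.map (MinTensor.ofAlg X) LinearMap.id

/-- The completion of `ρ.H ⊗ σ.H` used for `prodRep` is invisible to operator norms: the uncompleted
triple tensor product sits in it isometrically and densely, intertwining both actions. -/
lemma norm_repTensor_assocLeft {y : X} (ρ : HilbertRep (Fibre A y)) (σ : HilbertRep (Fibre B y))
    (τ : HilbertRep (Fibre C y)) (α : (A ⊗[ℂ] B) ⊗[ℂ] C) :
    ‖repTensor (prodRep ρ σ) (τ.π.comp (toFibre y)) (assocLeft X A B C α)‖ =
      ‖tripleRep ρ σ τ α‖ := by
  refine norm_eq_of_intertwine (denseRange_tripleIsometry ρ σ τ) fun v => ?_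
  induction α with
  | zero => simp
  | add α β h h' => simp only [map_add, add_apply, h, h']
  | tmul w c =>
    induction v with
    | zero => simp
    | add v v' h h' => simp only [map_add, h, h']
    | tmul e g =>
      change repTensor (prodRep ρ σ) (τ.π.comp (toFibre y)) (MinTensor.ofAlg X w ⊗ₜ c)
        (toHilbertCompletion _ e ⊗ₜ g) = _
      rw [repTensor, tensorOp_tmul_tmul, repLin_apply, prodRep_ofAlg, completionLin_apply,
        tripleRep, tensorOp_tmul_tmul]
      rfl

/-- The cyclic rotation `(e ⊗ f) ⊗ g ↦ (f ⊗ g) ⊗ e` of Hilbert spaces is unitary and intertwines the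
two actions. -/
lemma norm_tripleRep_rotate {y : X} (ρ : HilbertRep (Fibre A y)) (σ : HilbertRep (Fibre B y))
    (τ : HilbertRep (Fibre C y)) (α : (A ⊗[ℂ] B) ⊗[ℂ] C) :
    ‖tripleRep σ τ ρ (TensorProduct.comm ℂ A (B ⊗[ℂ] C) (TensorProduct.assoc ℂ A B C α))‖ =
      ‖tripleRep ρ σ τ α‖ := by
  refine norm_eq_of_intertwine (U := ((TensorProduct.assocIsometry ℂ ρ.H σ.H τ.H).trans
    (TensorProduct.commIsometry ℂ ρ.H (σ.H ⊗[ℂ] τ.H))).toLinearIsometry)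
    (LinearIsometryEquiv.surjective _).denseRange fun v => ?_
  refine tensor_induction_three (P := fun v => tripleRep σ τ ρ (TensorProduct.comm ℂ A (B ⊗[ℂ] C)
    (TensorProduct.assoc ℂ A B C α)) (((TensorProduct.assocIsometry ℂ ρ.H σ.H τ.H).trans
    (TensorProduct.commIsometry ℂ ρ.H (σ.H ⊗[ℂ] τ.H))).toLinearIsometry v) =
    ((TensorProduct.assocIsometry ℂ ρ.H σ.H τ.H).trans
    (TensorProduct.commIsometry ℂ ρ.H (σ.H ⊗[ℂ] τ.H))).toLinearIsometry (tripleRep ρ σ τ α v))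
    (by simp) (fun v v' h h' => by simp only [map_add, h, h']) (fun e f g => ?_) v
  refine tensor_induction_three (P := fun α => tripleRep σ τ ρ (TensorProduct.comm ℂ A (B ⊗[ℂ] C)
    (TensorProduct.assoc ℂ A B C α)) (((TensorProduct.assocIsometry ℂ ρ.H σ.H τ.H).trans
    (TensorProduct.commIsometry ℂ ρ.H (σ.H ⊗[ℂ] τ.H))).toLinearIsometry ((e ⊗ₜ f) ⊗ₜ g)) =
    ((TensorProduct.assocIsometry ℂ ρ.H σ.H τ.H).trans
    (TensorProduct.commIsometry ℂ ρ.H (σ.H ⊗[ℂ] τ.H))).toLinearIsometry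
      (tripleRep ρ σ τ α ((e ⊗ₜ f) ⊗ₜ g)))
    (by simp) (fun v v' h h' => by simp only [map_add, add_apply, h, h']) (fun a b c => ?_) α
  rw [tripleRep_tmul]
  exact tripleRep_tmul σ τ ρ b c a f g e

variable [T2Space X]

/-- The iterated norm is identified with a symmetric supremum over triples of fibre representations.
One inequality is the factorisation through fibres. For the other, the product representations of `A
⊗^m B` form a jointly isometric family to which `IsContinuousField.mNorm_le_of_reps` applies, with
`C` as the continuous factor. -/
lemma IsContinuousField.mNorm_assocLeft_le_iff (hC : IsContinuousField X C)
    (α : (A ⊗[ℂ] B) ⊗[ℂ] C) {c : ℝ} (hc : 0 < c) : mNorm X (assocLeft X A B C α) ≤ c ↔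
      ∀ (y : X) (ρ : HilbertRep (Fibre A y)) (σ : HilbertRep (Fibre B y))
        (τ : HilbertRep (Fibre C y)), ‖tripleRep ρ σ τ α‖ ≤ c := by
  refine ⟨fun h y ρ σ τ => ?_, fun h => ?_⟩
  · rw [← norm_repTensor_assocLeft]
    exact (norm_repTensor_comp_toFibre_le _ (prodRep_act ρ σ) _ _).trans h
  · refine hC.mNorm_le_of_reps
      (ι := Σ y : X, HilbertRep (Fibre A y) × HilbertRep (Fibre B y)) (fun i => i.1)
      (fun i => prodRep i.2.1 i.2.2) (fun i => prodRep_act _ _)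
      (fun d c hc hd => norm_le_of_prodRep hc fun y ρ σ => hd ⟨y, ρ, σ⟩) hc fun i t => ?_
    rw [norm_repTensor_assocLeft]
    exact h _ _ _ _

end TripleRep

/-! ### Invariance of the norms under the flip -/

section Comm

set_option maxSynthPendingDepth 3

variable {X : Type w} [TopologicalSpace X] [CompactSpace X]
variable {A : Type u} [NonUnitalCStarAlgebra A] {B : Type v} [NonUnitalCStarAlgebra B]

/-- The flip of the Hilbert spaces is unitary, and exchanging the two representations reindexes the
supremum. -/
lemma spatialNorm_comm (α : A ⊗[ℂ] B) :
    spatialNorm (TensorProduct.comm ℂ A B α) = spatialNorm α := by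
  refine Equiv.iSup_congr (Equiv.prodComm _ _) fun p => ?_
  refine Eq.symm (norm_eq_of_intertwine
    (U := (TensorProduct.commIsometry ℂ p.2.H p.1.H).toLinearIsometry)
    (LinearIsometryEquiv.surjective _).denseRange fun v => ?_)
  change tensorRep p.1 p.2 (TensorProduct.comm ℂ A B α)
    (TensorProduct.comm ℂ p.2.H p.1.H v) = TensorProduct.comm ℂ p.2.H p.1.H (tensorRep p.2 p.1 α v)
  rw [tensorRep_eq, tensorRep_eq]
  induction α with
  | zero => simp
  | add α β h h' => simp only [map_add, add_apply, h, h']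
  | tmul a b =>
    induction v with
    | zero => simp
    | add v v' h h' => simp only [map_add, h, h']
    | tmul e f =>
      rw [TensorProduct.comm_tmul, TensorProduct.comm_tmul, repTensor, repTensor,
        tensorOp_tmul_tmul, tensorOp_tmul_tmul, TensorProduct.comm_tmul]

lemma mNorm_comm [CXAlgebra X A] [CXAlgebra X B] (α : A ⊗[ℂ] B) :
    mNorm X (TensorProduct.comm ℂ A B α) = mNorm X α := by
  refine iSup_congr fun x => ?_
  rw [← spatialNorm_comm (tensorFibre X x α)]
  congr 1
  exact TensorProduct.map_comm (toFibreₗ x) (toFibreₗ x) α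

end Comm

/-! ### Associativity -/

section Assoc

variable {X : Type w} [TopologicalSpace X] [CompactSpace X]
variable {A : Type u} [NonUnitalCStarAlgebra A] [CXAlgebra X A]
variable {B : Type v} [NonUnitalCStarAlgebra B] [CXAlgebra X B]
variable {C : Type t} [NonUnitalCStarAlgebra C] [CXAlgebra X C]

/-- The map `A ⊗ (B ⊗ C) → A ⊗ (B ⊗^m C)`. -/
def assocRight (X : Type w) [TopologicalSpace X] [CompactSpace X]
    (A : Type u) [NonUnitalCStarAlgebra A]
    (B : Type v) [NonUnitalCStarAlgebra B] [CXAlgebra X B]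
    (C : Type t) [NonUnitalCStarAlgebra C] [CXAlgebra X C] :
    A ⊗[ℂ] (B ⊗[ℂ] C) →ₗ[ℂ] A ⊗[ℂ] MinTensor X B C :=
  TensorProduct.map LinearMap.id (MinTensor.ofAlg X)

/-- Moving `A` to the last place brings the right-bracketed norm into the form covered by
`IsContinuousField.mNorm_assocLeft_le_iff`, with `A` now as the continuous factor. -/
lemma mNorm_assocRight (α : A ⊗[ℂ] (B ⊗[ℂ] C)) :
    mNorm X (assocRight X A B C α) =
      mNorm X (assocLeft X B C A (TensorProduct.comm ℂ A (B ⊗[ℂ] C) α)) := by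
  rw [← mNorm_comm (assocRight X A B C α)]
  congr 1
  exact (TensorProduct.map_comm (MinTensor.ofAlg X) LinearMap.id α).symm

/-- For continuous fields, the two iterated minimal tensor norms agree. -/
lemma mNorm_assoc [T2Space X] (hA : IsContinuousField X A) (hC : IsContinuousField X C)
    (α : (A ⊗[ℂ] B) ⊗[ℂ] C) : mNorm X (assocRight X A B C (TensorProduct.assoc ℂ A B C α)) =
      mNorm X (assocLeft X A B C α) := by
  have key : ∀ c : ℝ, 0 < c →
      (mNorm X (assocRight X A B C (TensorProduct.assoc ℂ A B C α)) ≤ c ↔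
        mNorm X (assocLeft X A B C α) ≤ c) := fun c hc => by
    rw [mNorm_assocRight, hA.mNorm_assocLeft_le_iff _ hc, hC.mNorm_assocLeft_le_iff _ hc]
    -- Both sides are now conditions on triples of representations over the same point, in the
    -- orders `(σ, τ, ρ)` and `(ρ, σ, τ)`.
    refine forall_congr' fun y => ⟨fun h ρ σ τ => ?_, fun h σ τ ρ => ?_⟩
    · rw [← norm_tripleRep_rotate]; exact h σ τ ρ
    · rw [norm_tripleRep_rotate]; exact h ρ σ τ
  refine le_antisymm (le_of_forall_pos_le_add fun ε hε => ?_)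
    (le_of_forall_pos_le_add fun ε hε => ?_)
  · have h0 := (isCStarSeminorm_mNorm X).nonneg (assocLeft X A B C α)
    exact (key _ (by linarith)).2 (by linarith)
  · have h0 := (isCStarSeminorm_mNorm X).nonneg
      (assocRight X A B C (TensorProduct.assoc ℂ A B C α))
    exact (key _ (by linarith)).1 (by linarith)

lemma MinTensor.norm_tmul_le (a : A) (b : B) : ‖MinTensor.tmul X a b‖ ≤ ‖a‖ * ‖b‖ := by
  rw [← MinTensor.ofAlg_tmul, MinTensor.norm_ofAlg]
  refine Real.iSup_le (fun x => (spatialNorm_tmul_le (toFibre x a) (toFibre x b)).trans ?_)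
    (by positivity)
  gcongr <;> exact norm_toFibre_le _ _

variable (X) in
/-- The bilinear map `(a, b) ↦ a ⊗ b`, as a continuous linear map. -/
def MinTensor.mkL : A →L[ℂ] B →L[ℂ] MinTensor X A B :=
  (TensorProduct.mk ℂ A B |>.compr₂ (MinTensor.ofAlg X)).mkContinuous₂ 1 fun a b => by
    rw [one_mul]; exact MinTensor.norm_tmul_le a b

lemma MinTensor.continuous_tmul_left (b : B) : Continuous fun a : A => MinTensor.tmul X a b :=
  (MinTensor.mkL (A := A) (B := B) X).continuous.clm_apply continuous_const

lemma MinTensor.continuous_tmul_right (a : A) : Continuous fun b : B => MinTensor.tmul X a b :=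
  (MinTensor.mkL X a).continuous

/-- By additivity, elementary tensors `d ⊗ c` suffice; there `d` is approximated by algebraic
tensors, `d ↦ d ⊗ c` being continuous. Density on both sides lets the isometry between algebraic
tensors extend to the completions. -/
lemma denseRange_assocLeft :
    DenseRange (MinTensor.ofAlg X ∘ₗ assocLeft X A B C) := by
  have hcl : IsClosed (closure (Set.range (MinTensor.ofAlg X ∘ₗ assocLeft X A B C))) :=
    isClosed_closure
  intro w
  refine MinTensor.denseRange_ofAlg.induction_on (p := fun w =>
    w ∈ closure (Set.range (MinTensor.ofAlg X ∘ₗ assocLeft X A B C))) w hcl fun α => ?_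
  have hadd : ∀ v w, v ∈ closure (Set.range (MinTensor.ofAlg X ∘ₗ assocLeft X A B C)) →
      w ∈ closure (Set.range (MinTensor.ofAlg X ∘ₗ assocLeft X A B C)) →
      v + w ∈ closure (Set.range (MinTensor.ofAlg X ∘ₗ assocLeft X A B C)) := fun v w hv hw =>
    map_mem_closure₂ continuous_add hv hw (by
      rintro _ ⟨α, rfl⟩ _ ⟨β, rfl⟩
      exact ⟨α + β, map_add _ α β⟩)
  induction α with
  | zero => exact subset_closure ⟨0, by simp⟩
  | add α β h h' => rw [map_add]; exact hadd _ _ h h'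
  | tmul d c =>
    rw [MinTensor.ofAlg_tmul]
    refine MinTensor.denseRange_ofAlg.induction_on (p := fun d => MinTensor.tmul X d c ∈
      closure (Set.range (MinTensor.ofAlg X ∘ₗ assocLeft X A B C))) d
      (hcl.preimage (MinTensor.continuous_tmul_left c)) fun β => subset_closure ⟨β ⊗ₜ c, rfl⟩

lemma denseRange_assocRight :
    DenseRange (MinTensor.ofAlg X ∘ₗ assocRight X A B C) := by
  have hcl : IsClosed (closure (Set.range (MinTensor.ofAlg X ∘ₗ assocRight X A B C))) :=
    isClosed_closure
  intro w
  refine MinTensor.denseRange_ofAlg.induction_on (p := fun w =>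
    w ∈ closure (Set.range (MinTensor.ofAlg X ∘ₗ assocRight X A B C))) w hcl fun α => ?_
  have hadd : ∀ v w, v ∈ closure (Set.range (MinTensor.ofAlg X ∘ₗ assocRight X A B C)) →
      w ∈ closure (Set.range (MinTensor.ofAlg X ∘ₗ assocRight X A B C)) →
      v + w ∈ closure (Set.range (MinTensor.ofAlg X ∘ₗ assocRight X A B C)) := fun v w hv hw =>
    map_mem_closure₂ continuous_add hv hw (by
      rintro _ ⟨α, rfl⟩ _ ⟨β, rfl⟩
      exact ⟨α + β, map_add _ α β⟩)
  induction α with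
  | zero => exact subset_closure ⟨0, by simp⟩
  | add α β h h' => rw [map_add]; exact hadd _ _ h h'
  | tmul a d =>
    rw [MinTensor.ofAlg_tmul]
    refine MinTensor.denseRange_ofAlg.induction_on (p := fun d => MinTensor.tmul X a d ∈
      closure (Set.range (MinTensor.ofAlg X ∘ₗ assocRight X A B C))) d
      (hcl.preimage (MinTensor.continuous_tmul_right a)) fun β => subset_closure ⟨a ⊗ₜ β, rfl⟩

/-- Additive continuous maps on a threefold tensor product which agree on elementary tensors are
equal. -/
lemma MinTensor.ext_of_tmul_tmul {F : Type*} [NormedAddCommGroup F]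
    {P Q : MinTensor X (MinTensor X A B) C → F} (hP : Continuous P) (hQ : Continuous Q)
    (hPadd : ∀ s t, P (s + t) = P s + P t) (hQadd : ∀ s t, Q (s + t) = Q s + Q t)
    (h : ∀ a b c, P (MinTensor.tmul X (MinTensor.tmul X a b) c) =
      Q (MinTensor.tmul X (MinTensor.tmul X a b) c)) (d) : P d = Q d := by
  refine MinTensor.ext_of_tmul hP hQ hPadd hQadd (fun e c => ?_) d
  have hc : Continuous fun e : MinTensor X A B => MinTensor.tmul X e c :=
    MinTensor.continuous_tmul_left c
  exact MinTensor.ext_of_tmul (P := fun e => P (MinTensor.tmul X e c))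
    (Q := fun e => Q (MinTensor.tmul X e c)) (hP.comp hc) (hQ.comp hc)
    (fun s t => by rw [MinTensor.tmul_add, hPadd]) (fun s t => by rw [MinTensor.tmul_add, hQadd])
    (fun a b => h a b c) e

/-- The associativity isomorphism as a linear isometry. -/
def assocIsom [T2Space X] (hA : IsContinuousField X A) (hC : IsContinuousField X C) :
    MinTensor X (MinTensor X A B) C ≃ₗᵢ[ℂ] MinTensor X A (MinTensor X B C) :=
  (TensorProduct.assoc ℂ A B C).extendOfIsometry (MinTensor.ofAlg X ∘ₗ assocLeft X A B C)
    (MinTensor.ofAlg X ∘ₗ assocRight X A B C) denseRange_assocLeft denseRange_assocRight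
    fun α => by
      rw [LinearMap.comp_apply, LinearMap.comp_apply, MinTensor.norm_ofAlg, MinTensor.norm_ofAlg]
      exact mNorm_assoc hA hC α

lemma assocIsom_tmul [T2Space X] (hA : IsContinuousField X A) (hC : IsContinuousField X C) (a : A)
    (b : B) (c : C) : assocIsom hA hC (MinTensor.tmul X (MinTensor.tmul X a b) c) =
      MinTensor.tmul X a (MinTensor.tmul X b c) :=
  LinearEquiv.extendOfIsometry_eq (f := TensorProduct.assoc ℂ A B C)
    (e₁ := MinTensor.ofAlg X ∘ₗ assocLeft X A B C) (e₂ := MinTensor.ofAlg X ∘ₗ assocRight X A B C)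
    _ _ _ ((a ⊗ₜ b) ⊗ₜ c)

lemma assocIsom_mul [T2Space X] (hA : IsContinuousField X A) (hC : IsContinuousField X C)
    (d e : MinTensor X (MinTensor X A B) C) :
    assocIsom hA hC (d * e) = assocIsom hA hC d * assocIsom hA hC e := by
  have hc : Continuous (assocIsom (B := B) hA hC) := (assocIsom hA hC).continuous
  refine MinTensor.ext_of_tmul_tmul (P := fun d => assocIsom hA hC (d * e))
    (Q := fun d => assocIsom hA hC d * assocIsom hA hC e) (by fun_prop) (by fun_prop)
    (fun s t => by rw [add_mul, map_add]) (fun s t => by rw [map_add, add_mul])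
    (fun a b c => ?_) d
  refine MinTensor.ext_of_tmul_tmul
    (P := fun e => assocIsom hA hC (MinTensor.tmul X (MinTensor.tmul X a b) c * e))
    (Q := fun e => assocIsom hA hC (MinTensor.tmul X (MinTensor.tmul X a b) c) *
      assocIsom hA hC e) (by fun_prop) (by fun_prop)
    (fun s t => by rw [mul_add, map_add]) (fun s t => by rw [map_add, mul_add])
    (fun a' b' c' => ?_) e
  simp only [MinTensor.tmul_mul_tmul, assocIsom_tmul]

lemma assocIsom_star [T2Space X] (hA : IsContinuousField X A) (hC : IsContinuousField X C)
    (d : MinTensor X (MinTensor X A B) C) :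
    assocIsom hA hC (star d) = star (assocIsom hA hC d) := by
  have hc : Continuous (assocIsom (B := B) hA hC) := (assocIsom hA hC).continuous
  refine MinTensor.ext_of_tmul_tmul (P := fun d => assocIsom hA hC (star d))
    (Q := fun d => star (assocIsom hA hC d)) (by fun_prop) (by fun_prop)
    (fun s t => by rw [star_add, map_add]) (fun s t => by rw [map_add, star_add])
    (fun a b c => ?_) d
  simp only [MinTensor.star_tmul, assocIsom_tmul]

lemma assocIsom_act [T2Space X] (hA : IsContinuousField X A) (hC : IsContinuousField X C)
    (f : C(X, ℂ)) (d : MinTensor X (MinTensor X A B) C) :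
    assocIsom hA hC (act f d) = act f (assocIsom hA hC d) := by
  have hc : Continuous (assocIsom (B := B) hA hC) := (assocIsom hA hC).continuous
  refine MinTensor.ext_of_tmul_tmul (P := fun d => assocIsom hA hC (act f d))
    (Q := fun d => act f (assocIsom hA hC d)) (by fun_prop) (by fun_prop)
    (fun s t => by rw [map_add, map_add]) (fun s t => by rw [map_add, map_add])
    (fun a b c => ?_) d
  simp only [MinTensor.act_tmul, assocIsom_tmul]

/-- The minimal tensor product over `C(X)` is associative for continuous fields. -/
def assocStarAlgEquiv [T2Space X] (hA : IsContinuousField X A) (hC : IsContinuousField X C) :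
    MinTensor X (MinTensor X A B) C ≃⋆ₐ[ℂ] MinTensor X A (MinTensor X B C) where
  toFun := assocIsom hA hC
  invFun := (assocIsom hA hC).symm
  left_inv := (assocIsom hA hC).symm_apply_apply
  right_inv := (assocIsom hA hC).apply_symm_apply
  map_mul' := assocIsom_mul hA hC
  map_add' := map_add (assocIsom hA hC)
  map_star' := assocIsom_star hA hC
  map_smul' := map_smul (assocIsom hA hC)

end Assoc

end CX

end

theorem mainTheorem7 {X : Type*} [TopologicalSpace X] [CompactSpace X] [T2Space X] :
    -- a field of faithful representations of `A` in `E` gives a faithful `C(X)`-linear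
    -- representation of `A ⊗^m_{C(X)} B` in the Hilbert `B`-module `E ⊗_{C(X)} B`
    (∀ (A : Type*) [NonUnitalCStarAlgebra A] [CX.CXAlgebra X A]
      (B : Type*) [NonUnitalCStarAlgebra B] [PartialOrder B] [StarOrderedRing B]
      [CX.CXAlgebra X B]
      (E : Type*) [NormedAddCommGroup E] [NormedSpace ℂ E] [CompleteSpace E]
      [Module C(X, ℂ) E] [CStarModule C(X, ℂ) E]
      (π : A →⋆ₙₐ[ℂ] CX.Adj C(X, ℂ) E), CX.IsFieldOfFaithfulReps π →
      ∃ Ψ : CX.MinTensor X A B →⋆ₙₐ[ℂ] CX.Adj Bᵐᵒᵖ (CX.IntTensor X E B),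
        (∀ (a : A) (b : B) (ξ : E) (c : B),
          (Ψ (CX.MinTensor.tmul X a b)).1 (CX.IntTensor.tmul X ξ c) =
            CX.IntTensor.tmul X ((π a).1 ξ) (b * c)) ∧
        Function.Injective Ψ ∧
        ∀ (f : C(X, ℂ)) (d : CX.MinTensor X A B) (z : CX.IntTensor X E B),
          (Ψ (CX.act f d)).1 z = CX.IntTensor.actL f ((Ψ d).1 z)) ∧
    -- the minimal tensor product of separable continuous fields is associative
    (∀ (A₁ : Type*) [NonUnitalCStarAlgebra A₁] [CX.CXAlgebra X A₁]
      [TopologicalSpace.SeparableSpace A₁]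
      (A₂ : Type*) [NonUnitalCStarAlgebra A₂] [CX.CXAlgebra X A₂]
      [TopologicalSpace.SeparableSpace A₂]
      (A₃ : Type*) [NonUnitalCStarAlgebra A₃] [CX.CXAlgebra X A₃]
      [TopologicalSpace.SeparableSpace A₃],
      CX.IsContinuousField X A₁ → CX.IsContinuousField X A₂ → CX.IsContinuousField X A₃ →
      ∃ Φ : CX.MinTensor X (CX.MinTensor X A₁ A₂) A₃ ≃⋆ₐ[ℂ]
          CX.MinTensor X A₁ (CX.MinTensor X A₂ A₃),
        (∀ (a₁ : A₁) (a₂ : A₂) (a₃ : A₃),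
          Φ (CX.MinTensor.tmul X (CX.MinTensor.tmul X a₁ a₂) a₃) =
            CX.MinTensor.tmul X a₁ (CX.MinTensor.tmul X a₂ a₃)) ∧
        ∀ (f : C(X, ℂ)) (d : CX.MinTensor X (CX.MinTensor X A₁ A₂) A₃),
          Φ (CX.act f d) = CX.act f (Φ d)) := by 
  refine ⟨fun A _ _ B _ _ _ _ E _ _ _ _ _ π hπ => ⟨CX.minIntRep hπ, fun a b ξ c =>
    CX.minIntOp_tmul_tmul hπ a b c ξ,
    CX.minIntRep_injective hπ, CX.minIntOp_act hπ⟩, fun A₁ _ _ _ A₂ _ _ _ A₃ _ _ _ h₁ _ h₃ =>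
    ⟨CX.assocStarAlgEquiv h₁ h₃, CX.assocIsom_tmul h₁ h₃, CX.assocIsom_act h₁ h₃⟩⟩
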